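/- Let $G=\mathrm{PGL}_2(\mathbb R)=\mathrm{SL}_2^{\pm}(\mathbb R)/\{\pm1\}$, $K=\mathrm{PO}(2)$, $A=\{a_t=\mathrm{diag}(e^t,e^{-t}):t\in\mathbb R\}$, $N$ the group of upper triangular unipotent matrices, and $M=\{1,T\}$ with $T=\mathrm{diag}(-1,1)$. Let $\mathfrak g=\mathfrak{sl}_2(\mathbb C)$ be the complexified Lie algebra of $G$ and $\mathfrak n$ that of $N$, so $\dim\mathfrak n=1$. Write $a_t^{2\lambda\rho}=e^{2\lambda t}$ for $\lambda\in\mathbb C$ (so $a_t^{\rho}=e^{t}$). For a character $\sigma$ of $M$ let $\sigma\otimes\mathbb C_{2\lambda\rho}$ be the one-dimensional $AM$-module on which $am$ acts by $\sigma(m)a^{2\lambda\rho}$; $\det$ denotes the nontrivial character of $M$, which is also the character $g\mapsto\operatorname{sign}\det g$ of $G$. Consider the following $(\mathfrak g,K)$-modules, up to isomorphism. * $\pi_{\sigma,2\lambda\rho}$ ($\sigma\in\widehat M$, $\lambda\in\mathbb C$): the $K$-finite smooth functions $f:G\to\mathbb C$ with $f(manx)=\sigma(m)a^{2\lambda\rho+\rho}f(x)$,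 under right translation. * $\sigma\otimes\delta_{2k}$ ($k\ge0$): $\delta_{2k}$ is the space of homogeneous polynomials of degree $2k$ in $X,Y$ with $\delta_{2k}(g)p(X,Y)=p((X,Y)g)$ for $g\in\mathrm{SL}_2^{\pm}(\mathbb R)$, and $\sigma\otimes\delta_{2k}$ is $\delta_{2k}$ if $\sigma=1$ and $\det\otimes\delta_{2k}$ if $\sigma\neq1$. * $\mathcal D_{n+1}$ ($n\ge1$ odd): the discrete series representation, i.e. the unique irreducible $(\mathfrak g,K)$-submodule of $\pi_{1,n\rho}$. For a $(\mathfrak g,K)$-module $\pi$ let $H^p(\mathfrak n,\pi)$, $p=0,1$, be Lie algebra cohomology (the cohomology of $\pi\to\mathrm{Hom}(\mathfrak n,\pi)$; it vanishes for $p\ge2$), with its natural action of $\mathfrak a$ and $M$; where it is finite-dimensional it is an $AM$-module, $\exp(Z)\in A$ acting by the exponential of the action of $Z\in\mathfrak a$. For $\tau\in\widehat M$, $\mu\in\mathbb C$ and an $AM$-module $W$ let $W^\tau_{2\mu\rho}$ be the space of $v\in W$ for which there is $j$ with $(am-\tau(m)a^{2\mu\rho})^jv=0$ for all $am\in AM$,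 and put $$L^\tau_{2\mu\rho}(\pi)=\sum_{q=0}^{1}(-1)^{q+1}\dim H^q(\mathfrak n,\pi)^\tau_{2\mu\rho}.$$ Then, with $[P]=1$ if $P$ holds and $[P]=0$ otherwise: 1. $H^0(\mathfrak n,\pi_{\sigma,2\lambda\rho})=0$ if and only if $\lambda$ is not of the form $-n/2$ with $n\in\mathbb N$ odd. If $\lambda\notin\frac12+\mathbb Z$ and $\lambda\ne0$, then, as $AM$-modules, $H^1(\mathfrak n,\pi_{\sigma,2\lambda\rho})\cong(\sigma\det)\otimes\mathbb C_{2\lambda\rho-\rho}\ \oplus\ (\sigma\det)\otimes\mathbb C_{-2\lambda\rho-\rho}$. If $\lambda=0$, then $H^1(\mathfrak n,\pi_{\sigma,0})\cong\big((\sigma\det)\otimes\mathbb C_{-\rho}\big)\otimes U$, where $U=\mathbb C^2$ with $a_tm$ acting by $\begin{pmatrix}1&t\\0&1\end{pmatrix}$ (so both composition factors are $(\sigma\det)\otimes\mathbb C_{-\rho}$, but the extension does not split). For all $\lambda\notin\frac12+\mathbb Z$, $$L^\tau_{2\mu\rho}(\pi_{\sigma,2\lambda\rho})=[\tau=\sigma\det,\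 \mu=\lambda-\tfrac12]+[\tau=\sigma\det,\ \mu=-\lambda-\tfrac12].$$ 2. $H^0(\mathfrak n,\sigma\otimes\delta_{2k})\cong\sigma\otimes\mathbb C_{2k\rho}$, $\ H^1(\mathfrak n,\sigma\otimes\delta_{2k})\cong(\sigma\det)\otimes\mathbb C_{-2k\rho-2\rho}$, and $$L^\tau_{2\mu\rho}(\sigma\otimes\delta_{2k})=[\tau=\sigma\det,\ \mu=-k-1]-[\tau=\sigma,\ \mu=k].$$ 3. $H^0(\mathfrak n,\mathcal D_{n+1})=0$, $\ H^1(\mathfrak n,\mathcal D_{n+1})\cong\big(\det\otimes\,\mathbb C_{n\rho-\rho}\big)\oplus\mathbb C_{n\rho-\rho}$, and $L^\tau_{2\mu\rho}(\mathcal D_{n+1})=[\mu=\tfrac{n-1}2]$ for both characters $\tau$ of $M$. -/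

import Mathlib

noncomputable section

open scoped MatrixGroups ContDiff

namespace PGLTwo

attribute [local instance] LieRing.ofAssociativeRing LieAlgebra.ofAssociativeAlgebra

/-- The group `G = PGL₂(ℝ)`. -/
abbrev G : Type := PGL(2, ℝ)

/-- Real `2 × 2` matrices. -/
abbrev Mat : Type := Matrix (Fin 2) (Fin 2) ℝ

/-- The complexified Lie algebra `𝔤 = 𝔰𝔩₂(ℂ)` of `G`. -/
abbrev sl2 : LieSubalgebra ℂ (Matrix (Fin 2) (Fin 2) ℂ) :=
  LieAlgebra.SpecialLinear.sl (Fin 2) ℂ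

/-- The element of `PGL₂(ℝ)` represented by an invertible matrix. -/
def cls (g : Mat) (h : g.det ≠ 0) : G :=
  Matrix.ProjGenLinGroup.mk (Matrix.GeneralLinearGroup.mkOfDetNeZero g h)

/-- The class of the matrix exponential `exp X` in `G`. -/
def expG (X : Mat) : G :=
  cls (NormedSpace.exp X)
    (((Matrix.isUnit_iff_isUnit_det _).mp (Matrix.isUnit_exp X)).ne_zero)

/-- The inclusion `GL₂(ℝ) ⊂ GL₂(ℂ)`. -/
def complexify (g : GL (Fin 2) ℝ) : GL (Fin 2) ℂ :=
  Matrix.GeneralLinearGroup.map Complex.ofRealHom g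

/-- `GL₂(ℝ)` acts on `𝔰𝔩₂(ℂ)` by conjugation. -/
def AdGL : GL (Fin 2) ℝ →* Module.End ℂ sl2 where
  toFun g :=
    { toFun := fun X => ⟨(complexify g).1 * X.1 * (complexify g)⁻¹.1, by
        have h : Matrix.trace X.1 = 0 := X.2
        change Matrix.trace (_ : Matrix (Fin 2) (Fin 2) ℂ) = 0
        rw [Matrix.trace_mul_comm, ← mul_assoc]
        simpa using h⟩
      map_add' := fun X Y => by ext1; simp [mul_add, add_mul]
      map_smul' := fun c X => by ext1; simp }
  map_one' := by ext1 X; ext1; simp [complexify]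
  map_mul' g h := by
    ext1 X; ext1
    simp only [complexify, map_mul, mul_inv_rev, Units.val_mul]
    simp [mul_assoc]

/-- The adjoint action of `G` on `𝔤`. -/
def Ad : G →* Module.End ℂ sl2 :=
  QuotientGroup.lift (Subgroup.center (GL (Fin 2) ℝ)) AdGL (by
    intro z hz
    rw [Matrix.GeneralLinearGroup.center_eq_range_scalar] at hz
    obtain ⟨u, rfl⟩ := hz
    ext1 X; ext1
    change (complexify _).1 * X.1 * (complexify _)⁻¹.1 = X.1
    have : (complexify (Matrix.GeneralLinearGroup.scalar (Fin 2) u)).1 = (u : ℂ) • 1 := by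
      ext i j
      fin_cases i <;> fin_cases j <;> simp [complexify]
    have h2 : (complexify (Matrix.GeneralLinearGroup.scalar (Fin 2) u)).1 * X.1
        = X.1 * (complexify (Matrix.GeneralLinearGroup.scalar (Fin 2) u)).1 := by
      rw [this]; simp
    rw [h2, mul_assoc]
    simp)

/-- The character `g ↦ sign (det g)` of `PGL₂(ℝ)`, that is, the determinant on
`PGL₂(ℝ) = SL₂^±(ℝ) / ±1`. -/
def signDet : G →* ℂˣ :=
  QuotientGroup.lift (Subgroup.center (GL (Fin 2) ℝ))
    ((Units.map (SignType.castHom (α := ℂ)).toMonoidHom).comp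
      ((Units.map (signHom (α := ℝ)).toMonoidHom).comp Matrix.GeneralLinearGroup.det)) (by
    intro z hz
    rw [Matrix.GeneralLinearGroup.center_eq_range_scalar] at hz
    obtain ⟨u, rfl⟩ := hz
    ext1
    rcases lt_or_gt_of_ne u.ne_zero with h | h
    · simp [sign_neg h]
    · simp [sign_pos h])


/-! ### Smooth functions on the group -/

lemma det_exp_ne (X : Mat) : (NormedSpace.exp X).det ≠ 0 :=
  ((Matrix.isUnit_iff_isUnit_det _).mp (Matrix.isUnit_exp X)).ne_zero

section

open scoped Matrix.Norms.Operator

lemma hasDerivAt_exp_entry (X : Mat) (i j : Fin 2) :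
    HasDerivAt (fun t : ℝ => NormedSpace.exp (t • X) i j) (X i j) 0 := by
  have h := (LinearMap.toContinuousLinearMap
    (Matrix.entryLinearMap ℝ ℝ i j)).hasFDerivAt.comp_hasDerivAt (0 : ℝ)
    (hasDerivAt_exp_smul_const (𝕂 := ℝ) (𝔸 := Matrix (Fin 2) (Fin 2) ℝ) X 0)
  rw [zero_smul, NormedSpace.exp_zero, one_mul] at h
  exact h

end

/-- The coordinate space `ℝ⁴` of real `2 × 2` matrices. -/
abbrev Coord : Type := Fin 2 → Fin 2 → ℝ

/-- A function on `G`, pulled back to the open set of invertible matrices (and extended by `0`). -/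
def pullback (f : G → ℂ) : Coord → ℂ :=
  fun g => if h : (Matrix.of g).det ≠ 0 then f (cls (Matrix.of g) h) else 0

/-- Smooth functions on `G`: the pull-back to `GL₂(ℝ)`, an open subset of `ℝ⁴`, is smooth. -/
def IsSmooth (f : G → ℂ) : Prop :=
  ContDiffOn ℝ ∞ (pullback f) {g : Coord | (Matrix.of g).det ≠ 0}

lemma isOpen_det : IsOpen {g : Coord | (Matrix.of g).det ≠ 0} := by
  have : Continuous fun g : Coord => (Matrix.of g).det := by
    simp only [Matrix.det_fin_two, Matrix.of_apply]
    fun_prop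
  exact isOpen_ne.preimage this

lemma pullback_of {f : G → ℂ} {g : Mat} (h : g.det ≠ 0) :
    pullback f (Matrix.of.symm g) = f (cls g h) := by
  simp [pullback, h]

lemma cls_mul {g h : Mat} (hg : g.det ≠ 0) (hh : h.det ≠ 0) (hgh : (g * h).det ≠ 0) :
    cls (g * h) hgh = cls g hg * cls h hh := by
  unfold cls
  rw [← map_mul]
  congr 1
  ext1
  rfl

lemma exists_cls (x : G) : ∃ g h, x = cls g h := by
  obtain ⟨g, rfl⟩ := Matrix.ProjGenLinGroup.mk_surjective x
  have hd : g.1.det ≠ 0 := ((Matrix.isUnit_iff_isUnit_det _).mp g.isUnit).ne_zero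
  refine ⟨g.1, hd, ?_⟩
  unfold cls
  congr 1
  ext1
  rfl

/-- The derivative of right translation, `(X f)(x) = d/dt f(x exp(tX))` at `t = 0`. -/
def deriveReal (X : Mat) (f : G → ℂ) : G → ℂ :=
  fun x => deriv (fun t : ℝ => f (x * expG (t • X))) 0

/-- Right multiplication by a matrix, in coordinates. -/
def rmul (X : Mat) : Coord →L[ℝ] Coord :=
  LinearMap.toContinuousLinearMap
    { toFun := fun g => Matrix.of.symm (Matrix.of g * X)
      map_add' := fun g h => by ext i j; simp [Matrix.mul_apply]; ring
      map_smul' := fun c g => by ext i j; simp [Matrix.mul_apply]; ring }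

lemma rmul_apply (X : Mat) (g : Coord) : rmul X g = Matrix.of.symm (Matrix.of g * X) := rfl

lemma rmul_rmul (X Y : Mat) (g : Coord) : rmul Y (rmul X g) = rmul (X * Y) g := by
  simp [rmul_apply, mul_assoc]

lemma IsSmooth.differentiableAt {f : G → ℂ} (hf : IsSmooth f) {g : Coord}
    (hg : (Matrix.of g).det ≠ 0) : DifferentiableAt ℝ (pullback f) g :=
  (hf.contDiffAt (isOpen_det.mem_nhds hg)).differentiableAt (by simp)

lemma IsSmooth.hasDerivAt {f : G → ℂ} (hf : IsSmooth f) {g : Mat} (hg : g.det ≠ 0) (X : Mat) :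
    HasDerivAt (fun t : ℝ => f (cls g hg * expG (t • X)))
      (fderiv ℝ (pullback f) (Matrix.of.symm g) (rmul X (Matrix.of.symm g))) 0 := by
  have h1 : (fun t : ℝ => f (cls g hg * expG (t • X)))
      = fun t : ℝ => pullback f (Matrix.of.symm (g * NormedSpace.exp (t • X))) := by
    funext t
    have hd : (g * NormedSpace.exp (t • X)).det ≠ 0 := by
      rw [Matrix.det_mul]; exact mul_ne_zero hg (det_exp_ne _)
    rw [pullback_of hd, cls_mul hg (det_exp_ne _) hd]
    rfl
  rw [h1]
  have h2 : HasDerivAt (fun t : ℝ => Matrix.of.symm (g * NormedSpace.exp (t • X)))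
      (rmul X (Matrix.of.symm g)) 0 := by
    refine hasDerivAt_pi.2 fun i => hasDerivAt_pi.2 fun j => ?_
    simp only [rmul_apply, Matrix.of_symm_apply, Matrix.mul_apply]
    exact HasDerivAt.fun_sum fun k _ => (hasDerivAt_exp_entry X k j).const_mul _
  have h3 : HasFDerivAt (pullback f) (fderiv ℝ (pullback f) (Matrix.of.symm g))
      ((fun t : ℝ => Matrix.of.symm (g * NormedSpace.exp (t • X))) 0) := by
    simpa using (hf.differentiableAt (g := Matrix.of.symm g) hg).hasFDerivAt
  exact h3.comp_hasDerivAt 0 h2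

lemma deriveReal_cls {f : G → ℂ} (hf : IsSmooth f) {g : Mat} (hg : g.det ≠ 0) (X : Mat) :
    deriveReal X f (cls g hg)
      = fderiv ℝ (pullback f) (Matrix.of.symm g) (rmul X (Matrix.of.symm g)) :=
  (hf.hasDerivAt hg X).deriv

lemma pullback_deriveReal {f : G → ℂ} (hf : IsSmooth f) {g : Coord}
    (hg : (Matrix.of g).det ≠ 0) (X : Mat) :
    pullback (deriveReal X f) g = fderiv ℝ (pullback f) g (rmul X g) := by
  have := pullback_of (f := deriveReal X f) hg
  rw [deriveReal_cls hf hg] at this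
  simpa using this

lemma IsSmooth.fderiv {f : G → ℂ} (hf : IsSmooth f) :
    ContDiffOn ℝ ∞ (fderiv ℝ (pullback f)) {g : Coord | (Matrix.of g).det ≠ 0} :=
  ContDiffOn.fderiv_of_isOpen hf isOpen_det (by simp)

lemma IsSmooth.derive {f : G → ℂ} (hf : IsSmooth f) (X : Mat) : IsSmooth (deriveReal X f) := by
  have h2 : ContDiffOn ℝ ∞ (fun g => _root_.fderiv ℝ (pullback f) g (rmul X g))
      {g : Coord | (Matrix.of g).det ≠ 0} :=
    hf.fderiv.clm_apply (rmul X).contDiff.contDiffOn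
  exact h2.congr fun g hg => pullback_deriveReal hf hg X

lemma deriveReal_bracket {f : G → ℂ} (hf : IsSmooth f) (X Y : Mat) :
    deriveReal (X * Y - Y * X) f
      = deriveReal X (deriveReal Y f) - deriveReal Y (deriveReal X f) := by
  funext x
  obtain ⟨g, hg, rfl⟩ := exists_cls x
  set c : Coord := Matrix.of.symm g with hc
  have hg' : (Matrix.of c).det ≠ 0 := hg
  have key : ∀ X Y : Mat, deriveReal X (deriveReal Y f) (cls g hg)
      = fderiv ℝ (fderiv ℝ (pullback f)) c (rmul X c) (rmul Y c)
        + fderiv ℝ (pullback f) c (rmul (X * Y) c) := by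
    intro X Y
    rw [deriveReal_cls (hf.derive Y) hg]
    have he : pullback (deriveReal Y f) =ᶠ[nhds c]
        fun g => fderiv ℝ (pullback f) g (rmul Y g) := by
      filter_upwards [isOpen_det.mem_nhds hg'] with g' hg'
      exact pullback_deriveReal hf hg' Y
    rw [he.fderiv_eq]
    have hd : DifferentiableAt ℝ (fderiv ℝ (pullback f)) c :=
      (hf.fderiv.contDiffAt (isOpen_det.mem_nhds hg')).differentiableAt (by simp)
    rw [fderiv_clm_apply hd (rmul Y).differentiableAt]
    simp [rmul_rmul, add_comm, hc]
  have hs : IsSymmSndFDerivAt ℝ (pullback f) c :=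
    (hf.contDiffAt (isOpen_det.mem_nhds hg')).isSymmSndFDerivAt (by
      simp only [minSmoothness_of_isRCLikeNormedField]; exact WithTop.coe_le_coe.2 (le_top : (2 : ℕ∞) ≤ ⊤))
  rw [Pi.sub_apply, key, key, deriveReal_cls hf hg, hs.eq (rmul X c) (rmul Y c)]
  have : rmul (X * Y - Y * X) c = rmul (X * Y) c - rmul (Y * X) c := by
    simp [rmul_apply, mul_sub]; rfl
  rw [this, map_sub]
  ring

lemma deriveReal_add_left {f : G → ℂ} (hf : IsSmooth f) (X Y : Mat) :
    deriveReal (X + Y) f = deriveReal X f + deriveReal Y f := by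
  funext x
  obtain ⟨g, hg, rfl⟩ := exists_cls x
  rw [Pi.add_apply, deriveReal_cls hf hg, deriveReal_cls hf hg, deriveReal_cls hf hg, ← map_add]
  congr 1
  simp [rmul_apply, mul_add]; rfl

lemma deriveReal_smul_left {f : G → ℂ} (hf : IsSmooth f) (c : ℝ) (X : Mat) :
    deriveReal (c • X) f = (c : ℂ) • deriveReal X f := by
  funext x
  obtain ⟨g, hg, rfl⟩ := exists_cls x
  rw [Pi.smul_apply, deriveReal_cls hf hg, deriveReal_cls hf hg, Complex.coe_smul, ← map_smul]
  congr 1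
  simp [rmul_apply]; rfl

lemma deriveReal_add {f h : G → ℂ} (hf : IsSmooth f) (hh : IsSmooth h) (X : Mat) :
    deriveReal X (f + h) = deriveReal X f + deriveReal X h := by
  funext x
  obtain ⟨g, hg, rfl⟩ := exists_cls x
  exact (((hf.hasDerivAt hg X).add (hh.hasDerivAt hg X)).deriv).trans (by
    rw [Pi.add_apply, deriveReal_cls hf hg, deriveReal_cls hh hg])

lemma deriveReal_smul {f : G → ℂ} (hf : IsSmooth f) (c : ℂ) (X : Mat) :
    deriveReal X (c • f) = c • deriveReal X f := by
  funext x
  obtain ⟨g, hg, rfl⟩ := exists_cls x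
  exact (((hf.hasDerivAt hg X).const_smul c).deriv).trans (by
    rw [Pi.smul_apply, deriveReal_cls hf hg])

lemma pullback_add (f h : G → ℂ) : pullback (f + h) = pullback f + pullback h := by
  funext g; by_cases hg : (Matrix.of g).det ≠ 0 <;> simp [pullback, hg]

lemma pullback_smul (c : ℂ) (f : G → ℂ) : pullback (c • f) = c • pullback f := by
  funext g; by_cases hg : (Matrix.of g).det ≠ 0 <;> simp [pullback, hg]

/-- The space `C^∞(G)` as a subspace of all functions. -/
def smoothSubmodule : Submodule ℂ (G → ℂ) where
  carrier := {f | IsSmooth f}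
  zero_mem' := by
    have : pullback (0 : G → ℂ) = 0 := by
      funext g; by_cases hg : (Matrix.of g).det ≠ 0 <;> simp [pullback, hg]
    change ContDiffOn _ _ _ _
    rw [this]; exact contDiffOn_const
  add_mem' := fun {f h} hf hh => by
    change ContDiffOn _ _ _ _
    rw [pullback_add]; exact ContDiffOn.add hf hh
  smul_mem' := fun c f hf => by
    change ContDiffOn _ _ _ _
    rw [pullback_smul]; exact ContDiffOn.const_smul c hf

/-- The vector space `C^∞(G)`. -/
def smoothFun : Type := smoothSubmodule

instance : AddCommGroup smoothFun := inferInstanceAs (AddCommGroup smoothSubmodule)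

instance : Module ℂ smoothFun := inferInstanceAs (Module ℂ smoothSubmodule)

/-- The function underlying an element of `C^∞(G)`. -/
def smoothFun.toFun : smoothFun →ₗ[ℂ] G → ℂ := smoothSubmodule.subtype

instance : CoeFun smoothFun fun _ => G → ℂ := ⟨fun f => smoothFun.toFun f⟩

lemma smoothFun.isSmooth (f : smoothFun) : IsSmooth f := f.2

/-- The element of `C^∞(G)` given by a smooth function. -/
def smoothFun.mk (f : G → ℂ) (hf : IsSmooth f) : smoothFun := ⟨f, hf⟩

lemma smoothFun.ext {f h : smoothFun} (hfh : ∀ x, f x = h x) : f = h :=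
  Subtype.ext (funext hfh)

/-- Right translation `(y f)(x) = f(x y)` on `C^∞(G)`. -/
def rightTranslate : G →* Module.End ℂ smoothFun where
  toFun y :=
    { toFun := fun f => smoothFun.mk (fun x => f (x * y)) (by
        obtain ⟨h, hh, rfl⟩ := exists_cls y
        have hf : IsSmooth f := f.2
        have h1 : ContDiffOn ℝ ∞ (pullback f ∘ rmul h) {g : Coord | (Matrix.of g).det ≠ 0} := by
          refine ContDiffOn.comp hf (rmul h).contDiff.contDiffOn ?_
          intro g hg
          simpa [rmul_apply, hh] using hg
        refine h1.congr ?_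
        intro g hg
        have hd : (Matrix.of g * h).det ≠ 0 := by
          rw [Matrix.det_mul]; exact mul_ne_zero hg hh
        rw [Function.comp_apply, rmul_apply, pullback_of hd, cls_mul hg hh hd]
        have := pullback_of (f := fun x => f (x * cls h hh)) hg
        simpa using this)
      map_add' := fun f h => rfl
      map_smul' := fun c f => rfl }
  map_one' := LinearMap.ext fun f => smoothFun.ext fun x => congrArg f (mul_one x)
  map_mul' y z := LinearMap.ext fun f => smoothFun.ext fun x =>
    congrArg f (mul_assoc x y z).symm

lemma rightTranslate_apply (y : G) (f : smoothFun) (x : G) :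
    rightTranslate y f x = f (x * y) := rfl

/-- The operator `f ↦ X f` on `C^∞(G)` for a real matrix `X`. -/
def deriveSmooth (X : Mat) : Module.End ℂ smoothFun where
  toFun f := smoothFun.mk (deriveReal X f) (IsSmooth.derive f.2 X)
  map_add' f h := Subtype.ext (deriveReal_add f.2 h.2 X)
  map_smul' c f := Subtype.ext (deriveReal_smul f.2 c X)

/-- The real part of a complex matrix. -/
def reM (X : Matrix (Fin 2) (Fin 2) ℂ) : Mat := X.map Complex.re

/-- The imaginary part of a complex matrix. -/
def imM (X : Matrix (Fin 2) (Fin 2) ℂ) : Mat := X.map Complex.im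

lemma deriveSmooth_add (X Y : Mat) : deriveSmooth (X + Y) = deriveSmooth X + deriveSmooth Y :=
  LinearMap.ext fun f => Subtype.ext (deriveReal_add_left f.2 X Y)

lemma deriveSmooth_smul (c : ℝ) (X : Mat) :
    deriveSmooth (c • X) = (c : ℂ) • deriveSmooth X :=
  LinearMap.ext fun f => Subtype.ext (deriveReal_smul_left f.2 c X)

lemma deriveSmooth_bracket (X Y : Mat) : deriveSmooth (X * Y - Y * X)
    = deriveSmooth X * deriveSmooth Y - deriveSmooth Y * deriveSmooth X :=
  LinearMap.ext fun f => Subtype.ext (deriveReal_bracket f.2 X Y)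

/-- The action of `𝔤 = 𝔰𝔩₂(ℂ)` on `C^∞(G)`: the complex linear extension of the derivative of right
translation. -/
def lieSmooth : sl2 →ₗ⁅ℂ⁆ Module.End ℂ smoothFun where
  toFun X := deriveSmooth (reM X.1) + Complex.I • deriveSmooth (imM X.1)
  map_add' X Y := by
    have h1 : reM (X + Y).1 = reM X.1 + reM Y.1 := by ext; simp [reM]
    have h2 : imM (X + Y).1 = imM X.1 + imM Y.1 := by ext; simp [imM]
    rw [h1, h2, deriveSmooth_add, deriveSmooth_add]
    module
  map_smul' c X := by
    have h1 : reM (c • X).1 = c.re • reM X.1 + (-c.im) • imM X.1 := by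
      ext; simp [reM, imM]; ring
    have h2 : imM (c • X).1 = c.re • imM X.1 + c.im • reM X.1 := by
      ext; simp [reM, imM]
    rw [h1, h2, deriveSmooth_add, deriveSmooth_add]
    simp only [deriveSmooth_smul, RingHom.id_apply]
    nth_rw 5 [← Complex.re_add_im c]
    have hI := Complex.I_mul_I
    have e : ((c.re : ℂ) + c.im * Complex.I) * Complex.I = c.re * Complex.I - c.im := by
      linear_combination (c.im : ℂ) * hI
    rw [smul_add _ _ (Complex.I • _), smul_smul _ Complex.I, e]
    push_cast
    module
  map_lie' {X Y} := by
    have h1 : reM ⁅X, Y⁆.1 = (reM X.1 * reM Y.1 - reM Y.1 * reM X.1)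
        + (-1 : ℝ) • (imM X.1 * imM Y.1 - imM Y.1 * imM X.1) := by
      rw [LieAlgebra.SpecialLinear.sl_bracket]
      ext; simp [reM, imM, Matrix.mul_apply]; ring
    have h2 : imM ⁅X, Y⁆.1 = (reM X.1 * imM Y.1 - imM Y.1 * reM X.1)
        + (imM X.1 * reM Y.1 - reM Y.1 * imM X.1) := by
      rw [LieAlgebra.SpecialLinear.sl_bracket]
      ext; simp [reM, imM, Matrix.mul_apply]; ring
    change deriveSmooth _ + _ • deriveSmooth _ = _
    rw [h1, h2, deriveSmooth_add, deriveSmooth_add, deriveSmooth_smul]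
    simp only [deriveSmooth_bracket, Ring.lie_def, add_mul, mul_add, smul_mul_assoc,
      mul_smul_comm]
    push_cast
    match_scalars <;> ring_nf <;> simp [Complex.I_sq]

/-! ### `(𝔤, K)`-modules -/

/-- The orthogonal group `O(2)` inside `GL₂(ℝ)`. -/
def O2 : Subgroup (GL (Fin 2) ℝ) where
  carrier := {g : GL (Fin 2) ℝ | g.1 ∈ Matrix.orthogonalGroup (Fin 2) ℝ}
  one_mem' := by simp [one_mem]
  mul_mem' := fun {a b} ha hb => (Matrix.orthogonalGroup (Fin 2) ℝ).mul_mem ha hb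
  inv_mem' := fun {a} ha => by
    have h1 : a.1 * star a.1 = 1 := Matrix.mem_unitaryGroup_iff.mp ha
    have h2 : a⁻¹.1 = star a.1 := by
      calc a⁻¹.1 = a⁻¹.1 * (a.1 * star a.1) := by rw [h1, mul_one]
        _ = star a.1 := by rw [← mul_assoc, Units.inv_mul, one_mul]
    change a⁻¹.1 ∈ Matrix.orthogonalGroup (Fin 2) ℝ
    rw [h2]
    exact Unitary.star_mem ha

/-- The maximal compact subgroup `K = PO(2)` of `PGL₂(ℝ)`. -/
def K : Subgroup G := O2.map Matrix.ProjGenLinGroup.mk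

/-- The generator of the Lie algebra of `K`. -/
def J : Mat := !![0, -1; 1, 0]

lemma expG_J_mem (t : ℝ) : expG (t • J) ∈ K := by
  refine ⟨Matrix.GeneralLinearGroup.mkOfDetNeZero (NormedSpace.exp (t • J)) (det_exp_ne _), ?_, rfl⟩
  change NormedSpace.exp (t • J) ∈ Matrix.orthogonalGroup (Fin 2) ℝ
  rw [Matrix.mem_orthogonalGroup_iff, ← Matrix.exp_transpose, ← NormedSpace.exp_zero]
  have hJ : (t • J).transpose = - (t • J) := by
    ext i j; fin_cases i <;> fin_cases j <;> simp [J]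
  rw [hJ, ← Matrix.exp_add_of_commute _ _ (Commute.neg_right (Commute.refl (t • J))),
    add_neg_cancel]

/-- The one-parameter group `exp(tJ)` of rotations in `K`. -/
def rot (t : ℝ) : K := ⟨expG (t • J), expG_J_mem t⟩

/-- The generator of the Lie algebra of `K`, as an element of `𝔤`. -/
def Jsl : sl2 := ⟨!![0, -1; 1, 0], by
  change Matrix.trace (_ : Matrix (Fin 2) (Fin 2) ℂ) = 0; simp [Matrix.trace_fin_two]⟩

/-- The generator `diag(1, -1)` of `𝔞`. -/
def H : sl2 := ⟨!![1, 0; 0, -1], by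
  change Matrix.trace (_ : Matrix (Fin 2) (Fin 2) ℂ) = 0; simp [Matrix.trace_fin_two]⟩

/-- The generator of `𝔫`. -/
def E : sl2 := ⟨!![0, 1; 0, 0], by
  change Matrix.trace (_ : Matrix (Fin 2) (Fin 2) ℂ) = 0; simp [Matrix.trace_fin_two]⟩

/-- A `(𝔤, K)`-module for `G = PGL₂(ℝ)`: a complex vector space with a complex linear action of
`𝔤 = 𝔰𝔩₂(ℂ)` and an action of `K = PO(2)`, compatible with the adjoint action, such that every
vector is `K`-finite and the derivative of the action of `K` is the action of its Lie algebra.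
(Differentiability is tested against linear functionals; by local finiteness only finite-dimensional
spaces matter.) -/
structure GKModule (V : Type*) [AddCommGroup V] [Module ℂ V] where
  lie : sl2 →ₗ⁅ℂ⁆ Module.End ℂ V
  act : K →* Module.End ℂ V
  act_lie : ∀ (k : K) (X : sl2) (v : V), act k (lie X v) = lie (Ad k X) (act k v)
  locallyFinite : ∀ v : V, FiniteDimensional ℂ (Submodule.span ℂ (Set.range fun k : K => act k v))
  hasDerivAt : ∀ (v : V) (ℓ : V →ₗ[ℂ] ℂ),
    HasDerivAt (fun t : ℝ => ℓ (act (rot t) v)) (ℓ (lie Jsl v)) 0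

/-- Isomorphism of `(𝔤, K)`-modules (infinitesimal equivalence). -/
def GKModule.IsIso {V W : Type*} [AddCommGroup V] [Module ℂ V] [AddCommGroup W] [Module ℂ W]
    (π : GKModule V) (τ : GKModule W) : Prop :=
  ∃ e : V ≃ₗ[ℂ] W, (∀ X v, e (π.lie X v) = τ.lie X (e v)) ∧ ∀ k v, e (π.act k v) = τ.act k (e v)

/-- A subspace is a `(𝔤, K)`-submodule. -/
def GKModule.IsStable {V : Type*} [AddCommGroup V] [Module ℂ V] (π : GKModule V)
    (S : Submodule ℂ V) : Prop :=
  (∀ X, ∀ v ∈ S, π.lie X v ∈ S) ∧ ∀ k, ∀ v ∈ S, π.act k v ∈ S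

lemma finiteDimensional_span_of_map {V W : Type*} [AddCommGroup V] [Module ℂ V]
    [AddCommGroup W] [Module ℂ W] {ι : Type*} (f : V →ₗ[ℂ] W) (hf : Function.Injective f)
    (v : ι → V) (h : FiniteDimensional ℂ (Submodule.span ℂ (Set.range fun i => f (v i)))) :
    FiniteDimensional ℂ (Submodule.span ℂ (Set.range v)) := by
  have h1 : (Submodule.span ℂ (Set.range v)).map f
      = Submodule.span ℂ (Set.range fun i => f (v i)) := by
    rw [Submodule.map_span, ← Set.range_comp]; rfl
  rw [← h1] at h
  exact Module.Finite.equiv (Submodule.equivMapOfInjective f hf _).symm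

/-- A `(𝔤, K)`-submodule as a `(𝔤, K)`-module. -/
def GKModule.restrict {V : Type*} [AddCommGroup V] [Module ℂ V] (π : GKModule V)
    (S : Submodule ℂ V) (hS : π.IsStable S) : GKModule S where
  lie :=
    { toFun := fun X => (π.lie X).restrict (hS.1 X)
      map_add' := fun X Y => by ext v; simp
      map_smul' := fun c X => by ext v; simp
      map_lie' := fun {X Y} => by ext v; simp [Ring.lie_def] }
  act :=
    { toFun := fun k => (π.act k).restrict (hS.2 k)
      map_one' := by ext v; simp
      map_mul' := fun k l => by ext v; simp }
  act_lie k X v := Subtype.ext (π.act_lie k X v)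
  locallyFinite v := finiteDimensional_span_of_map S.subtype S.injective_subtype _
    (π.locallyFinite v)
  hasDerivAt v ℓ := by
    obtain ⟨L, hL⟩ := LinearMap.exists_extend ℓ
    subst hL
    exact π.hasDerivAt v.1 L

/-! ### `K`-finite smooth functions -/

/-- `f` is `K`-finite: its `K`-translates span a finite-dimensional space. -/
def IsKFinite (f : smoothFun) : Prop :=
  FiniteDimensional ℂ (Submodule.span ℂ (Set.range fun k : K => rightTranslate k f))

lemma rightTranslate_deriveSmooth (g : GL (Fin 2) ℝ) (Y : Mat) (f : smoothFun) :
    rightTranslate (Matrix.ProjGenLinGroup.mk g) (deriveSmooth Y f)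
      = deriveSmooth (g.1 * Y * g⁻¹.1) (rightTranslate (Matrix.ProjGenLinGroup.mk g) f) := by
  refine smoothFun.ext fun x => ?_
  change deriv (fun t : ℝ => f (x * Matrix.ProjGenLinGroup.mk g * expG (t • Y))) 0
    = deriv (fun t : ℝ => f (x * expG (t • (g.1 * Y * g⁻¹.1)) * Matrix.ProjGenLinGroup.mk g)) 0
  refine congrArg (fun φ : ℝ → ℂ => deriv φ 0) (funext fun t => congrArg (smoothFun.toFun f) ?_)
  rw [mul_assoc, mul_assoc]
  refine congrArg (x * ·) ?_
  unfold expG cls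
  rw [← map_mul, ← map_mul]
  refine congrArg Matrix.ProjGenLinGroup.mk (Units.ext ?_)
  change g.1 * NormedSpace.exp (t • Y) = NormedSpace.exp (t • (g.1 * Y * g⁻¹.1)) * g.1
  have : t • (g.1 * Y * g⁻¹.1) = g.1 * (t • Y) * g⁻¹.1 := by simp
  rw [this, Matrix.exp_units_conj]
  simp [mul_assoc]

lemma Ad_mk (g : GL (Fin 2) ℝ) : Ad (Matrix.ProjGenLinGroup.mk g) = AdGL g := rfl

lemma AdGL_val (g : GL (Fin 2) ℝ) (X : sl2) :
    (AdGL g X).1 = g.1.map Complex.ofReal * X.1 * g⁻¹.1.map Complex.ofReal := rfl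

lemma rightTranslate_lieSmooth (y : G) (X : sl2) (f : smoothFun) :
    rightTranslate y (lieSmooth X f) = lieSmooth (Ad y X) (rightTranslate y f) := by
  obtain ⟨g, rfl⟩ := Matrix.ProjGenLinGroup.mk_surjective y
  have h1 : reM (AdGL g X).1 = g.1 * reM X.1 * g⁻¹.1 := by
    rw [AdGL_val]; ext i j; simp [reM, Matrix.mul_apply]
  have h2 : imM (AdGL g X).1 = g.1 * imM X.1 * g⁻¹.1 := by
    rw [AdGL_val]; ext i j; simp [imM, Matrix.mul_apply]
  rw [Ad_mk]
  change rightTranslate _ (deriveSmooth _ f + Complex.I • deriveSmooth _ f)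
    = deriveSmooth (reM (AdGL g X).1) _ + Complex.I • deriveSmooth (imM (AdGL g X).1) _
  rw [h1, h2, map_add, map_smul, rightTranslate_deriveSmooth, rightTranslate_deriveSmooth]

lemma IsKFinite.add {f h : smoothFun} (hf : IsKFinite f) (hh : IsKFinite h) :
    IsKFinite (f + h) := by
  unfold IsKFinite at *
  refine Submodule.finiteDimensional_of_le (S₂ :=
    Submodule.span ℂ (Set.range fun k : K => rightTranslate k f) ⊔
    Submodule.span ℂ (Set.range fun k : K => rightTranslate k h)) ?_
  rw [Submodule.span_le]
  rintro _ ⟨k, rfl⟩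
  simp only [map_add]
  exact Submodule.add_mem_sup (Submodule.subset_span ⟨k, rfl⟩) (Submodule.subset_span ⟨k, rfl⟩)

lemma IsKFinite.smul {f : smoothFun} (hf : IsKFinite f) (c : ℂ) : IsKFinite (c • f) := by
  unfold IsKFinite at *
  refine Submodule.finiteDimensional_of_le (S₂ :=
    Submodule.span ℂ (Set.range fun k : K => rightTranslate k f)) ?_
  rw [Submodule.span_le]
  rintro _ ⟨k, rfl⟩
  simp only [map_smul]
  exact Submodule.smul_mem _ _ (Submodule.subset_span ⟨k, rfl⟩)

lemma IsKFinite.act {f : smoothFun} (hf : IsKFinite f) (l : K) :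
    IsKFinite (rightTranslate l f) := by
  unfold IsKFinite at *
  refine Submodule.finiteDimensional_of_le (S₂ :=
    Submodule.span ℂ (Set.range fun k : K => rightTranslate k f)) ?_
  rw [Submodule.span_le]
  rintro _ ⟨k, rfl⟩
  refine Submodule.subset_span ⟨k * l, ?_⟩
  simp

lemma IsKFinite.lie {f : smoothFun} (hf : IsKFinite f) (X : sl2) :
    IsKFinite (lieSmooth X f) := by
  unfold IsKFinite at *
  let B : sl2 →ₗ[ℂ] smoothFun →ₗ[ℂ] smoothFun := lieSmooth.toLinearMap
  have hB : (Submodule.map₂ B ⊤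
      (Submodule.span ℂ (Set.range fun k : K => rightTranslate k f))).FG :=
    Submodule.FG.map₂ B (Module.Finite.fg_top) (Module.Finite.iff_fg.mp hf)
  have : FiniteDimensional ℂ (Submodule.map₂ B ⊤
      (Submodule.span ℂ (Set.range fun k : K => rightTranslate k f))) :=
    Module.Finite.iff_fg.mpr hB
  refine Submodule.finiteDimensional_of_le (S₂ := Submodule.map₂ B ⊤
      (Submodule.span ℂ (Set.range fun k : K => rightTranslate k f))) ?_
  rw [Submodule.span_le]
  rintro _ ⟨k, rfl⟩
  simp only [rightTranslate_lieSmooth]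
  exact Submodule.apply_mem_map₂ B (m := Ad k X) trivial (Submodule.subset_span ⟨k, rfl⟩)

lemma zero_isKFinite : IsKFinite 0 := by
  have h : (fun k : K => rightTranslate k (0 : smoothFun)) = fun _ => 0 :=
    funext fun k => map_zero _
  unfold IsKFinite
  rw [h]
  exact FiniteDimensional.span_of_finite ℂ Set.finite_range_const

lemma lieSmooth_Jsl (f : smoothFun) : lieSmooth Jsl f = deriveSmooth J f := by
  have h1 : reM Jsl.1 = J := by ext i j; fin_cases i <;> fin_cases j <;> simp [reM, Jsl, J]
  have h2 : imM Jsl.1 = (0 : ℝ) • J := by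
    ext i j; fin_cases i <;> fin_cases j <;> simp [imM, Jsl, J]
  change deriveSmooth _ f + Complex.I • deriveSmooth _ f = _
  rw [h1, h2, deriveSmooth_smul]
  simp

lemma hasDerivAt_eval (f : smoothFun) (x : G) :
    HasDerivAt (fun t : ℝ => rightTranslate (rot t) f x) (lieSmooth Jsl f x) 0 := by
  rw [lieSmooth_Jsl]
  obtain ⟨g, hg, rfl⟩ := exists_cls x
  have := IsSmooth.hasDerivAt f.2 hg J
  have h2 : deriveSmooth J f (cls g hg) = _ := deriveReal_cls f.2 hg J
  rw [h2]
  exact this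

lemma hasDerivAt_rot {f : smoothFun} (hf : IsKFinite f) (ℓ : smoothFun →ₗ[ℂ] ℂ) :
    HasDerivAt (fun t : ℝ => ℓ (rightTranslate (rot t) f)) (ℓ (lieSmooth Jsl f)) 0 := by
  unfold IsKFinite at hf
  let W : Submodule ℂ smoothFun :=
    Submodule.span ℂ (Set.range fun k : K => rightTranslate k f) ⊔
      Submodule.span ℂ {lieSmooth Jsl f}
  have hfin : FiniteDimensional ℂ W := inferInstance
  have hk : ∀ k : K, rightTranslate k f ∈ W := fun k =>
    Submodule.mem_sup_left (Submodule.subset_span ⟨k, rfl⟩)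
  have hl : lieSmooth Jsl f ∈ W :=
    Submodule.mem_sup_right (Submodule.subset_span rfl)
  let ev : G → Module.Dual ℂ W := fun x =>
    (LinearMap.proj x) ∘ₗ smoothFun.toFun ∘ₗ W.subtype
  have hspan : Submodule.span ℂ (Set.range ev) = ⊤ := by
    have h := Subspace.dualCoannihilator_dualAnnihilator_eq
      (W := Submodule.span ℂ (Set.range ev))
    have h0 : (Submodule.span ℂ (Set.range ev)).dualCoannihilator = ⊥ := by
      rw [eq_bot_iff]
      intro w hw
      rw [Submodule.mem_dualCoannihilator] at hw
      refine Submodule.mem_bot ℂ |>.2 (Subtype.ext (smoothFun.ext fun x => ?_))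
      exact hw (ev x) (Submodule.subset_span ⟨x, rfl⟩)
    rw [← h, h0, Submodule.dualAnnihilator_bot]
  have key : ∀ φ : Module.Dual ℂ W, HasDerivAt
      (fun t : ℝ => φ ⟨rightTranslate (rot t) f, hk _⟩) (φ ⟨lieSmooth Jsl f, hl⟩) 0 := by
    intro φ
    have hφ : φ ∈ Submodule.span ℂ (Set.range ev) := by rw [hspan]; trivial
    induction hφ using Submodule.span_induction with
    | mem φ h =>
      obtain ⟨x, rfl⟩ := h
      exact hasDerivAt_eval f x
    | zero => exact hasDerivAt_const _ _
    | add φ ψ _ _ h1 h2 => exact h1.add h2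
    | smul c φ _ h => exact h.const_smul c
  exact key (ℓ ∘ₗ W.subtype)

/-! ### Principal series -/

/-- The element `T = diag(-1, 1)` of `G`. -/
def T : G := cls !![-1, 0; 0, 1] (by simp)

/-- The group `M = {1, T}`. -/
def M : Subgroup G := Subgroup.zpowers T

/-- The elements `diag(e^t, e^{-t})` of `A`. -/
def a (t : ℝ) : G := cls !![Real.exp t, 0; 0, Real.exp (-t)] (by simp)

/-- The elements of `N`. -/
def n (u : ℝ) : G := cls !![1, u; 0, 1] (by simp)

/-- `f(m a n x) = σ(m) a^{2λρ + ρ} f(x)`, where `a^ρ = e^t` for `a = diag(e^t, e^{-t})`. -/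
def IsEquivariant (σ : M →* ℂˣ) (lam : ℂ) (f : G → ℂ) : Prop :=
  ∀ (m : M) (t u : ℝ) (x : G),
    f (m * a t * n u * x) = (σ m : ℂ) * Complex.exp ((2 * lam + 1) * t) * f x

/-- The space of `K`-finite vectors of the induced representation `π_{σ,2λρ}` (these are smooth
functions). -/
def principalSpace (σ : M →* ℂˣ) (lam : ℂ) : Submodule ℂ smoothFun where
  carrier := {f | IsEquivariant σ lam f ∧ IsKFinite f}
  zero_mem' := ⟨fun m t u x => by simp, zero_isKFinite⟩
  add_mem' := fun {f h} hf hh => ⟨fun m t u x => by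
    simp [hf.1 m t u x, hh.1 m t u x, mul_add], hf.2.add hh.2⟩
  smul_mem' := fun c f hf => ⟨fun m t u x => by
    simp [hf.1 m t u x]; ring, hf.2.smul c⟩

lemma IsEquivariant.deriveReal {σ : M →* ℂˣ} {lam : ℂ} {f : G → ℂ}
    (hf : IsEquivariant σ lam f) (X : Mat) : IsEquivariant σ lam (deriveReal X f) := by
  intro m t u x
  unfold PGLTwo.deriveReal
  rw [← deriv_const_mul_field]
  congr 1
  funext s
  rw [mul_assoc _ x, hf m t u]

lemma principalSpace_lie {σ : M →* ℂˣ} {lam : ℂ} (X : sl2) {f : smoothFun}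
    (hf : f ∈ principalSpace σ lam) : lieSmooth X f ∈ principalSpace σ lam := by
  refine ⟨fun m t u x => ?_, hf.2.lie X⟩
  change PGLTwo.deriveReal (reM X.1) f _ + Complex.I * PGLTwo.deriveReal (imM X.1) f _
    = _ * (PGLTwo.deriveReal (reM X.1) f _ + Complex.I * PGLTwo.deriveReal (imM X.1) f _)
  rw [hf.1.deriveReal (reM X.1) m t u x, hf.1.deriveReal (imM X.1) m t u x]
  ring

lemma principalSpace_act {σ : M →* ℂˣ} {lam : ℂ} (k : K) {f : smoothFun}
    (hf : f ∈ principalSpace σ lam) : rightTranslate k f ∈ principalSpace σ lam := by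
  refine ⟨fun m t u x => ?_, hf.2.act k⟩
  rw [rightTranslate_apply, rightTranslate_apply, mul_assoc _ x, hf.1 m t u]

/-- The `(𝔤, K)`-module of the principal series representation `π_{σ,2λρ}`, on which `G` acts by
right translation. -/
def principalSeries (σ : M →* ℂˣ) (lam : ℂ) : GKModule (principalSpace σ lam) where
  lie :=
    { toFun := fun X => (lieSmooth X).restrict (fun _ hf => principalSpace_lie X hf)
      map_add' := fun X Y => by ext1 v; ext1; simp
      map_smul' := fun c X => by ext1 v; ext1; simp
      map_lie' := fun {X Y} => by ext1 v; ext1; simp [Ring.lie_def] }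
  act :=
    { toFun := fun k => (rightTranslate k).restrict (fun _ hf => principalSpace_act k hf)
      map_one' := by ext1 v; ext1; simp
      map_mul' := fun k l => by ext1 v; ext1; simp }
  act_lie k X f := Subtype.ext (rightTranslate_lieSmooth k X f.1)
  locallyFinite f := finiteDimensional_span_of_map (principalSpace σ lam).subtype
    (Submodule.injective_subtype _) _ f.2.2
  hasDerivAt f ℓ := by
    obtain ⟨L, hL⟩ := LinearMap.exists_extend ℓ
    subst hL
    exact hasDerivAt_rot f.2.2 L

/-! ### Discrete series -/

/-- The intersection of all nonzero `(𝔤, K)`-submodules; if it is nonzero, it is the unique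
irreducible submodule. -/
def GKModule.socle {V : Type*} [AddCommGroup V] [Module ℂ V] (π : GKModule V) : Submodule ℂ V :=
  sInf {S | S ≠ ⊥ ∧ π.IsStable S}

lemma GKModule.socle_stable {V : Type*} [AddCommGroup V] [Module ℂ V] (π : GKModule V) :
    π.IsStable π.socle := by
  constructor
  · intro X v hv
    rw [GKModule.socle, Submodule.mem_sInf] at *
    exact fun S hS => hS.2.1 X v (hv S hS)
  · intro k v hv
    rw [GKModule.socle, Submodule.mem_sInf] at *
    exact fun S hS => hS.2.2 k v (hv S hS)

/-- The discrete series representation `D_{n+1}`, for `n` odd: the unique irreducible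
`(𝔤, K)`-submodule of the principal series representation `π_{1,nρ}`. -/
def discreteSeries (n : ℕ) : GKModule (principalSeries 1 (n / 2)).socle :=
  (principalSeries 1 (n / 2)).restrict _ (GKModule.socle_stable _)

/-! ### Finite-dimensional representations -/

open MvPolynomial in
/-- The substitution `p(X, Y) ↦ p((X, Y) g)`. -/
def substPoly (g : Matrix (Fin 2) (Fin 2) ℂ) : MvPolynomial (Fin 2) ℂ →ₐ[ℂ] MvPolynomial (Fin 2) ℂ :=
  aeval fun j => ∑ i, C (g i j) * X i

open MvPolynomial in
lemma substPoly_X (g : Matrix (Fin 2) (Fin 2) ℂ) (j : Fin 2) :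
    substPoly g (X j) = ∑ i, C (g i j) * X i := by simp [substPoly]

open MvPolynomial in
lemma substPoly_mul (g h : Matrix (Fin 2) (Fin 2) ℂ) :
    substPoly (g * h) = (substPoly g).comp (substPoly h) := by
  refine MvPolynomial.algHom_ext fun j => ?_
  have hC : ∀ c : ℂ, substPoly g (C c) = C c := fun c => (substPoly g).commutes c
  simp only [AlgHom.comp_apply, substPoly_X, map_mul, hC, Matrix.mul_apply,
    Fin.sum_univ_two, map_add]
  ring

open MvPolynomial in
lemma substPoly_one : substPoly 1 = AlgHom.id ℂ _ := by
  refine MvPolynomial.algHom_ext fun j => ?_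
  fin_cases j <;> simp [substPoly_X]

/-- Homogeneous polynomials of degree `2k` in two variables. -/
abbrev polySpace (k : ℕ) : Submodule ℂ (MvPolynomial (Fin 2) ℂ) :=
  MvPolynomial.homogeneousSubmodule (Fin 2) ℂ (2 * k)

open MvPolynomial in
lemma isHomogeneous_lin (g : Matrix (Fin 2) (Fin 2) ℂ) (j : Fin 2) :
    (∑ i, C (g i j) * X i : MvPolynomial (Fin 2) ℂ).IsHomogeneous 1 :=
  IsHomogeneous.sum _ _ _ fun i _ => by
    simpa using (isHomogeneous_C (Fin 2) (g i j)).mul (isHomogeneous_X ℂ i)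

lemma substPoly_mem {k : ℕ} (g : Matrix (Fin 2) (Fin 2) ℂ) {p : MvPolynomial (Fin 2) ℂ}
    (hp : p ∈ polySpace k) : substPoly g p ∈ polySpace k := by
  have := MvPolynomial.IsHomogeneous.aeval (n := 1) hp _ (isHomogeneous_lin g)
  rw [one_mul] at this
  exact this

open MvPolynomial in
lemma substPoly_scalar {k : ℕ} (c : ℂ) {p : MvPolynomial (Fin 2) ℂ} (hp : p ∈ polySpace k) :
    substPoly (c • 1) p = c ^ (2 * k) • p := by
  have h1 : (fun j => ∑ i, C ((c • (1 : Matrix (Fin 2) (Fin 2) ℂ)) i j) * X i)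
      = fun j => C c * (X j : MvPolynomial (Fin 2) ℂ) := by
    funext j; fin_cases j <;> simp
  have hp' : p.IsHomogeneous (2 * k) := hp
  unfold substPoly
  rw [h1, aeval_def, eval₂_eq]
  conv_rhs => rw [p.as_sum, Finset.smul_sum]
  refine Finset.sum_congr rfl fun d hd => ?_
  have hdeg : ∑ i ∈ d.support, d i = 2 * k := by
    have := hp' (mem_support_iff.mp hd)
    rw [Finsupp.weight_apply] at this
    simpa [Finsupp.sum] using this
  simp only [mul_pow, Finset.prod_mul_distrib, Finset.prod_pow_eq_pow_sum, hdeg]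
  rw [monomial_eq, Finsupp.prod, smul_eq_C_mul, C_pow, MvPolynomial.algebraMap_eq]
  ring

/-- `δ_{2k}` as a representation of `GL₂(ℝ)`: the matrix `g` acts by `p(X, Y) ↦ p((X, Y) g₁)`, where
`g₁ = |det g|^{-1/2} g` lies in `SL₂^±(ℝ)`. -/
def deltaGL (k : ℕ) : GL (Fin 2) ℝ →* Module.End ℂ (polySpace k) where
  toFun g := (((|g.1.det| ^ k)⁻¹ : ℝ) : ℂ) •
    (substPoly (g.1.map Complex.ofReal)).toLinearMap.restrict fun _ hp => substPoly_mem _ hp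
  map_one' := by
    have : (1 : Mat).map Complex.ofReal = 1 := by simp
    ext1 p; ext1
    simp [this, substPoly_one]
  map_mul' g h := by
    have : (g.1 * h.1).map Complex.ofReal = g.1.map Complex.ofReal * h.1.map Complex.ofReal :=
      Matrix.map_mul (f := Complex.ofRealHom)
    ext1 p; ext1
    change (((|(g.1 * h.1).det| ^ k)⁻¹ : ℝ) : ℂ) •
        substPoly ((g.1 * h.1).map Complex.ofReal) p.1
      = (((|g.1.det| ^ k)⁻¹ : ℝ) : ℂ) • substPoly (g.1.map Complex.ofReal)
          ((((|h.1.det| ^ k)⁻¹ : ℝ) : ℂ) • substPoly (h.1.map Complex.ofReal) p.1)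
    rw [this, substPoly_mul, Matrix.det_mul, abs_mul, mul_pow, mul_inv, map_smul, smul_smul]
    push_cast
    rfl

/-- The representation `δ_{2k}` of `G`. -/
def delta (k : ℕ) : G →* Module.End ℂ (polySpace k) :=
  QuotientGroup.lift (Subgroup.center (GL (Fin 2) ℝ)) (deltaGL k) (by
    intro z hz
    rw [Matrix.GeneralLinearGroup.center_eq_range_scalar] at hz
    obtain ⟨u, rfl⟩ := hz
    have h1 : (Matrix.GeneralLinearGroup.scalar (Fin 2) u).1.map Complex.ofReal = (u : ℂ) • 1 := by
      ext i j; fin_cases i <;> fin_cases j <;> simp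
    have h2 : (Matrix.GeneralLinearGroup.scalar (Fin 2) u).1.det = (u : ℝ) ^ 2 := by
      simp
    ext1 p; ext1
    change (((|(Matrix.GeneralLinearGroup.scalar (Fin 2) u).1.det| ^ k)⁻¹ : ℝ) : ℂ) •
      substPoly ((Matrix.GeneralLinearGroup.scalar (Fin 2) u).1.map Complex.ofReal) p.1 = p.1
    rw [h1, h2, substPoly_scalar _ p.2, smul_smul, abs_of_nonneg (sq_nonneg _), ← pow_mul]
    have : (u : ℂ) ^ (2 * k) ≠ 0 := pow_ne_zero _ (by exact_mod_cast u.ne_zero)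
    push_cast
    rw [inv_mul_cancel₀ this, one_smul])

open MvPolynomial in
/-- The derivative of `p(X, Y) ↦ p((X, Y) exp(tA))` at `t = 0`: the derivation with
`(X, Y) ↦ (X, Y) A`. -/
def derivPoly (A : Matrix (Fin 2) (Fin 2) ℂ) :
    Derivation ℂ (MvPolynomial (Fin 2) ℂ) (MvPolynomial (Fin 2) ℂ) :=
  mkDerivation ℂ fun j => ∑ i, C (A i j) * X i

open MvPolynomial in
lemma derivPoly_X (A : Matrix (Fin 2) (Fin 2) ℂ) (j : Fin 2) :
    derivPoly A (X j) = ∑ i, C (A i j) * X i := by simp [derivPoly]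

open MvPolynomial in
lemma derivPoly_C (A : Matrix (Fin 2) (Fin 2) ℂ) (c : ℂ) : derivPoly A (C c) = 0 := by
  simp [derivPoly]

open MvPolynomial in
lemma derivPoly_mem {k : ℕ} (A : Matrix (Fin 2) (Fin 2) ℂ) {p : MvPolynomial (Fin 2) ℂ}
    (hp : p ∈ polySpace k) : derivPoly A p ∈ polySpace k := by
  have hp' : p.IsHomogeneous (2 * k) := hp
  rw [p.as_sum, map_sum]
  refine Submodule.sum_mem _ fun d hd => ?_
  rw [derivPoly, mkDerivation_monomial]
  refine Submodule.smul_mem _ _ (Submodule.sum_mem _ fun i hi => ?_)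
  have hdeg : d.degree = 2 * k := by
    have := hp' (mem_support_iff.mp hd)
    rwa [Finsupp.degree_eq_weight_one]
  have hi' : Finsupp.single i 1 ≤ d := by
    rw [Finsupp.single_le_iff]
    exact Nat.one_le_iff_ne_zero.mpr (Finsupp.mem_support_iff.mp hi)
  have hd1 : (d - Finsupp.single i 1).degree + 1 = 2 * k := by
    rw [← hdeg]
    conv_rhs => rw [← tsub_add_cancel_of_le hi', map_add, Finsupp.degree_single]
  have := (isHomogeneous_monomial (d i : ℂ) (d := d - Finsupp.single i 1) rfl).mul
    (isHomogeneous_lin A i)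
  rw [hd1] at this
  exact this

open MvPolynomial in
lemma derivPoly_lie (A B : Matrix (Fin 2) (Fin 2) ℂ) (p : MvPolynomial (Fin 2) ℂ) :
    derivPoly (A * B - B * A) p = derivPoly A (derivPoly B p) - derivPoly B (derivPoly A p) := by
  induction p using MvPolynomial.induction_on with
  | C c => simp
  | add p q hp hq => simp only [map_add, hp, hq]; ring
  | mul_X p i hp =>
    simp only [Derivation.leibniz, smul_eq_mul, map_add, hp, derivPoly_X, Fin.sum_univ_two,
      derivPoly_C, Matrix.sub_apply, Matrix.mul_apply, map_sub, map_mul]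
    ring

open MvPolynomial in
lemma substPoly_derivPoly {g A B : Matrix (Fin 2) (Fin 2) ℂ} (h : B * g = g * A)
    (p : MvPolynomial (Fin 2) ℂ) :
    substPoly g (derivPoly A p) = derivPoly B (substPoly g p) := by
  have hC : ∀ c : ℂ, substPoly g (C c) = C c := fun c => (substPoly g).commutes c
  induction p using MvPolynomial.induction_on with
  | C c => simp [hC]
  | add p q hp hq => simp only [map_add, hp, hq]
  | mul_X p j hp =>
    have h0 := congrArg (C (σ := Fin 2)) (congrFun (congrFun h 0) j)
    have h1 := congrArg (C (σ := Fin 2)) (congrFun (congrFun h 1) j)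
    simp only [Matrix.mul_apply, Fin.sum_univ_two, map_add, map_mul] at h0 h1
    simp only [Derivation.leibniz, smul_eq_mul, map_add, map_mul, hp, derivPoly_X, substPoly_X,
      Fin.sum_univ_two, derivPoly_C, hC]
    linear_combination (-(substPoly g p * X 0)) * h0 + (-(substPoly g p * X 1)) * h1

/-- The action of `𝔤` on the space of `δ_{2k}`. -/
def lieDelta (k : ℕ) : sl2 →ₗ⁅ℂ⁆ Module.End ℂ (polySpace k) where
  toFun A := (derivPoly A.1).toLinearMap.restrict fun _ hp => derivPoly_mem A.1 hp
  map_add' A B := by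
    ext1 p; ext1
    have : derivPoly (A.1 + B.1) = derivPoly A.1 + derivPoly B.1 :=
      MvPolynomial.derivation_ext fun i => by simp [derivPoly_X, add_mul, Finset.sum_add_distrib]
    simp [this]
  map_smul' c A := by
    ext1 p; ext1
    have : derivPoly (c • A.1) = c • derivPoly A.1 :=
      MvPolynomial.derivation_ext fun i => by
        simp [derivPoly_X, MvPolynomial.smul_eq_C_mul]; ring
    simp [this]
  map_lie' {A B} := by
    ext1 p; ext1
    exact derivPoly_lie A.1 B.1 p.1

lemma exp_zero_J : NormedSpace.exp ((0 : ℝ) • J) = 1 := by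
  rw [zero_smul, NormedSpace.exp_zero]

lemma det_exp_J (t : ℝ) : |(NormedSpace.exp (t • J)).det| = 1 := by
  have h : NormedSpace.exp (t • J) ∈ Matrix.orthogonalGroup (Fin 2) ℝ := by
    rw [Matrix.mem_orthogonalGroup_iff, ← Matrix.exp_transpose, ← NormedSpace.exp_zero]
    have hJ : (t • J).transpose = - (t • J) := by
      ext i j; fin_cases i <;> fin_cases j <;> simp [J]
    rw [hJ, ← Matrix.exp_add_of_commute _ _ (Commute.neg_right (Commute.refl (t • J))),
      add_neg_cancel]
  have h2 := congrArg Matrix.det (Matrix.mem_orthogonalGroup_iff _ _ |>.mp h)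
  rw [Matrix.det_mul, Matrix.det_transpose, Matrix.det_one] at h2
  rcases mul_self_eq_one_iff.mp h2 with h | h <;> simp [h]

lemma det_exp_J_one (t : ℝ) : (NormedSpace.exp (t • J)).det = 1 := by
  have h : NormedSpace.exp (t • J) = NormedSpace.exp ((t / 2) • J) * NormedSpace.exp ((t / 2) • J) := by
    rw [← Matrix.exp_add_of_commute _ _ (Commute.refl ((t / 2) • J)), ← add_smul]
    congr 2; ring
  rw [h, Matrix.det_mul, ← abs_mul_abs_self, det_exp_J, one_mul]

open MvPolynomial in
lemma hasDerivAt_substPoly (p : MvPolynomial (Fin 2) ℂ) (ℓ : MvPolynomial (Fin 2) ℂ →ₗ[ℂ] ℂ) :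
    HasDerivAt (fun t : ℝ => ℓ (substPoly ((NormedSpace.exp (t • J)).map Complex.ofReal) p))
      (ℓ (derivPoly (J.map Complex.ofReal) p)) 0 := by
  have hC : ∀ (g : Matrix (Fin 2) (Fin 2) ℂ) (c : ℂ), substPoly g (C c) = C c :=
    fun g c => (substPoly g).commutes c
  have hE : ∀ i j, HasDerivAt (fun t : ℝ => ((NormedSpace.exp (t • J) i j : ℝ) : ℂ)) (J i j : ℂ) 0 :=
    fun i j => (hasDerivAt_exp_entry J i j).ofReal_comp
  induction p using MvPolynomial.induction_on generalizing ℓ with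
  | C c => simpa [hC, derivPoly_C] using hasDerivAt_const (0 : ℝ) (ℓ (C c))
  | add p q hp hq => simpa only [map_add] using (hp ℓ).fun_add (hq ℓ)
  | mul_X p j hp =>
    have h := HasDerivAt.fun_sum (u := Finset.univ) fun i (_ : i ∈ Finset.univ) =>
      (hE i j).mul (hp (ℓ ∘ₗ LinearMap.mulRight ℂ (X i)))
    refine (h.congr_deriv ?_).congr_of_eventuallyEq (Filter.Eventually.of_forall fun t => ?_)
    · have h1 : (1 : Mat).map Complex.ofReal = 1 := by simp
      have hmul : ∀ (c : ℂ) (i : Fin 2), ℓ (p * (C c * X i)) = c * ℓ (p * X i) := fun c i => by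
        rw [← smul_eq_C_mul, mul_smul_comm, map_smul, smul_eq_mul]
      rw [exp_zero_J, h1, substPoly_one, Derivation.leibniz, derivPoly_X, smul_eq_mul,
        smul_eq_mul, Fin.sum_univ_two, Fin.sum_univ_two, mul_add, map_add, map_add, hmul, hmul,
        mul_comm (X j)]
      obtain rfl | rfl : j = 0 ∨ j = 1 := by omega
      · simp; ring
      · simp; ring
    · simp only [map_mul, substPoly_X, LinearMap.comp_apply, LinearMap.mulRight_apply,
        Fin.sum_univ_two, mul_add, map_add, Matrix.map_apply, Pi.mul_apply]
      simp only [← smul_eq_C_mul, mul_smul_comm, map_smul, smul_eq_mul]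

open Classical in
/-- The character of `G` attached to `σ`: trivial if `σ = 1`, and `det` otherwise. -/
def extendChar (σ : M →* ℂˣ) : G →* ℂˣ := if σ = 1 then 1 else signDet

/-- The action of `K` on `σ ⊗ δ_{2k}`. -/
def twistedDelta (σ : M →* ℂˣ) (k : ℕ) : K →* Module.End ℂ (polySpace k) where
  toFun x := (extendChar σ x : ℂ) • delta k x
  map_one' := by simp
  map_mul' x y := by simp [smul_smul, mul_comm]

lemma extendChar_rot (σ : M →* ℂˣ) (t : ℝ) : extendChar σ (rot t : G) = 1 := by
  unfold extendChar
  split_ifs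
  · rfl
  · ext
    change ((SignType.sign (NormedSpace.exp (t • J)).det : SignType) : ℂ) = 1
    rw [det_exp_J_one]; simp

lemma delta_rot {k : ℕ} (t : ℝ) (p : polySpace k) : (delta k (rot t : G) p).1
    = substPoly ((NormedSpace.exp (t • J)).map Complex.ofReal) p.1 := by
  change (((|(NormedSpace.exp (t • J)).det| ^ k)⁻¹ : ℝ) : ℂ) • substPoly _ _ = _
  rw [det_exp_J]; simp

lemma delta_lieDelta {k : ℕ} (y : G) (A : sl2) (p : polySpace k) :
    delta k y (lieDelta k A p) = lieDelta k (Ad y A) (delta k y p) := by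
  obtain ⟨g, rfl⟩ := Matrix.ProjGenLinGroup.mk_surjective y
  ext1
  change (((|g.1.det| ^ k)⁻¹ : ℝ) : ℂ) • substPoly (g.1.map Complex.ofReal) (derivPoly A.1 p.1)
    = derivPoly (AdGL g A).1
      ((((|g.1.det| ^ k)⁻¹ : ℝ) : ℂ) • substPoly (g.1.map Complex.ofReal) p.1)
  rw [Derivation.map_smul, substPoly_derivPoly (B := (AdGL g A).1)]
  rw [AdGL_val, mul_assoc]
  have : g⁻¹.1.map Complex.ofReal * g.1.map Complex.ofReal = 1 := by
    have h := Matrix.map_mul (f := Complex.ofRealHom) (L := g⁻¹.1) (M := g.1)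
    rw [Units.inv_mul] at h
    exact h.symm.trans (by simp)
  rw [this, mul_one]

/-- The `(𝔤, K)`-module of the finite-dimensional representation `σ ⊗ δ_{2k}`, which is `δ_{2k}` if
`σ = 1` and `det ⊗ δ_{2k}` otherwise. -/
def finDim (σ : M →* ℂˣ) (k : ℕ) : GKModule (polySpace k) where
  lie := lieDelta k
  act := twistedDelta σ k
  act_lie x A p := by
    change (extendChar σ x : ℂ) • delta k x (lieDelta k A p)
      = lieDelta k (Ad x A) ((extendChar σ x : ℂ) • delta k x p)
    rw [map_smul, delta_lieDelta]
  locallyFinite p := by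
    have : FiniteDimensional ℂ (polySpace k) := Module.Finite.iff_fg.mpr
      (MvPolynomial.homogeneousSubmodule_fg (Fin 2) ℂ (2 * k))
    infer_instance
  hasDerivAt p ℓ := by
    obtain ⟨L, hL⟩ := LinearMap.exists_extend ℓ
    subst hL
    have h := hasDerivAt_substPoly p.1 L
    have h1 : J.map Complex.ofReal = Jsl.1 := by
      ext i j; fin_cases i <;> fin_cases j <;> simp [J, Jsl]
    rw [h1] at h
    refine h.congr_of_eventuallyEq (Filter.Eventually.of_forall fun t => ?_)
    change L ((extendChar σ (rot t : G) : ℂ) • (delta k (rot t : G) p).1) = _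
    rw [extendChar_rot, delta_rot]
    simp

/-! ### `AM`-modules -/

/-- The exponential `∑ X^j / j!` of a linear operator, in the canonical topology of the
(finite-dimensional) space of operators. -/
def expEnd {W : Type*} [AddCommGroup W] [Module ℂ W] (X : Module.End ℂ W) : Module.End ℂ W :=
  letI : TopologicalSpace (Module.End ℂ W) := moduleTopology ℂ (Module.End ℂ W)
  ∑' j : ℕ, ((j.factorial : ℂ)⁻¹) • X ^ j

/-- An `(𝔞, M)`-module: a vector space with an action of `𝔞 = ℂ H`, given by the operator `a` by which
`H` acts, and a commuting action of `M`. -/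
structure AModule (W : Type*) [AddCommGroup W] [Module ℂ W] where
  a : Module.End ℂ W
  m : M →* Module.End ℂ W
  comm : ∀ x, Commute a (m x)

/-- The group `AM ≅ A × M`; the pair `(t, m)` stands for `diag(e^t, e^{-t}) m`. -/
abbrev AM : Type := Multiplicative ℝ × M

/-- The action of `AM` on a finite-dimensional `(𝔞, M)`-module: `exp(tH) m` acts as `exp` of `t` times
the action of `H`, composed with the action of `m`. -/
def AModule.act {W : Type*} [AddCommGroup W] [Module ℂ W] (w : AModule W) (g : AM) :
    Module.End ℂ W :=
  expEnd (((Multiplicative.toAdd g.1 : ℝ) : ℂ) • w.a) * w.m g.2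

/-- Isomorphism of `AM`-modules with a given representation of `AM`. -/
def AModule.IsIsoTo {W U : Type*} [AddCommGroup W] [Module ℂ W] [AddCommGroup U] [Module ℂ U]
    (w : AModule W) (ρ : Representation ℂ AM U) : Prop :=
  ∃ e : W ≃ₗ[ℂ] U, ∀ g v, e (w.act g v) = ρ g (e v)

/-- The character `a m ↦ σ(m) a^{2λρ}` of `AM`. -/
def charAM (σ : M →* ℂˣ) (lam : ℂ) (g : AM) : ℂ :=
  (σ g.2 : ℂ) * Complex.exp (2 * lam * (Multiplicative.toAdd g.1 : ℝ))

lemma charAM_one (σ : M →* ℂˣ) (lam : ℂ) : charAM σ lam 1 = 1 := by simp [charAM]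

lemma charAM_mul (σ : M →* ℂˣ) (lam : ℂ) (g h : AM) :
    charAM σ lam (g * h) = charAM σ lam g * charAM σ lam h := by
  simp [charAM, mul_add, Complex.exp_add]; ring

/-- The one-dimensional `AM`-module `σ ⊗ ℂ_{2λρ}`. -/
def charRep (σ : M →* ℂˣ) (lam : ℂ) : Representation ℂ AM ℂ where
  toFun g := charAM σ lam g • 1
  map_one' := by simp [charAM_one]
  map_mul' g h := by simp [charAM_mul, smul_smul, mul_comm]

/-- The tensor product of `σ ⊗ ℂ_{2λρ}` with the two-dimensional `AM`-module on which
`diag(e^t, e^{-t}) m` acts by the unipotent matrix with rows `(1, t)` and `(0, 1)`. -/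
def jordanRep (σ : M →* ℂˣ) (lam : ℂ) : Representation ℂ AM (ℂ × ℂ) where
  toFun g := charAM σ lam g •
    (LinearMap.prod (LinearMap.fst ℂ ℂ ℂ + ((Multiplicative.toAdd g.1 : ℝ) : ℂ) • LinearMap.snd ℂ ℂ ℂ)
      (LinearMap.snd ℂ ℂ ℂ))
  map_one' := by ext <;> simp [charAM_one]
  map_mul' g h := by ext <;> simp [charAM_mul] <;> ring

/-- The space of all `v` such that, for some `j`, `(am - σ(m) a^{2λρ})^j v = 0` for all `am ∈ AM`
(an increasing union of subspaces). -/
def AModule.genEigenspace {W : Type*} [AddCommGroup W] [Module ℂ W] (w : AModule W)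
    (σ : M →* ℂˣ) (lam : ℂ) : Submodule ℂ W :=
  ⨆ j : ℕ, ⨅ g : AM, LinearMap.ker ((w.act g - charAM σ lam g • (1 : Module.End ℂ W)) ^ j)

/-! ### Lie algebra cohomology -/

/-- The complexified Lie algebra `𝔫 = ℂ E` of `N`. -/
def nil : LieSubalgebra ℂ sl2 where
  toSubmodule := Submodule.span ℂ {E}
  lie_mem' := by
    intro x y hx hy
    obtain ⟨c, rfl⟩ := Submodule.mem_span_singleton.mp hx
    obtain ⟨d, rfl⟩ := Submodule.mem_span_singleton.mp hy
    simp

lemma mem_nil {X : sl2} : X ∈ nil ↔ ∃ c : ℂ, c • E = X := Submodule.mem_span_singleton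

lemma lie_H_E : ⁅H, E⁆ = (2 : ℂ) • E := by
  ext i j
  rw [LieAlgebra.SpecialLinear.sl_bracket]
  fin_cases i <;> fin_cases j <;> simp [H, E]
  norm_num

lemma lie_H_mem {X : sl2} (hX : X ∈ nil) : ⁅H, X⁆ ∈ nil := by
  obtain ⟨c, rfl⟩ := mem_nil.mp hX
  rw [lie_smul, lie_H_E, smul_smul]
  exact mem_nil.mpr ⟨_, rfl⟩

lemma AdGL_eq {g : GL (Fin 2) ℝ} {X Y : sl2}
    (h : g.1.map Complex.ofReal * X.1 = Y.1 * g.1.map Complex.ofReal) : AdGL g X = Y := by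
  ext1
  have h1 : g.1.map Complex.ofReal * g⁻¹.1.map Complex.ofReal = 1 := by
    have h := Matrix.map_mul (f := Complex.ofRealHom) (L := g.1) (M := g⁻¹.1)
    rw [Units.mul_inv] at h
    exact h.symm.trans (by simp)
  rw [AdGL_val, h, mul_assoc, h1, mul_one]

lemma Ad_T_E : Ad T E = (-1 : ℂ) • E := by
  refine AdGL_eq ?_
  change (!![-1, 0; 0, 1] : Mat).map Complex.ofReal * _ = _ * (!![-1, 0; 0, 1] : Mat).map Complex.ofReal
  ext i j; fin_cases i <;> fin_cases j <;> simp [E, Matrix.mul_apply]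

lemma Ad_T_H : Ad T H = H := by
  refine AdGL_eq ?_
  change (!![-1, 0; 0, 1] : Mat).map Complex.ofReal * _ = _ * (!![-1, 0; 0, 1] : Mat).map Complex.ofReal
  ext i j; fin_cases i <;> fin_cases j <;> simp [H, Matrix.mul_apply]

lemma T_mul_T : T * T = 1 := by
  have h : (!![-1, 0; 0, 1] : Mat) * !![-1, 0; 0, 1] = 1 := by
    ext i j; fin_cases i <;> fin_cases j <;> simp
  unfold T
  rw [← cls_mul _ _ (by rw [h]; simp)]
  simp only [h]
  unfold cls
  rw [← map_one Matrix.ProjGenLinGroup.mk]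
  refine congrArg Matrix.ProjGenLinGroup.mk (Units.ext rfl)

lemma eq_one_or_T {x : G} (hx : x ∈ M) : x = 1 ∨ x = T := by
  obtain ⟨j, rfl⟩ := Subgroup.mem_zpowers_iff.mp hx
  have h2 : T ^ (2 : ℤ) = 1 := by rw [zpow_ofNat, pow_two, T_mul_T]
  rcases Int.even_or_odd' j with ⟨i, rfl | rfl⟩
  · left; rw [zpow_mul, h2, one_zpow]
  · right; rw [zpow_add, zpow_mul, h2, one_zpow, one_mul, zpow_one]

lemma Ad_mem {X : sl2} (m : M) (hX : X ∈ nil) : Ad m X ∈ nil := by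
  rcases eq_one_or_T m.2 with h | h
  · rw [h, map_one]; exact hX
  · obtain ⟨c, rfl⟩ := mem_nil.mp hX
    rw [h, map_smul, Ad_T_E, smul_smul]
    exact mem_nil.mpr ⟨_, rfl⟩

lemma Ad_H (m : M) : Ad m H = H := by
  rcases eq_one_or_T m.2 with h | h
  · rw [h, map_one]; rfl
  · rw [h, Ad_T_H]

lemma M_le_K : M ≤ K := by
  rw [M, Subgroup.zpowers_le]
  refine ⟨Matrix.GeneralLinearGroup.mkOfDetNeZero !![-1, 0; 0, 1] (by simp), ?_, rfl⟩
  change (!![-1, 0; 0, 1] : Mat) ∈ Matrix.orthogonalGroup (Fin 2) ℝ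
  rw [Matrix.mem_orthogonalGroup_iff]
  ext i j; fin_cases i <;> fin_cases j <;> simp [Matrix.mul_apply]

/-- `ad H` on `𝔫`. -/
def adH : nil →ₗ[ℂ] nil :=
  (LieAlgebra.ad ℂ sl2 H).restrict (p := nil.toSubmodule) (q := nil.toSubmodule)
    fun _ hX => lie_H_mem hX

/-- The adjoint action of `M` on `𝔫`. -/
def AdN : M →* Module.End ℂ nil where
  toFun m := (Ad m).restrict (p := nil.toSubmodule) (q := nil.toSubmodule) fun _ hX => Ad_mem m hX
  map_one' := by ext X; simp
  map_mul' m l := by ext X; simp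

namespace GKModule

variable {V : Type*} [AddCommGroup V] [Module ℂ V] (π : GKModule V)

/-- The differential of the Chevalley-Eilenberg complex `V → Hom(𝔫, V) → 0`, `(d v)(X) = X v`; since
`dim 𝔫 = 1`, there are no nonzero cochains `Λ^p 𝔫 → V` with `p ≥ 2`. -/
def d : V →ₗ[ℂ] (nil →ₗ[ℂ] V) where
  toFun v := { toFun := fun X => π.lie X v, map_add' := by simp, map_smul' := by simp }
  map_add' v w := LinearMap.ext fun X => map_add (π.lie X) v w
  map_smul' c v := LinearMap.ext fun X => map_smul (π.lie X) c v

lemma d_apply (v : V) (X : nil) : π.d v X = π.lie X v := rfl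

/-- The cohomology space `H⁰(𝔫, V)`. -/
abbrev H0 : Submodule ℂ V := LinearMap.ker π.d

/-- The cohomology space `H¹(𝔫, V)`. -/
abbrev H1 : Type _ := (nil →ₗ[ℂ] V) ⧸ LinearMap.range π.d

/-- The action of `M ⊂ K`. -/
def actM : M →* Module.End ℂ V := π.act.comp (Subgroup.inclusion M_le_K)

lemma lie_mul (X Y : sl2) (v : V) : π.lie X (π.lie Y v) = π.lie ⁅X, Y⁆ v + π.lie Y (π.lie X v) := by
  rw [LieHom.map_lie, Ring.lie_def]; simp

lemma actM_lie (m : M) (X : sl2) (v : V) :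
    π.actM m (π.lie X v) = π.lie (Ad m X) (π.actM m v) :=
  π.act_lie _ X v

lemma mem_H0 {v : V} : v ∈ π.H0 ↔ ∀ X ∈ nil, π.lie X v = 0 := by
  rw [LinearMap.mem_ker]
  exact ⟨fun h X hX => congrArg (fun φ : nil →ₗ[ℂ] V => φ ⟨X, hX⟩) h,
    fun h => LinearMap.ext fun X => h X X.2⟩

lemma lie_H_mem_H0 {v : V} (hv : v ∈ π.H0) : π.lie H v ∈ π.H0 := by
  rw [mem_H0] at *
  intro X hX
  have h := π.lie_mul H X v
  rw [hv X hX, hv _ (lie_H_mem hX), map_zero, zero_add] at h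
  exact h.symm

lemma actM_mem_H0 (m : M) {v : V} (hv : v ∈ π.H0) : π.actM m v ∈ π.H0 := by
  rw [mem_H0] at *
  intro X hX
  have h := π.actM_lie m (Ad (m⁻¹ : G) X) v
  rw [show π.lie (Ad (m⁻¹ : G) X) v = 0 from hv _ (Ad_mem m⁻¹ hX), map_zero, ← Module.End.mul_apply (Ad _), ← map_mul,
    mul_inv_cancel, map_one] at h
  exact h.symm

lemma actM_lie_H (m : M) (v : V) : π.actM m (π.lie H v) = π.lie H (π.actM m v) := by
  rw [actM_lie, Ad_H]

/-- `H⁰(𝔫, V)` as an `(𝔞, M)`-module. -/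
def cohomology0 : AModule π.H0 where
  a := (π.lie H).restrict (p := π.H0) (q := π.H0) fun _ hv => π.lie_H_mem_H0 hv
  m :=
    { toFun := fun m => (π.actM m).restrict (p := π.H0) (q := π.H0)
        fun _ hv => π.actM_mem_H0 m hv
      map_one' := by ext v; simp
      map_mul' := fun m l => by ext v; simp }
  comm m := LinearMap.ext fun v => Subtype.ext (π.actM_lie_H m v.1).symm

/-- The action of `H ∈ 𝔞` on `1`-cochains, `(H φ)(X) = H φ(X) - φ([H, X])`. -/
def cochainA : Module.End ℂ (nil →ₗ[ℂ] V) where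
  toFun φ := π.lie H ∘ₗ φ - φ ∘ₗ adH
  map_add' φ η := by ext X; simp; abel
  map_smul' c φ := by ext X; simp [smul_sub]

/-- The action of `M` on `1`-cochains, `(m φ)(X) = m φ(Ad(m⁻¹) X)`. -/
def cochainM : M →* Module.End ℂ (nil →ₗ[ℂ] V) where
  toFun m :=
    { toFun := fun φ => π.actM m ∘ₗ φ ∘ₗ AdN m⁻¹
      map_add' := fun φ η => by ext X; simp
      map_smul' := fun c φ => by ext X; simp }
  map_one' := by ext φ X; simp
  map_mul' m l := by ext φ X; simp

lemma cochainA_d (v : V) : π.cochainA (π.d v) = π.d (π.lie H v) := by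
  ext X
  change π.lie H (π.lie X v) - π.lie ⁅H, (X : sl2)⁆ v = π.lie X (π.lie H v)
  rw [lie_mul]; abel

lemma cochainM_d (m : M) (v : V) : π.cochainM m (π.d v) = π.d (π.actM m v) := by
  ext X
  change π.actM m (π.lie (Ad (m⁻¹ : M) X) v) = π.lie X (π.actM m v)
  rw [actM_lie, ← Module.End.mul_apply (Ad _), ← map_mul]
  simp

lemma Ad_bracket (m : M) {X : sl2} (hX : X ∈ nil) : Ad m ⁅H, X⁆ = ⁅H, Ad m X⁆ := by
  obtain ⟨c, rfl⟩ := mem_nil.mp hX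
  obtain ⟨e, he⟩ := mem_nil.mp (Ad_mem m (mem_nil.mpr ⟨1, one_smul _ E⟩))
  rw [lie_smul, lie_H_E, map_smul, map_smul, map_smul, lie_smul, ← he, lie_smul, lie_H_E,
    smul_comm (2 : ℂ) e]

lemma cochain_comm (m : M) (φ : nil →ₗ[ℂ] V) :
    π.cochainA (π.cochainM m φ) = π.cochainM m (π.cochainA φ) := by
  ext X
  change π.lie H (π.actM m (φ (AdN m⁻¹ X))) - π.actM m (φ (AdN m⁻¹ (adH X)))
    = π.actM m (π.lie H (φ (AdN m⁻¹ X)) - φ (adH (AdN m⁻¹ X)))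
  rw [map_sub, actM_lie_H]
  have : AdN m⁻¹ (adH X) = adH (AdN m⁻¹ X) := Subtype.ext (Ad_bracket m⁻¹ X.2)
  rw [this]

/-- `H¹(𝔫, V)` as an `(𝔞, M)`-module. -/
def cohomology1 : AModule π.H1 where
  a := (LinearMap.range π.d).mapQ (LinearMap.range π.d) π.cochainA (by
    rintro _ ⟨v, rfl⟩
    exact ⟨_, (π.cochainA_d v).symm⟩)
  m :=
    { toFun := fun m => (LinearMap.range π.d).mapQ (LinearMap.range π.d) (π.cochainM m) (by
        rintro _ ⟨v, rfl⟩
        exact ⟨_, (π.cochainM_d m v).symm⟩)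
      map_one' := by
        refine Submodule.linearMap_qext _ (LinearMap.ext fun φ => ?_)
        simp
      map_mul' := fun m l => by
        refine Submodule.linearMap_qext _ (LinearMap.ext fun φ => ?_)
        simp }
  comm m := by
    refine Submodule.linearMap_qext _ (LinearMap.ext fun φ => ?_)
    simp [cochain_comm]

/-- The spectral Lefschetz number
`∑_{q=0}^{dim 𝔫} (-1)^{q + dim 𝔫} dim H^q(𝔫, π)^σ_{2λρ}`, where `dim 𝔫 = 1`. -/
def lefschetz (σ : M →* ℂˣ) (lam : ℂ) : ℤ :=
  (-1) ^ (0 + 1) * (Module.finrank ℂ (π.cohomology0.genEigenspace σ lam) : ℤ)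
    + (-1) ^ (1 + 1) * (Module.finrank ℂ (π.cohomology1.genEigenspace σ lam) : ℤ)

end GKModule

/-- The character `det` of `M`. -/
def detM : M →* ℂˣ := signDet.comp M.subtype

/-- The number `1` if `p` holds and `0` otherwise. -/
def iverson (p : Prop) : ℤ := open Classical in if p then 1 else 0

end PGLTwo

end

noncomputable section

open scoped MatrixGroups ContDiff

namespace PGLTwo

attribute [local instance] LieRing.ofAssociativeRing LieAlgebra.ofAssociativeAlgebra

/-! ### The exponential of an operator -/

lemma expEnd_eq {W : Type*} [AddCommGroup W] [Module ℂ W] [FiniteDimensional ℂ W]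
    {X P Q : Module.End ℂ W} {a b : ℕ → ℂ} {α β : ℂ} (hX : ∀ j, X ^ j = a j • P + b j • Q)
    (ha : HasSum (fun j => (j.factorial : ℂ)⁻¹ * a j) α)
    (hb : HasSum (fun j => (j.factorial : ℂ)⁻¹ * b j) β) :
    expEnd X = α • P + β • Q := by
  let _ : TopologicalSpace (Module.End ℂ W) := moduleTopology ℂ (Module.End ℂ W)
  have : IsModuleTopology ℂ (Module.End ℂ W) := ⟨rfl⟩
  have : ContinuousAdd (Module.End ℂ W) := IsModuleTopology.toContinuousAdd ℂ _
  let φ := (Module.finBasis ℂ (Module.End ℂ W)).equivFun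
  have : T2Space (Module.End ℂ W) := T2Space.of_injective_continuous φ.injective
    (IsModuleTopology.continuous_of_linearMap φ.toLinearMap)
  refine HasSum.tsum_eq ?_
  convert (ha.smul_const P).add (hb.smul_const Q) using 2 with j
  rw [hX, smul_add, smul_smul, smul_smul]

lemma pow_conj {W U : Type*} [AddCommGroup W] [Module ℂ W] [AddCommGroup U] [Module ℂ U]
    (e : W ≃ₗ[ℂ] U) {X : Module.End ℂ W} {Y : Module.End ℂ U} (h : ∀ v, e (X v) = Y (e v))
    (j : ℕ) (v : W) : e ((X ^ j) v) = (Y ^ j) (e v) := by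
  induction j generalizing v with
  | zero => rfl
  | succ j ih => rw [pow_succ, pow_succ, Module.End.mul_apply, Module.End.mul_apply, ih, h]

lemma expEnd_conj {W U : Type*} [AddCommGroup W] [Module ℂ W] [AddCommGroup U] [Module ℂ U]
    [FiniteDimensional ℂ U] (e : W ≃ₗ[ℂ] U) {X : Module.End ℂ W} {Y P Q : Module.End ℂ U}
    {a b : ℕ → ℂ} {α β : ℂ} (h : ∀ v, e (X v) = Y (e v))
    (hY : ∀ j, Y ^ j = a j • P + b j • Q)
    (ha : HasSum (fun j => (j.factorial : ℂ)⁻¹ * a j) α)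
    (hb : HasSum (fun j => (j.factorial : ℂ)⁻¹ * b j) β) (v : W) :
    e (expEnd X v) = α • P (e v) + β • Q (e v) := by
  have : FiniteDimensional ℂ W := Module.Finite.equiv e.symm
  rw [expEnd_eq (X := X) (P := e.symm.conj P) (Q := e.symm.conj Q) (a := a) (b := b) ?_ ha hb]
  · simp [LinearEquiv.conj_apply]
  · intro j
    ext v
    apply e.injective
    rw [pow_conj e h, hY]
    simp [LinearEquiv.conj_apply]

lemma hasSum_exp (z : ℂ) : HasSum (fun j : ℕ => (j.factorial : ℂ)⁻¹ * z ^ j) (Complex.exp z) := by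
  rw [Complex.exp_eq_exp_ℂ]
  exact NormedSpace.exp_series_hasSum_exp' (𝕂 := ℂ) z

lemma hasSum_exp_deriv (z : ℂ) :
    HasSum (fun j : ℕ => (j.factorial : ℂ)⁻¹ * (j * z ^ (j - 1))) (Complex.exp z) := by
  rw [← hasSum_nat_add_iff' 1]
  simp only [Finset.range_one, Finset.sum_singleton, Nat.cast_zero, zero_mul, mul_zero, sub_zero]
  have key := hasSum_exp z
  refine (funext fun j => ?_ : (fun j : ℕ => _) = _) ▸ key
  have h : ((j + 1 : ℕ) : ℂ) ≠ 0 := Nat.cast_ne_zero.mpr j.succ_ne_zero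
  rw [Nat.factorial_succ, Nat.cast_mul, mul_inv, Nat.add_sub_cancel]
  field_simp

lemma hasSum_exp_zero : HasSum (fun j : ℕ => (j.factorial : ℂ)⁻¹ * (fun _ => 0 : ℕ → ℂ) j) 0 := by
  simp

/-! ### `M` and its characters -/

/-- The generator of `M`. -/
def genM : M := ⟨T, Subgroup.mem_zpowers T⟩

lemma eq_one_or_genM (m : M) : m = 1 ∨ m = genM := by
  rcases eq_one_or_T m.2 with h | h
  · exact Or.inl (Subtype.ext h)
  · exact Or.inr (Subtype.ext h)

lemma genM_mul_self : genM * genM = 1 := Subtype.ext T_mul_T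

lemma genM_inv : genM⁻¹ = genM := inv_eq_of_mul_eq_one_left genM_mul_self

lemma char_genM_sq (σ : M →* ℂˣ) : (σ genM : ℂ) * σ genM = 1 := by
  rw [← Units.val_mul, ← map_mul, genM_mul_self, map_one, Units.val_one]

lemma char_ext {σ τ : M →* ℂˣ} (h : (σ genM : ℂ) = τ genM) : σ = τ := by
  refine MonoidHom.ext fun m => ?_
  rcases eq_one_or_genM m with rfl | rfl
  · rw [map_one, map_one]
  · exact Units.ext h

lemma char_genM (σ : M →* ℂˣ) : (σ genM : ℂ) = 1 ∨ (σ genM : ℂ) = -1 :=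
  mul_self_eq_one_iff.mp (char_genM_sq σ)

lemma signDet_cls {g : Mat} (hg : g.det ≠ 0) :
    (signDet (cls g hg) : ℂ) = ((SignType.sign g.det : SignType) : ℂ) := rfl

lemma signDet_T : (signDet T : ℂ) = -1 := by
  rw [T, signDet_cls]
  simp

lemma detM_genM : (detM genM : ℂ) = -1 := signDet_T

lemma charAM_injective {σ τ : M →* ℂˣ} {lam mu : ℂ} :
    charAM σ lam = charAM τ mu ↔ σ = τ ∧ lam = mu := by
  refine ⟨fun h => ?_, fun h => by rw [h.1, h.2]⟩
  constructor
  · refine char_ext ?_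
    have := congrFun h (1, genM)
    simpa [charAM] using this
  · have h1 : ∀ t : ℝ, Complex.exp (2 * lam * t) = Complex.exp (2 * mu * t) := fun t => by
      have := congrFun h (Multiplicative.ofAdd t, 1)
      simpa [charAM] using this
    have hd : ∀ z : ℂ, HasDerivAt (fun t : ℝ => Complex.exp (2 * z * t)) (2 * z) 0 := fun z => by
      have := ((hasDerivAt_id (0 : ℂ)).const_mul (2 * z)).cexp.comp_ofReal (z := 0)
      simpa using this
    have := (hd lam).unique (by simpa only [← h1] using hd mu)
    exact mul_left_cancel₀ two_ne_zero this

/-! ### Criteria for isomorphism of `AM`-modules -/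

namespace AModule

variable {W : Type*} [AddCommGroup W] [Module ℂ W] (w : AModule W)

lemma act_m_conj {U : Type*} [AddCommGroup U] [Module ℂ U] (e : W ≃ₗ[ℂ] U) {σ : M →* ℂˣ}
    {f : U →ₗ[ℂ] ℂ} (hT : ∀ v, f (e (w.m genM v)) = σ genM * f (e v)) (m : M) (v : W) :
    f (e (w.m m v)) = σ m * f (e v) := by
  rcases eq_one_or_genM m with rfl | rfl
  · simp
  · exact hT v

lemma isIsoTo_charRep (e : W ≃ₗ[ℂ] ℂ) {σ : M →* ℂˣ} {lam : ℂ}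
    (ha : ∀ v, e (w.a v) = 2 * lam * e v) (hT : ∀ v, e (w.m genM v) = σ genM * e v) :
    w.IsIsoTo (charRep σ lam) := by
  refine ⟨e, fun g v => ?_⟩
  set t : ℂ := ((Multiplicative.toAdd g.1 : ℝ) : ℂ) with ht
  have h := expEnd_conj e (X := t • w.a) (Y := (2 * lam * t) • 1) (P := 1) (Q := 0)
    (a := fun j => (2 * lam * t) ^ j) (fun v => by simp [ha]; ring)
    (fun j => by simp [smul_pow]) (hasSum_exp _) hasSum_exp_zero (w.m g.2 v)
  refine h.trans ?_
  have hm := w.act_m_conj e (f := LinearMap.id) hT g.2 v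
  simp only [LinearMap.id_apply] at hm
  simp [hm, charRep, charAM, ht]
  ring

lemma isIsoTo_prod (e : W ≃ₗ[ℂ] ℂ × ℂ) {σ τ : M →* ℂˣ} {lam mu : ℂ}
    (ha : ∀ v, e (w.a v) = (2 * lam * (e v).1, 2 * mu * (e v).2))
    (hT : ∀ v, e (w.m genM v) = (σ genM * (e v).1, τ genM * (e v).2)) :
    w.IsIsoTo ((charRep σ lam).prod (charRep τ mu)) := by
  refine ⟨e, fun g v => ?_⟩
  set t : ℂ := ((Multiplicative.toAdd g.1 : ℝ) : ℂ) with ht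
  have h := expEnd_conj e (X := t • w.a)
    (Y := ((2 * lam * t) • LinearMap.id).prodMap ((2 * mu * t) • LinearMap.id))
    (P := LinearMap.id.prodMap 0) (Q := LinearMap.prodMap 0 LinearMap.id)
    (a := fun j => (2 * lam * t) ^ j) (b := fun j => (2 * mu * t) ^ j)
    (fun v => by simp [ha]; constructor <;> ring)
    (fun j => by
      induction j with
      | zero => ext <;> simp
      | succ j ih => rw [pow_succ, ih]; ext <;> simp [pow_succ])
    (hasSum_exp _) (hasSum_exp _) (w.m g.2 v)
  refine h.trans ?_
  have h1 := w.act_m_conj e (f := LinearMap.fst ℂ ℂ ℂ) (σ := σ) (fun v => by simp [hT]) g.2 v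
  have h2 := w.act_m_conj e (f := LinearMap.snd ℂ ℂ ℂ) (σ := τ) (fun v => by simp [hT]) g.2 v
  simp only [LinearMap.fst_apply, LinearMap.snd_apply] at h1 h2
  ext
  · simp [h1, charRep, charAM, ht, Representation.prod]; ring
  · simp [h2, charRep, charAM, ht, Representation.prod]; ring

lemma isIsoTo_jordanRep (e : W ≃ₗ[ℂ] ℂ × ℂ) {σ : M →* ℂˣ} {lam : ℂ}
    (ha : ∀ v, e (w.a v) = (2 * lam * (e v).1 + (e v).2, 2 * lam * (e v).2))
    (hT : ∀ v, e (w.m genM v) = (σ genM : ℂ) • e v) :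
    w.IsIsoTo (jordanRep σ lam) := by
  refine ⟨e, fun g v => ?_⟩
  set t : ℂ := ((Multiplicative.toAdd g.1 : ℝ) : ℂ) with ht
  have h := expEnd_conj e (X := t • w.a)
    (Y := (2 * lam * t) • 1 + t • LinearMap.inl ℂ ℂ ℂ ∘ₗ LinearMap.snd ℂ ℂ ℂ)
    (P := 1) (Q := t • LinearMap.inl ℂ ℂ ℂ ∘ₗ LinearMap.snd ℂ ℂ ℂ)
    (a := fun j => (2 * lam * t) ^ j) (b := fun j => j * (2 * lam * t) ^ (j - 1))
    (fun v => by ext <;> simp [ha] <;> ring)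
    (fun j => by
      induction j with
      | zero => ext <;> simp
      | succ j ih =>
        rw [pow_succ, ih]
        rcases j with _ | j
        · ext <;> simp
        · ext <;> simp [pow_succ]
          ring)
    (hasSum_exp _) (hasSum_exp_deriv _) (w.m g.2 v)
  refine h.trans ?_
  have h1 := w.act_m_conj e (f := LinearMap.fst ℂ ℂ ℂ) (σ := σ) (fun v => by simp [hT]) g.2 v
  have h2 := w.act_m_conj e (f := LinearMap.snd ℂ ℂ ℂ) (σ := σ) (fun v => by simp [hT]) g.2 v
  simp only [LinearMap.fst_apply, LinearMap.snd_apply] at h1 h2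
  ext
  · simp [h1, h2, jordanRep, charAM, ← ht]; ring
  · simp [h2, jordanRep, charAM, ← ht]; ring

/-! ### Generalized eigenspaces -/

lemma mem_genEigenspace {σ : M →* ℂˣ} {lam : ℂ} {v : W} : v ∈ w.genEigenspace σ lam ↔
    ∃ j : ℕ, ∀ g, ((w.act g - charAM σ lam g • (1 : Module.End ℂ W)) ^ j) v = 0 := by
  unfold genEigenspace
  rw [Submodule.mem_iSup_of_directed]
  · simp
  · refine Monotone.directed_le fun i j hij => iInf_mono fun g => ?_
    intro v hv
    rw [LinearMap.mem_ker] at *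
    rw [← Nat.sub_add_cancel hij, pow_add, Module.End.mul_apply, hv, map_zero]

lemma finrank_genEigenspace {w : AModule W} {U : Type*} [AddCommGroup U] [Module ℂ U]
    {ρ : Representation ℂ AM U} (h : w.IsIsoTo ρ) {σ : M →* ℂˣ} {lam : ℂ} (S : Submodule ℂ U)
    (hS : ∀ u, u ∈ S ↔ ∃ j : ℕ, ∀ g, ((ρ g - charAM σ lam g • (1 : Module.End ℂ U)) ^ j) u = 0) :
    Module.finrank ℂ (w.genEigenspace σ lam) = Module.finrank ℂ S := by
  obtain ⟨e, he⟩ := h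
  have : w.genEigenspace σ lam = S.comap e.toLinearMap := by
    ext v
    rw [mem_genEigenspace, Submodule.mem_comap]
    refine Iff.trans ?_ (hS (e v)).symm
    refine exists_congr fun j => forall_congr' fun g => ?_
    rw [← pow_conj e (X := w.act g - charAM σ lam g • (1 : Module.End ℂ W)), e.map_eq_zero_iff]
    intro v
    simp [he]
  rw [this]
  exact (e.ofSubmodule' S).finrank_eq

end AModule

/-- A product of subspaces is the product of the subspaces as vector spaces. -/
def submoduleProdEquiv {V W : Type*} [AddCommGroup V] [Module ℂ V] [AddCommGroup W] [Module ℂ W]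
    (S : Submodule ℂ V) (R : Submodule ℂ W) : S.prod R ≃ₗ[ℂ] S × R where
  toFun x := (⟨x.1.1, x.2.1⟩, ⟨x.1.2, x.2.2⟩)
  invFun x := ⟨(x.1.1, x.2.1), x.1.2, x.2.2⟩
  map_add' _ _ := rfl
  map_smul' _ _ := rfl

open Classical in
/-- The generalized eigenspace of `charRep c`, as a subspace of `ℂ`. -/
def charSpace (c χ : AM → ℂ) : Submodule ℂ ℂ := if χ = c then ⊤ else ⊥

lemma mem_charSpace {c χ : AM → ℂ} {x : ℂ} :
    x ∈ charSpace c χ ↔ ∃ j : ℕ, ∀ g, (c g - χ g) ^ j * x = 0 := by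
  unfold charSpace
  split_ifs with h
  · subst h
    exact ⟨fun _ => ⟨1, by simp⟩, fun _ => trivial⟩
  · rw [Submodule.mem_bot]
    refine ⟨fun hx => ⟨0, by simp [hx]⟩, fun ⟨j, hj⟩ => ?_⟩
    obtain ⟨g, hg⟩ := Function.ne_iff.mp h
    exact (mul_eq_zero.mp (hj g)).resolve_left (pow_ne_zero _ (sub_ne_zero.mpr (Ne.symm hg)))

lemma finrank_charSpace (σ τ : M →* ℂˣ) (lam mu : ℂ) :
    (Module.finrank ℂ (charSpace (charAM σ lam) (charAM τ mu)) : ℤ)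
      = iverson (τ = σ ∧ mu = lam) := by
  by_cases h : charAM τ mu = charAM σ lam
  · rw [charSpace, if_pos h]
    simp [iverson, charAM_injective.mp h]
  · have h' := mt charAM_injective.mpr h
    rw [charSpace, if_neg h]
    simp [iverson, h']

lemma charRep_sub_pow (σ τ : M →* ℂˣ) (lam mu : ℂ) (g : AM) (j : ℕ) (x : ℂ) :
    ((charRep σ lam g - charAM τ mu g • (1 : Module.End ℂ ℂ)) ^ j) x
      = (charAM σ lam g - charAM τ mu g) ^ j * x := by
  have : charRep σ lam g - charAM τ mu g • (1 : Module.End ℂ ℂ)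
      = (charAM σ lam g - charAM τ mu g) • 1 := by
    rw [sub_smul]; rfl
  rw [this, smul_pow]
  simp

namespace AModule

variable {W : Type*} [AddCommGroup W] [Module ℂ W] {w : AModule W}

lemma IsIsoTo.finrank_charRep {σ : M →* ℂˣ} {lam : ℂ} (h : w.IsIsoTo (charRep σ lam))
    (τ : M →* ℂˣ) (mu : ℂ) :
    (Module.finrank ℂ (w.genEigenspace τ mu) : ℤ) = iverson (τ = σ ∧ mu = lam) := by
  rw [finrank_genEigenspace h (charSpace (charAM σ lam) (charAM τ mu)), finrank_charSpace]
  intro u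
  rw [mem_charSpace]
  simp only [charRep_sub_pow]

lemma IsIsoTo.finrank_prod {σ σ' : M →* ℂˣ} {lam lam' : ℂ}
    (h : w.IsIsoTo ((charRep σ lam).prod (charRep σ' lam'))) (τ : M →* ℂˣ) (mu : ℂ) :
    (Module.finrank ℂ (w.genEigenspace τ mu) : ℤ)
      = iverson (τ = σ ∧ mu = lam) + iverson (τ = σ' ∧ mu = lam') := by
  rw [finrank_genEigenspace h ((charSpace (charAM σ lam) (charAM τ mu)).prod
    (charSpace (charAM σ' lam') (charAM τ mu))), ← finrank_charSpace, ← finrank_charSpace,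
    LinearEquiv.finrank_eq (submoduleProdEquiv _ _), Module.finrank_prod]
  · push_cast; rfl
  intro u
  have key : ∀ (g : AM) (j : ℕ), ((((charRep σ lam).prod (charRep σ' lam')) g
      - charAM τ mu g • (1 : Module.End ℂ (ℂ × ℂ))) ^ j) u
      = ((charAM σ lam g - charAM τ mu g) ^ j * u.1,
        (charAM σ' lam' g - charAM τ mu g) ^ j * u.2) := by
    intro g j
    have : ((charRep σ lam).prod (charRep σ' lam')) g
      - charAM τ mu g • (1 : Module.End ℂ (ℂ × ℂ))
      = (charRep σ lam g - charAM τ mu g • (1 : Module.End ℂ ℂ)).prodMap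
        (charRep σ' lam' g - charAM τ mu g • (1 : Module.End ℂ ℂ)) := by
      ext <;> simp [Representation.prod]
    rw [this, ← charRep_sub_pow, ← charRep_sub_pow]
    exact congrArg (fun A : Module.End ℂ (ℂ × ℂ) => A u) (map_pow (LinearMap.prodMapRingHom ℂ ℂ ℂ)
      (charRep σ lam g - charAM τ mu g • (1 : Module.End ℂ ℂ),
        charRep σ' lam' g - charAM τ mu g • (1 : Module.End ℂ ℂ)) j).symm
  simp only [key, Submodule.mem_prod, Prod.mk_eq_zero]
  rw [mem_charSpace, mem_charSpace]
  constructor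
  · rintro ⟨⟨i, hi⟩, ⟨j, hj⟩⟩
    exact ⟨i + j, fun g => ⟨by rw [pow_add, mul_right_comm, hi, zero_mul],
      by rw [pow_add, mul_assoc, hj, mul_zero]⟩⟩
  · rintro ⟨j, hj⟩
    exact ⟨⟨j, fun g => (hj g).1⟩, ⟨j, fun g => (hj g).2⟩⟩

lemma IsIsoTo.finrank_jordanRep {σ : M →* ℂˣ} {lam : ℂ} (h : w.IsIsoTo (jordanRep σ lam))
    (τ : M →* ℂˣ) (mu : ℂ) :
    (Module.finrank ℂ (w.genEigenspace τ mu) : ℤ)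
      = iverson (τ = σ ∧ mu = lam) + iverson (τ = σ ∧ mu = lam) := by
  classical
  have key : ∀ g : AM, jordanRep σ lam g - charAM τ mu g • (1 : Module.End ℂ (ℂ × ℂ))
      = (charAM σ lam g - charAM τ mu g) • 1 + (charAM σ lam g *
        ((Multiplicative.toAdd g.1 : ℝ) : ℂ)) • LinearMap.inl ℂ ℂ ℂ ∘ₗ LinearMap.snd ℂ ℂ ℂ := by
    intro g
    ext <;> simp [jordanRep]
  by_cases hc : τ = σ ∧ mu = lam
  · rw [finrank_genEigenspace h ⊤]
    · simp [iverson, hc]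
    · refine fun u => ⟨fun _ => ⟨2, fun g => ?_⟩, fun _ => trivial⟩
      rw [key, hc.1, hc.2, pow_two]
      simp
  · rw [finrank_genEigenspace h ⊥]
    · simp [iverson, hc]
    · refine fun u => ⟨fun hu => ⟨0, fun g => by simpa using hu⟩, fun ⟨j, hj⟩ => ?_⟩
      rw [← charAM_injective] at hc
      obtain ⟨g, hg⟩ := Function.ne_iff.mp hc
      have hne := sub_ne_zero.mpr (Ne.symm hg)
      rw [Submodule.mem_bot]
      have hinj : Function.Injective
          (jordanRep σ lam g - charAM τ mu g • (1 : Module.End ℂ (ℂ × ℂ))) := by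
        rw [key, injective_iff_map_eq_zero]
        rintro ⟨x, y⟩ hxy
        simp only [LinearMap.add_apply, LinearMap.smul_apply, Module.End.one_apply,
          LinearMap.comp_apply, LinearMap.snd_apply, LinearMap.inl_apply, Prod.smul_mk,
          Prod.mk_add_mk, smul_eq_mul, mul_zero, add_zero, Prod.mk_eq_zero] at hxy
        have hy := (mul_eq_zero.mp hxy.2).resolve_left hne
        have hx := hxy.1
        rw [hy, mul_zero, add_zero] at hx
        rw [hy, (mul_eq_zero.mp hx).resolve_left hne]
        rfl
      have hj' := hj g
      rw [Module.End.pow_apply] at hj'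
      exact (hinj.iterate j) (hj'.trans (by rw [← Module.End.pow_apply, map_zero]))

end AModule

/-! ### Rotations and the Iwasawa decomposition -/

/-- The rotation matrix `exp(θ J)`. -/
def rotMat (θ : ℝ) : Mat := !![Real.cos θ, -Real.sin θ; Real.sin θ, Real.cos θ]

open scoped Matrix.Norms.Operator in
lemma exp_smul_J (θ : ℝ) : NormedSpace.exp (θ • J) = rotMat θ := by
  have hJ : J * J = -1 := by
    ext i j; fin_cases i <;> fin_cases j <;> simp [J]
  have hc : Continuous (Complex.liftAux J hJ) :=
    (Complex.liftAux J hJ).toLinearMap.continuous_of_finiteDimensional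
  have h := NormedSpace.map_exp (Complex.liftAux J hJ) hc (θ * Complex.I)
  have h1 : Complex.liftAux J hJ (θ * Complex.I) = θ • J := by
    rw [Complex.liftAux_apply]; simp
  rw [h1, ← Complex.exp_eq_exp_ℂ, Complex.liftAux_apply, Complex.exp_ofReal_mul_I_re,
    Complex.exp_ofReal_mul_I_im] at h
  refine h.symm.trans ?_
  ext i j; fin_cases i <;> fin_cases j <;> simp [J, rotMat, Matrix.algebraMap_matrix_apply]

lemma det_rotMat (θ : ℝ) : (rotMat θ).det ≠ 0 := by
  have := Real.cos_sq_add_sin_sq θ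
  simp only [rotMat, Matrix.det_fin_two_of]
  rw [show Real.cos θ * Real.cos θ - -Real.sin θ * Real.sin θ = 1 by linarith]
  exact one_ne_zero

lemma cls_congr {g h : Mat} (hg : g.det ≠ 0) (e : g = h) : cls g hg = cls h (e ▸ hg) := by
  subst e; rfl

lemma cls_smul {g : Mat} (hg : g.det ≠ 0) {c : ℝ} (hc : c ≠ 0) (hcg : (c • g).det ≠ 0) :
    cls (c • g) hcg = cls g hg := by
  unfold cls
  rw [eq_comm, Matrix.ProjGenLinGroup.mk_eq_mk_iff]
  refine ⟨Units.mk0 c hc, Units.ext ?_⟩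
  change g * Matrix.scalar (Fin 2) c = c • g
  ext i j
  simp [Matrix.mul_diagonal, mul_comm]

lemma cls_one (h : (1 : Mat).det ≠ 0) : cls 1 h = 1 := by
  unfold cls
  rw [← map_one Matrix.ProjGenLinGroup.mk]
  exact congrArg Matrix.ProjGenLinGroup.mk (Units.ext rfl)

lemma rot_coe (θ : ℝ) : (rot θ : G) = cls (rotMat θ) (det_rotMat θ) :=
  cls_congr _ (exp_smul_J θ)

lemma rot_add (s t : ℝ) : rot (s + t) = rot s * rot t := by
  refine Subtype.ext ?_
  have h : rotMat (s + t) = rotMat s * rotMat t := by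
    ext i j; fin_cases i <;> fin_cases j <;>
      simp [rotMat, Real.cos_add, Real.sin_add] <;> ring
  change (rot (s + t) : G) = rot s * rot t
  rw [rot_coe, rot_coe, rot_coe, ← cls_mul _ _ (by rw [← h]; exact det_rotMat _)]
  exact cls_congr _ h

lemma rot_zero : rot 0 = 1 := by
  have h := rot_add 0 0
  rw [add_zero] at h
  exact left_eq_mul.mp h

lemma rot_pi : rot Real.pi = 1 := by
  refine Subtype.ext ?_
  have h : rotMat Real.pi = (-1 : ℝ) • (1 : Mat) := by
    ext i j; fin_cases i <;> fin_cases j <;> simp [rotMat]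
  change (rot Real.pi : G) = 1
  rw [rot_coe, cls_congr _ h, cls_smul (by simp) (by norm_num), cls_one]

lemma exists_polar (c d : ℝ) : ∃ θ r : ℝ, 0 ≤ r ∧ r ^ 2 = c ^ 2 + d ^ 2 ∧
    d = r * Real.cos θ ∧ c = r * Real.sin θ := by
  refine ⟨Complex.arg ⟨d, c⟩, ‖(⟨d, c⟩ : ℂ)‖, norm_nonneg _, ?_, ?_, ?_⟩
  · rw [Complex.sq_norm, Complex.normSq_mk]; ring
  · exact (Complex.norm_mul_cos_arg ⟨d, c⟩).symm
  · exact (Complex.norm_mul_sin_arg ⟨d, c⟩).symm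

lemma exists_upper_mul_rot (g : Mat) : ∃ p q r θ : ℝ, 0 ≤ r ∧
    r ^ 2 = g 1 0 ^ 2 + g 1 1 ^ 2 ∧ q * r = g 0 0 * g 1 0 + g 0 1 * g 1 1 ∧
    g = !![p, q; 0, r] * rotMat θ := by
  obtain ⟨θ, r, hr, h2, hd, hc⟩ := exists_polar (g 1 0) (g 1 1)
  have hcs := Real.cos_sq_add_sin_sq θ
  refine ⟨g 0 0 * Real.cos θ - g 0 1 * Real.sin θ, g 0 0 * Real.sin θ + g 0 1 * Real.cos θ, r, θ,
    hr, h2, by rw [hd, hc]; ring, ?_⟩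
  ext i j; fin_cases i <;> fin_cases j <;> simp [rotMat]
  · linear_combination (-g 0 0) * hcs
  · linear_combination (-g 0 1) * hcs
  · exact hc
  · exact hd

lemma diag_T_mul (p q r : ℝ) (h : !![p, q; 0, r].det ≠ 0) :
    T * cls !![p, q; 0, r] h = cls !![-p, -q; 0, r] (by simpa using h) := by
  unfold T
  have e : !![-1, 0; 0, 1] * !![p, q; 0, r] = !![-p, -q; 0, r] := by
    ext i j; fin_cases i <;> fin_cases j <;> simp
  rw [← cls_mul _ _ (by rw [e]; simpa using h)]
  exact cls_congr _ e

lemma upper_pos {p q r : ℝ} (hp : 0 < p) (hr : 0 < r) (h : !![p, q; 0, r].det ≠ 0) :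
    ∃ t u, cls !![p, q; 0, r] h = a t * n u := by
  set t := Real.log (p / r) / 2 with ht
  have hτ : Real.exp t * Real.exp t = p / r := by
    rw [← Real.exp_add, ht, add_halves, Real.exp_log (div_pos hp hr)]
  have hτp := Real.exp_pos t
  have hτi : Real.exp t * Real.exp (-t) = 1 := by rw [← Real.exp_add]; simp
  have hτ' : r * (Real.exp t * Real.exp t) = p := by rw [hτ]; field_simp
  refine ⟨t, q / p, ?_⟩
  unfold a n
  have e : !![p, q; 0, r] = (r * Real.exp t) •
      (!![Real.exp t, 0; 0, Real.exp (-t)] * !![1, q / p; 0, 1]) := by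
    ext i j; fin_cases i <;> fin_cases j <;> simp
    · linear_combination -hτ'
    · field_simp; linear_combination (-q) * hτ'
    · linear_combination (-r) * hτi
  have h1 : (!![Real.exp t, 0; 0, Real.exp (-t)] * !![1, q / p; 0, 1]).det ≠ 0 := by
    simp
  rw [cls_congr h e, cls_smul h1 (mul_pos hr hτp).ne', cls_mul]

/-- The Iwasawa decomposition `G = M A N K₀`. -/
lemma exists_iwasawa (x : G) : ∃ (m : M) (t u θ : ℝ), x = m * a t * n u * rot θ := by
  obtain ⟨g, hg, rfl⟩ := exists_cls x
  obtain ⟨p, q, r, θ, hr, -, -, e⟩ := exists_upper_mul_rot g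
  have hd : !![p, q; 0, r].det ≠ 0 := by
    intro h
    rw [e, Matrix.det_mul, h, zero_mul] at hg
    exact hg rfl
  have hpr : p * r ≠ 0 := by simpa using hd
  have hr' : 0 < r := lt_of_le_of_ne hr (right_ne_zero_of_mul hpr).symm
  have hx : cls g hg = cls !![p, q; 0, r] hd * rot θ := by
    rw [rot_coe, ← cls_mul _ _ (e ▸ hg)]
    exact cls_congr hg e
  rcases lt_or_gt_of_ne (left_ne_zero_of_mul hpr) with hp | hp
  · have hd' : !![-p, -q; 0, r].det ≠ 0 := by simpa using hd
    obtain ⟨t, u, h⟩ := upper_pos (q := -q) (neg_pos.mpr hp) hr' hd'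
    refine ⟨genM, t, u, θ, ?_⟩
    rw [hx, mul_assoc (genM : G), ← h]
    change _ = T * _ * _
    rw [diag_T_mul]
    simp
  · obtain ⟨t, u, h⟩ := upper_pos (q := q) hp hr' hd
    exact ⟨1, t, u, θ, by rw [hx, h]; simp⟩

lemma exists_M_mul_rot (k : K) : ∃ (m : M) (θ : ℝ), (k : G) = m * rot θ := by
  obtain ⟨g, hg, hk⟩ := k.2
  have hO : g.1 * g.1.transpose = 1 := (Matrix.mem_orthogonalGroup_iff _ _).mp hg
  have h00 := congrFun (congrFun hO 0) 0
  have h01 := congrFun (congrFun hO 0) 1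
  have h11 := congrFun (congrFun hO 1) 1
  simp only [Matrix.mul_apply, Matrix.transpose_apply, Fin.sum_univ_two, Matrix.one_apply_eq,
    Matrix.one_apply_ne (zero_ne_one : (0 : Fin 2) ≠ 1)] at h00 h01 h11
  obtain ⟨p, q, r, θ, hr, hr2, hq, e⟩ := exists_upper_mul_rot g.1
  have hr1 : r = 1 := by
    have : r ^ 2 = 1 := by rw [hr2]; linarith
    exact (pow_eq_one_iff_of_nonneg hr two_ne_zero).mp this
  have hq0 : q = 0 := by rw [h01, hr1, mul_one] at hq; exact hq
  subst hr1 hq0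
  have hgd : g.1.det ≠ 0 := ((Matrix.isUnit_iff_isUnit_det _).mp g.isUnit).ne_zero
  have hp : p = 1 ∨ p = -1 := by
    rw [← mul_self_eq_one_iff]
    have e0 : g.1 0 0 = p * Real.cos θ := by rw [e]; simp [rotMat]
    have e1 : g.1 0 1 = -(p * Real.sin θ) := by rw [e]; simp [rotMat]
    rw [e0, e1] at h00
    linear_combination h00 - p ^ 2 * Real.cos_sq_add_sin_sq θ
  have hkg : (k : G) = cls g.1 hgd := by
    rw [← hk]
    unfold cls
    exact congrArg Matrix.ProjGenLinGroup.mk (Units.ext rfl)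
  have hd : !![p, 0; 0, 1].det ≠ 0 := by rcases hp with rfl | rfl <;> simp
  have hx : (k : G) = cls !![p, 0; 0, 1] hd * rot θ := by
    rw [hkg, rot_coe, ← cls_mul _ _ (e ▸ hgd)]
    exact cls_congr hgd e
  rcases hp with rfl | rfl
  · refine ⟨1, θ, ?_⟩
    have : (!![1, 0; 0, 1] : Mat) = 1 := by
      ext i j; fin_cases i <;> fin_cases j <;> simp
    rw [hx, cls_congr hd this, cls_one]
    simp
  · exact ⟨genM, θ, hx⟩

/-! ### The action of the rotations on a `(𝔤, K)`-module -/

namespace GKModule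

variable {V : Type*} [AddCommGroup V] [Module ℂ V] (π : GKModule V)

lemma hasDerivAt_rot_at (v : V) (ℓ : V →ₗ[ℂ] ℂ) (t : ℝ) :
    HasDerivAt (fun t : ℝ => ℓ (π.act (rot t) v)) (ℓ (π.act (rot t) (π.lie Jsl v))) t := by
  have h := π.hasDerivAt v (ℓ ∘ₗ π.act (rot t))
  rw [← sub_self t] at h
  refine (h.comp_sub_const t t).congr_of_eventuallyEq (Filter.Eventually.of_forall fun s => ?_)
  change ℓ (π.act (rot s) v) = ℓ (π.act (rot t) (π.act (rot (s - t)) v))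
  rw [← Module.End.mul_apply, ← map_mul, ← rot_add, add_sub_cancel]

lemma act_rot_of_jordan {μ : ℂ} {y z : V} (hy : π.lie Jsl y = μ • y + z)
    (hz : ∀ t : ℝ, π.act (rot t) z = Complex.exp (μ * t) • z) (t : ℝ) :
    π.act (rot t) y = Complex.exp (μ * t) • (y + (t : ℂ) • z) := by
  rw [← sub_eq_zero, ← Module.forall_dual_apply_eq_zero_iff ℂ]
  intro ℓ
  have hexp : ∀ s : ℝ, HasDerivAt (fun s : ℝ => Complex.exp (-μ * s))
      (Complex.exp (-μ * s) * -μ) s := fun s => by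
    simpa using ((hasDerivAt_id (s : ℂ)).const_mul (-μ)).cexp.comp_ofReal
  have hid : ∀ s : ℝ, HasDerivAt (fun s : ℝ => (s : ℂ)) 1 s := fun s =>
    (hasDerivAt_id (s : ℂ)).comp_ofReal
  have hg : ∀ s : ℝ, HasDerivAt (fun s : ℝ => Complex.exp (-μ * s) * ℓ (π.act (rot s) y)
      - s * ℓ z) 0 s := fun s => by
    refine (((hexp s).mul (π.hasDerivAt_rot_at y ℓ s)).sub ((hid s).mul_const (ℓ z))).congr_deriv ?_
    rw [hy, map_add, map_add, hz, map_smul, map_smul, map_smul]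
    have : Complex.exp (-μ * s) * Complex.exp (μ * s) = 1 := by rw [← Complex.exp_add]; simp
    simp only [smul_eq_mul]
    linear_combination (ℓ z) * this
  have hc := is_const_of_deriv_eq_zero (fun s => (hg s).differentiableAt)
    (fun s => (hg s).deriv) t 0
  simp only [Complex.ofReal_zero, mul_zero, Complex.exp_zero, one_mul, zero_mul, sub_zero,
    rot_zero, map_one, Module.End.one_apply] at hc
  have : Complex.exp (μ * t) * Complex.exp (-μ * t) = 1 := by rw [← Complex.exp_add]; simp
  simp only [map_sub, map_smul, map_add, smul_eq_mul]
  linear_combination Complex.exp (μ * t) * hc - (ℓ (π.act (rot t) y)) * this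

lemma act_rot_of_eigen {μ : ℂ} {v : V} (hv : π.lie Jsl v = μ • v) (t : ℝ) :
    π.act (rot t) v = Complex.exp (μ * t) • v := by
  have := π.act_rot_of_jordan (z := 0) (by rw [hv, add_zero]) (fun t => by simp) t
  simpa using this

lemma exp_pi_of_eigen {μ : ℂ} {v : V} (hv : π.lie Jsl v = μ • v) (h0 : v ≠ 0) :
    Complex.exp (μ * Real.pi) = 1 := by
  have h := π.act_rot_of_eigen hv Real.pi
  rw [rot_pi, map_one, Module.End.one_apply] at h
  have h1 : (Complex.exp (μ * Real.pi) - 1) • v = 0 := by rw [sub_smul, ← h, one_smul, sub_self]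
  exact sub_eq_zero.mp ((smul_eq_zero.mp h1).resolve_right h0)

lemma eigenvalue_Jsl {μ : ℂ} {v : V} (hv : π.lie Jsl v = μ • v) (h0 : v ≠ 0) :
    ∃ k : ℤ, μ = 2 * Complex.I * k := by
  obtain ⟨k, hk⟩ := Complex.exp_eq_one_iff.mp (π.exp_pi_of_eigen hv h0)
  refine ⟨k, mul_right_cancel₀ (Complex.ofReal_ne_zero.mpr Real.pi_ne_zero) ?_⟩
  rw [hk]; ring

lemma eigen_of_sq {μ : ℂ} {y : V}
    (h : (π.lie Jsl - μ • 1) ((π.lie Jsl - μ • 1) y) = 0) : (π.lie Jsl - μ • 1) y = 0 := by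
  set z := (π.lie Jsl - μ • (1 : Module.End ℂ V)) y with hz
  by_contra h0
  have hJz : π.lie Jsl z = μ • z := by
    have : π.lie Jsl z - μ • z = 0 := h
    exact sub_eq_zero.mp this
  have hJy : π.lie Jsl y = μ • y + z := by
    rw [hz, LinearMap.sub_apply]; simp
  have h1 := π.act_rot_of_jordan hJy (π.act_rot_of_eigen hJz) Real.pi
  rw [rot_pi, map_one, Module.End.one_apply, π.exp_pi_of_eigen hJz h0, one_smul,
    left_eq_add, smul_eq_zero] at h1
  exact h1.elim (Complex.ofReal_ne_zero.mpr Real.pi_ne_zero) h0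

lemma eigen_of_pow {μ : ℂ} (j : ℕ) {y : V} (h : ((π.lie Jsl - μ • 1) ^ j) y = 0) :
    (π.lie Jsl - μ • 1) y = 0 := by
  induction j generalizing y with
  | zero =>
    rw [pow_zero, Module.End.one_apply] at h
    rw [h, map_zero]
  | succ j ih =>
    rw [pow_succ, Module.End.mul_apply] at h
    exact π.eigen_of_sq (ih h)

lemma lie_Jsl_mem_span (v : V) :
    π.lie Jsl v ∈ Submodule.span ℂ (Set.range fun k : K => π.act k v) := by
  by_contra h
  obtain ⟨ℓ, h1, h2⟩ := Submodule.exists_le_ker_of_notMem h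
  have h3 : (fun t : ℝ => ℓ (π.act (rot t) v)) = fun _ => 0 := funext fun t =>
    h2 (Submodule.subset_span ⟨rot t, rfl⟩)
  have h4 := π.hasDerivAt v ℓ
  rw [h3] at h4
  exact h1 (h4.unique (hasDerivAt_const _ _))

/-- A `(𝔤, K)`-module of `PGL₂(ℝ)` is spanned by weight vectors for `K₀`. -/
lemma iSup_eigenspace_Jsl :
    ⨆ k : ℤ, Module.End.eigenspace (π.lie Jsl) (2 * Complex.I * k) = ⊤ := by
  rw [eq_top_iff]
  intro v _
  set Y := Submodule.span ℂ (Set.range fun k : K => π.act k v) with hY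
  have hfin : FiniteDimensional ℂ Y := π.locallyFinite v
  have hact : ∀ (l : K), ∀ y ∈ Y, π.act l y ∈ Y := by
    intro l y hy
    induction hy using Submodule.span_induction with
    | mem y h =>
      obtain ⟨k, rfl⟩ := h
      exact Submodule.subset_span ⟨l * k, by simp⟩
    | zero => rw [map_zero]; exact Y.zero_mem
    | add y z _ _ h1 h2 => rw [map_add]; exact Y.add_mem h1 h2
    | smul c y _ h => rw [map_smul]; exact Y.smul_mem c h
  have hJ : ∀ y ∈ Y, π.lie Jsl y ∈ Y := by
    intro y hy
    refine (Submodule.span_le.mpr ?_) (π.lie_Jsl_mem_span y)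
    rintro _ ⟨k, rfl⟩
    exact hact k y hy
  have htop := Module.End.iSup_maxGenEigenspace_eq_top ((π.lie Jsl).restrict hJ)
  have hv : v ∈ (⊤ : Submodule ℂ Y).map Y.subtype := by
    rw [Submodule.map_top, Submodule.range_subtype]
    exact Submodule.subset_span ⟨1, by simp⟩
  rw [← htop, Submodule.map_iSup] at hv
  refine SetLike.le_def.mp (iSup_le fun μ => ?_) hv
  rintro _ ⟨x, hx, rfl⟩
  obtain ⟨j, hj⟩ := Module.End.mem_maxGenEigenspace _ _ _ |>.mp hx
  have hpow : ∀ (j : ℕ) (x : Y), ((((π.lie Jsl).restrict hJ - μ • 1) ^ j) x : Y).1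
      = ((π.lie Jsl - μ • 1) ^ j) x.1 := by
    intro j
    induction j with
    | zero => intro x; rfl
    | succ j ih =>
      intro x
      rw [pow_succ, pow_succ, Module.End.mul_apply, Module.End.mul_apply, ih]
      rfl
  have hx1 := π.eigen_of_pow j ((hpow j x).symm.trans (congrArg Subtype.val hj))
  rw [LinearMap.sub_apply, sub_eq_zero] at hx1
  have hx2 : π.lie Jsl x.1 = μ • x.1 := hx1
  change x.1 ∈ _
  by_cases h0 : x.1 = 0
  · rw [h0]; exact Submodule.zero_mem _
  · obtain ⟨k, rfl⟩ := π.eigenvalue_Jsl hx2 h0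
    exact Submodule.mem_iSup_of_mem k (Module.End.mem_eigenspace_iff.mpr hx2)

end GKModule

/-! ### Weight vectors in the principal series -/

/-- The function `g ↦ σ(sign det g) |det g / (c² + d²)|^{λ + 1/2} ((d + ic) / (d - ic))^k` of a matrix
with lower row `(c, d)`. -/
def weightMat (σ : M →* ℂˣ) (lam : ℂ) (k : ℤ) (g : Mat) : ℂ :=
  (if 0 < g.det then 1 else (σ genM : ℂ)) *
    Complex.exp ((lam + 1 / 2) * (Real.log (g.det / (g 1 0 ^ 2 + g 1 1 ^ 2)) : ℝ)) *
    ((g 1 1 + g 1 0 * Complex.I) / (g 1 1 - g 1 0 * Complex.I)) ^ k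

lemma row_ne {g : Mat} (hg : g.det ≠ 0) : 0 < g 1 0 ^ 2 + g 1 1 ^ 2 := by
  rw [Matrix.det_fin_two] at hg
  rcases eq_or_ne (g 1 0) 0 with h | h
  · have : g 1 1 ≠ 0 := by rintro h'; rw [h, h'] at hg; simp at hg
    positivity
  · positivity

lemma row_mul (c d : ℝ) : ((d : ℂ) + c * Complex.I) * (d - c * Complex.I)
    = ((c ^ 2 + d ^ 2 : ℝ) : ℂ) := by
  push_cast
  linear_combination (-(c : ℂ) ^ 2) * Complex.I_sq

lemma row_add_ne {g : Mat} (hg : g.det ≠ 0) : (g 1 1 + g 1 0 * Complex.I : ℂ) ≠ 0 := by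
  intro h
  have := row_mul (g 1 0) (g 1 1)
  rw [h, zero_mul] at this
  exact (row_ne hg).ne (by exact_mod_cast this)

lemma row_sub_ne {g : Mat} (hg : g.det ≠ 0) : (g 1 1 - g 1 0 * Complex.I : ℂ) ≠ 0 := by
  intro h
  have := row_mul (g 1 0) (g 1 1)
  rw [h, mul_zero] at this
  exact (row_ne hg).ne (by exact_mod_cast this)

lemma weightMat_upper (σ : M →* ℂˣ) (lam : ℂ) (k : ℤ) {p q r : ℝ} (hp : p ≠ 0) (hr : r ≠ 0)
    {g : Mat} (hg : g.det ≠ 0) : weightMat σ lam k (!![p, q; 0, r] * g)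
      = (if 0 < p * r then 1 else (σ genM : ℂ)) *
        Complex.exp ((lam + 1 / 2) * (Real.log (p / r) : ℝ)) * weightMat σ lam k g := by
  have h10 : (!![p, q; 0, r] * g) 1 0 = r * g 1 0 := by simp [Matrix.mul_apply]
  have h11 : (!![p, q; 0, r] * g) 1 1 = r * g 1 1 := by simp [Matrix.mul_apply]
  have hd : (!![p, q; 0, r] * g).det = p * r * g.det := by
    rw [Matrix.det_mul, Matrix.det_fin_two_of]; ring
  have hS := row_ne hg
  have hlog : Real.log ((p * r * g.det) / ((r * g 1 0) ^ 2 + (r * g 1 1) ^ 2))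
      = Real.log (p / r) + Real.log (g.det / (g 1 0 ^ 2 + g 1 1 ^ 2)) := by
    rw [← Real.log_mul (div_ne_zero hp hr) (div_ne_zero hg hS.ne')]
    congr 1
    field_simp
  have hratio : (((r * g 1 1 : ℝ) : ℂ) + (r * g 1 0 : ℝ) * Complex.I) /
      ((r * g 1 1 : ℝ) - (r * g 1 0 : ℝ) * Complex.I)
      = (g 1 1 + g 1 0 * Complex.I) / (g 1 1 - g 1 0 * Complex.I) := by
    push_cast
    rw [mul_assoc, ← mul_add, ← mul_sub,
      mul_div_mul_left _ _ (Complex.ofReal_ne_zero.mpr hr)]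
  have hsign : (if 0 < p * r * g.det then 1 else (σ genM : ℂ))
      = (if 0 < p * r then 1 else (σ genM : ℂ)) * (if 0 < g.det then 1 else (σ genM : ℂ)) := by
    have hpr := mul_ne_zero hp hr
    rcases lt_or_gt_of_ne hpr with h1 | h1 <;> rcases lt_or_gt_of_ne hg with h2 | h2
    · rw [if_pos (mul_pos_of_neg_of_neg h1 h2), if_neg h1.not_gt, if_neg h2.not_gt, char_genM_sq]
    · rw [if_neg (mul_neg_of_neg_of_pos h1 h2).not_gt, if_neg h1.not_gt, if_pos h2, mul_one]
    · rw [if_neg (mul_neg_of_pos_of_neg h1 h2).not_gt, if_pos h1, if_neg h2.not_gt, one_mul]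
    · rw [if_pos (mul_pos h1 h2), if_pos h1, if_pos h2, mul_one]
  unfold weightMat
  rw [h10, h11, hd, hlog, hratio, hsign, Complex.ofReal_add, mul_add, Complex.exp_add]
  ring

lemma weightMat_mul_rot (σ : M →* ℂˣ) (lam : ℂ) (k : ℤ) (θ : ℝ) (g : Mat) :
    weightMat σ lam k (g * rotMat θ)
      = Complex.exp (2 * Complex.I * k * θ) * weightMat σ lam k g := by
  have h10 : (g * rotMat θ) 1 0 = g 1 0 * Real.cos θ + g 1 1 * Real.sin θ := by
    simp [Matrix.mul_apply, rotMat]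
  have h11 : (g * rotMat θ) 1 1 = -(g 1 0 * Real.sin θ) + g 1 1 * Real.cos θ := by
    simp [Matrix.mul_apply, rotMat]
  have hcs := Real.cos_sq_add_sin_sq θ
  have hd : (g * rotMat θ).det = g.det := by
    rw [Matrix.det_mul]
    simp only [rotMat, Matrix.det_fin_two_of]
    linear_combination g.det * hcs
  have hS : (g 1 0 * Real.cos θ + g 1 1 * Real.sin θ) ^ 2
      + (-(g 1 0 * Real.sin θ) + g 1 1 * Real.cos θ) ^ 2 = g 1 0 ^ 2 + g 1 1 ^ 2 := by
    linear_combination (g 1 0 ^ 2 + g 1 1 ^ 2) * hcs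
  have hratio : ((((-(g 1 0 * Real.sin θ) + g 1 1 * Real.cos θ : ℝ) : ℂ) +
        (g 1 0 * Real.cos θ + g 1 1 * Real.sin θ : ℝ) * Complex.I) /
      ((-(g 1 0 * Real.sin θ) + g 1 1 * Real.cos θ : ℝ) -
        (g 1 0 * Real.cos θ + g 1 1 * Real.sin θ : ℝ) * Complex.I))
      = Complex.exp (2 * θ * Complex.I) *
        ((g 1 1 + g 1 0 * Complex.I) / (g 1 1 - g 1 0 * Complex.I)) := by
    have e1 := Complex.exp_mul_I θ
    have e2 := Complex.exp_mul_I (-θ)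
    rw [Complex.cos_neg, Complex.sin_neg] at e2
    have e3 : Complex.exp (2 * θ * Complex.I)
        = Complex.exp (θ * Complex.I) / Complex.exp (-θ * Complex.I) := by
      rw [← Complex.exp_sub]; congr 1; ring
    rw [e3, div_mul_div_comm]
    congr 1
    · rw [e1]; push_cast
      linear_combination (-(g 1 0 : ℂ) * Complex.sin θ) * Complex.I_sq
    · rw [e2]; push_cast
      linear_combination (-(g 1 0 : ℂ) * Complex.sin θ) * Complex.I_sq
  unfold weightMat
  rw [h10, h11, hd, hS, hratio, mul_zpow, ← Complex.exp_int_mul]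
  rw [show (k : ℂ) * (2 * θ * Complex.I) = 2 * Complex.I * k * θ by ring]
  ring

lemma a_zero : a 0 = 1 := by
  unfold a
  rw [cls_congr (h := 1) _ (by ext i j; fin_cases i <;> fin_cases j <;> simp), cls_one]

lemma n_zero : n 0 = 1 := by
  unfold n
  rw [cls_congr (h := 1) _ (by ext i j; fin_cases i <;> fin_cases j <;> simp), cls_one]

/-- The function on `G` given by `weightMat`. -/
def weightFun (σ : M →* ℂˣ) (lam : ℂ) (k : ℤ) (x : G) : ℂ :=
  weightMat σ lam k (exists_cls x).choose

lemma weightFun_cls (σ : M →* ℂˣ) (lam : ℂ) (k : ℤ) {g : Mat} (hg : g.det ≠ 0) :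
    weightFun σ lam k (cls g hg) = weightMat σ lam k g := by
  unfold weightFun
  obtain ⟨h1, h2⟩ := (exists_cls (cls g hg)).choose_spec
  set g' := (exists_cls (cls g hg)).choose
  obtain ⟨u, hu⟩ := Matrix.ProjGenLinGroup.mk_eq_mk_iff.mp h2
  have hg' : g' = !![(u : ℝ), 0; 0, (u : ℝ)] * g := by
    have := congrArg Units.val hu
    change g * Matrix.scalar (Fin 2) (u : ℝ) = g' at this
    rw [← this]
    ext i j; fin_cases i <;> fin_cases j <;>
      simp [Matrix.mul_apply, mul_comm]
  rw [hg', weightMat_upper _ _ _ u.ne_zero u.ne_zero hg, if_pos (mul_self_pos.mpr u.ne_zero)]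
  simp

lemma weightFun_upper_mul (σ : M →* ℂˣ) (lam : ℂ) (k : ℤ) {p q r : ℝ} (hp : p ≠ 0) (hr : r ≠ 0)
    (h : !![p, q; 0, r].det ≠ 0) (x : G) : weightFun σ lam k (cls !![p, q; 0, r] h * x)
      = (if 0 < p * r then 1 else (σ genM : ℂ)) *
        Complex.exp ((lam + 1 / 2) * (Real.log (p / r) : ℝ)) * weightFun σ lam k x := by
  obtain ⟨g, hg, rfl⟩ := exists_cls x
  have hd : (!![p, q; 0, r] * g).det ≠ 0 := by rw [Matrix.det_mul]; exact mul_ne_zero h hg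
  rw [← cls_mul h hg hd, weightFun_cls, weightFun_cls, weightMat_upper _ _ _ hp hr hg]

lemma weightFun_equivariant (σ : M →* ℂˣ) (lam : ℂ) (k : ℤ) :
    IsEquivariant σ lam (weightFun σ lam k) := by
  intro m t u x
  have hn : ∀ x, weightFun σ lam k (n u * x) = weightFun σ lam k x := fun x => by
    unfold n
    rw [weightFun_upper_mul _ _ _ one_ne_zero one_ne_zero]
    simp
  have ha : ∀ x, weightFun σ lam k (a t * x)
      = Complex.exp ((2 * lam + 1) * t) * weightFun σ lam k x := fun x => by
    unfold a
    rw [weightFun_upper_mul _ _ _ (Real.exp_ne_zero _) (Real.exp_ne_zero _), ← Real.exp_add,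
      ← Real.exp_sub, Real.log_exp]
    simp only [add_neg_cancel, Real.exp_zero, zero_lt_one, if_true, one_mul]
    congr 2
    push_cast
    ring
  have hm : ∀ x, weightFun σ lam k (m * x) = σ m * weightFun σ lam k x := fun x => by
    rcases eq_one_or_genM m with rfl | rfl
    · simp
    · change weightFun σ lam k (T * x) = _
      unfold T
      rw [weightFun_upper_mul _ _ _ (by norm_num) one_ne_zero]
      norm_num
  rw [mul_assoc, mul_assoc, hm, ha, hn]
  ring

lemma weightFun_smooth (σ : M →* ℂˣ) (lam : ℂ) (k : ℤ) : IsSmooth (weightFun σ lam k) := by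
  have h : ContDiffOn ℝ ∞ (fun g : Coord => weightMat σ lam k (Matrix.of g))
      {g : Coord | (Matrix.of g).det ≠ 0} := by
    intro g hg
    refine ContDiffAt.contDiffWithinAt ?_
    have hent : ∀ i j, ContDiffAt ℝ ∞ (fun g : Coord => g i j) g := fun i j =>
      (contDiff_apply_apply ℝ ℝ i j).contDiffAt
    have hentC : ∀ i j, ContDiffAt ℝ ∞ (fun g : Coord => ((g i j : ℝ) : ℂ)) g := fun i j =>
      Complex.ofRealCLM.contDiff.contDiffAt.comp g (hent i j)
    have hdet : ContDiffAt ℝ ∞ (fun g : Coord => (Matrix.of g).det) g := by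
      simp only [Matrix.det_fin_two, Matrix.of_apply]
      exact ((hent 0 0).mul (hent 1 1)).sub ((hent 0 1).mul (hent 1 0))
    have hS := row_ne (g := Matrix.of g) hg
    refine ContDiffAt.mul (ContDiffAt.mul ?_ ?_) ?_
    · rcases lt_or_gt_of_ne (show (Matrix.of g).det ≠ 0 from hg) with h0 | h0
      · refine (contDiffAt_const (c := (σ genM : ℂ))).congr_of_eventuallyEq ?_
        filter_upwards [hdet.continuousAt.eventually_lt continuousAt_const h0] with g' hg'
        rw [if_neg hg'.not_gt]
      · refine (contDiffAt_const (c := (1 : ℂ))).congr_of_eventuallyEq ?_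
        filter_upwards [continuousAt_const.eventually_lt hdet.continuousAt h0] with g' hg'
        rw [if_pos hg']
    · refine ContDiffAt.cexp (contDiffAt_const.mul ?_)
      refine Complex.ofRealCLM.contDiff.contDiffAt.comp g ?_
      refine ContDiffAt.log (hdet.div (((hent 1 0).pow 2).add ((hent 1 1).pow 2)) hS.ne') ?_
      exact div_ne_zero hg hS.ne'
    · have hnum : ContDiffAt ℝ ∞ (fun g : Coord =>
          ((g 1 1 + g 1 0 * Complex.I) / (g 1 1 - g 1 0 * Complex.I) : ℂ)) g := by
        simp only [div_eq_mul_inv]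
        exact ((hentC 1 1).add ((hentC 1 0).mul contDiffAt_const)).mul
          (((hentC 1 1).sub ((hentC 1 0).mul contDiffAt_const)).inv
            (row_sub_ne (g := Matrix.of g) hg))
      rcases k with j | j
      · simp only [Int.ofNat_eq_natCast, zpow_natCast]
        exact hnum.pow j
      · simp only [zpow_negSucc]
        exact (hnum.pow _).inv (pow_ne_zero _ (div_ne_zero (row_add_ne (g := Matrix.of g) hg)
          (row_sub_ne (g := Matrix.of g) hg)))
  refine h.congr fun g hg => ?_
  have h1 := pullback_of (f := weightFun σ lam k) (g := Matrix.of g) hg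
  rw [weightFun_cls] at h1
  exact h1

lemma weightFun_mul_rot (σ : M →* ℂˣ) (lam : ℂ) (k : ℤ) (θ : ℝ) (x : G) :
    weightFun σ lam k (x * rot θ)
      = Complex.exp (2 * Complex.I * k * θ) * weightFun σ lam k x := by
  obtain ⟨g, hg, rfl⟩ := exists_cls x
  have hd : (g * rotMat θ).det ≠ 0 := by
    rw [Matrix.det_mul]; exact mul_ne_zero hg (det_rotMat θ)
  rw [rot_coe, ← cls_mul hg (det_rotMat θ) hd, weightFun_cls, weightFun_cls, weightMat_mul_rot]

lemma weightFun_one (σ : M →* ℂˣ) (lam : ℂ) (k : ℤ) : weightFun σ lam k 1 = 1 := by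
  rw [← cls_one (by simp), weightFun_cls]
  simp [weightMat]

/-- The weight function as an element of `C^∞(G)`. -/
def weightSmooth (σ : M →* ℂˣ) (lam : ℂ) (k : ℤ) : smoothFun :=
  smoothFun.mk (weightFun σ lam k) (weightFun_smooth σ lam k)

lemma rightTranslate_rot_weight (σ : M →* ℂˣ) (lam : ℂ) (k : ℤ) (θ : ℝ) :
    rightTranslate (rot θ) (weightSmooth σ lam k)
      = Complex.exp (2 * Complex.I * k * θ) • weightSmooth σ lam k :=
  smoothFun.ext fun x => weightFun_mul_rot σ lam k θ x

lemma weightSmooth_kFinite (σ : M →* ℂˣ) (lam : ℂ) (k : ℤ) : IsKFinite (weightSmooth σ lam k) := by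
  unfold IsKFinite
  have : FiniteDimensional ℂ (Submodule.span ℂ
      ({weightSmooth σ lam k, rightTranslate T (weightSmooth σ lam k)} : Set smoothFun)) :=
    FiniteDimensional.span_of_finite ℂ (Set.toFinite _)
  refine Submodule.finiteDimensional_of_le (S₂ := Submodule.span ℂ
    {weightSmooth σ lam k, rightTranslate T (weightSmooth σ lam k)}) ?_
  rw [Submodule.span_le]
  rintro _ ⟨x, rfl⟩
  obtain ⟨m, θ, hx⟩ := exists_M_mul_rot x
  simp only
  rw [hx, map_mul, Module.End.mul_apply, rightTranslate_rot_weight, map_smul]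
  refine Submodule.smul_mem _ _ (Submodule.subset_span ?_)
  rcases eq_one_or_genM m with rfl | rfl
  · left; simp
  · right; rfl

/-- The vector of weight `2ik` in the principal series with value `1` at the identity. -/
def weightVec (σ : M →* ℂˣ) (lam : ℂ) (k : ℤ) : principalSpace σ lam :=
  ⟨weightSmooth σ lam k, weightFun_equivariant σ lam k, weightSmooth_kFinite σ lam k⟩

/-- Evaluation at the identity. -/
def evalOne (σ : M →* ℂˣ) (lam : ℂ) : principalSpace σ lam →ₗ[ℂ] ℂ :=
  LinearMap.proj (1 : G) ∘ₗ smoothFun.toFun ∘ₗ (principalSpace σ lam).subtype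

lemma evalOne_weightVec (σ : M →* ℂˣ) (lam : ℂ) (k : ℤ) : evalOne σ lam (weightVec σ lam k) = 1 :=
  weightFun_one σ lam k

lemma GKModule.lie_Jsl_of_act_rot {V : Type*} [AddCommGroup V] [Module ℂ V] (π : GKModule V)
    {μ : ℂ} {v : V} (h : ∀ t : ℝ, π.act (rot t) v = Complex.exp (μ * t) • v) :
    π.lie Jsl v = μ • v := by
  rw [← sub_eq_zero, ← Module.forall_dual_apply_eq_zero_iff ℂ]
  intro ℓ
  have h1 := π.hasDerivAt v ℓ
  simp only [h, map_smul] at h1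
  have h2 : HasDerivAt (fun s : ℝ => Complex.exp (μ * s)) μ 0 := by
    have := ((hasDerivAt_id (0 : ℂ)).const_mul μ).cexp.comp_ofReal (z := 0)
    simpa using this
  rw [map_sub, map_smul, h1.unique (h2.smul_const (ℓ v)), sub_self]

lemma lie_Jsl_weightVec (σ : M →* ℂˣ) (lam : ℂ) (k : ℤ) :
    (principalSeries σ lam).lie Jsl (weightVec σ lam k)
      = (2 * Complex.I * k) • weightVec σ lam k :=
  GKModule.lie_Jsl_of_act_rot _ fun t => Subtype.ext (rightTranslate_rot_weight σ lam k t)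

lemma eq_smul_weightVec {σ : M →* ℂˣ} {lam : ℂ} {k : ℤ} {f : principalSpace σ lam}
    (hf : (principalSeries σ lam).lie Jsl f = (2 * Complex.I * k) • f) :
    f = evalOne σ lam f • weightVec σ lam k := by
  have key : ∀ h : principalSpace σ lam,
      (principalSeries σ lam).lie Jsl h = (2 * Complex.I * k) • h →
      ∀ (m : M) (t u θ : ℝ), h.1 (m * a t * n u * rot θ) = (σ m : ℂ) *
        Complex.exp ((2 * lam + 1) * t) * (Complex.exp (2 * Complex.I * k * θ) *
          evalOne σ lam h) := by
    intro h hh m t u θ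
    rw [h.2.1 m t u]
    have := congrArg (evalOne σ lam) ((principalSeries σ lam).act_rot_of_eigen hh θ)
    rw [map_smul, smul_eq_mul] at this
    rw [← this]
    change _ = _ * h.1 (1 * _)
    rw [one_mul]
  refine Subtype.ext (smoothFun.ext fun x => ?_)
  obtain ⟨m, t, u, θ, rfl⟩ := exists_iwasawa x
  rw [key f hf]
  change _ = evalOne σ lam f * (weightVec σ lam k).1 _
  rw [key _ (lie_Jsl_weightVec σ lam k), evalOne_weightVec]
  ring

lemma weightVec_ne_zero (σ : M →* ℂˣ) (lam : ℂ) (k : ℤ) : weightVec σ lam k ≠ 0 := by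
  intro h
  have := evalOne_weightVec σ lam k
  rw [h, map_zero] at this
  exact zero_ne_one this

lemma weight_injective : Function.Injective fun k : ℤ => 2 * Complex.I * (k : ℂ) := by
  intro k l h
  have := mul_left_cancel₀ (mul_ne_zero two_ne_zero Complex.I_ne_zero) h
  exact_mod_cast this

/-- The basis of weight vectors of the principal series. -/
def weightBasis (σ : M →* ℂˣ) (lam : ℂ) : Module.Basis ℤ ℂ (principalSpace σ lam) :=
  Module.Basis.mk (v := weightVec σ lam)
    (Module.End.eigenvectors_linearIndependent' ((principalSeries σ lam).lie Jsl)
      (fun k : ℤ => 2 * Complex.I * (k : ℂ)) weight_injective _ fun k =>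
      Module.End.hasEigenvector_iff.mpr
        ⟨Module.End.mem_eigenspace_iff.mpr (lie_Jsl_weightVec σ lam k), weightVec_ne_zero σ lam k⟩)
    (by
      rw [← (principalSeries σ lam).iSup_eigenspace_Jsl, iSup_le_iff]
      intro k f hf
      rw [eq_smul_weightVec (Module.End.mem_eigenspace_iff.mp hf)]
      exact Submodule.smul_mem _ _ (Submodule.subset_span ⟨k, rfl⟩))

lemma weightBasis_apply (σ : M →* ℂˣ) (lam : ℂ) (k : ℤ) :
    weightBasis σ lam k = weightVec σ lam k := by
  simp [weightBasis]

/-! ### The action of `𝔤` on weight vectors -/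

lemma lie_Jsl_H : ⁅Jsl, H⁆ = (4 : ℂ) • E + (2 : ℂ) • Jsl := by
  ext i j
  rw [LieAlgebra.SpecialLinear.sl_bracket]
  fin_cases i <;> fin_cases j <;> simp [H, E, Jsl] <;> norm_num

lemma lie_Jsl_E : ⁅Jsl, E⁆ = -H := by
  ext i j
  rw [LieAlgebra.SpecialLinear.sl_bracket]
  fin_cases i <;> fin_cases j <;> simp [H, E, Jsl]

/-- The element `H - ε i (E + F)` of `𝔤`, for `ε = ±1`, which shifts weights by `2iε`. -/
def shift (ε : ℂ) : sl2 := H - (ε * Complex.I) • ((2 : ℂ) • E + Jsl)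

lemma GKModule.lie_Jsl_shift {V : Type*} [AddCommGroup V] [Module ℂ V] (π : GKModule V)
    {μ ε : ℂ} (hε : ε * ε = 1) {v : V} (h : π.lie Jsl v = μ • v) :
    π.lie Jsl (π.lie (shift ε) v) = (2 * Complex.I * ε + μ) • π.lie (shift ε) v := by
  have hb : ⁅Jsl, shift ε⁆ = (2 * Complex.I * ε) • shift ε := by
    have hI := Complex.I_mul_I
    have e : 2 * Complex.I * ε * (ε * Complex.I) = -2 := by
      linear_combination (2 * Complex.I ^ 2) * hε + 2 * hI
    unfold shift
    rw [lie_sub, lie_smul, lie_add, lie_smul, lie_Jsl_H, lie_Jsl_E, lie_self, smul_sub, smul_smul, e]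
    module
  rw [π.lie_mul, hb, h, map_smul, map_smul, add_smul]
  rfl

lemma exp_smul_E (t : ℝ) : NormedSpace.exp (t • (!![0, 1; 0, 0] : Mat)) = !![1, t; 0, 1] := by
  have h : (t • (!![0, 1; 0, 0] : Mat)) ^ 2 = 0 := by
    rw [pow_two]; ext i j; fin_cases i <;> fin_cases j <;> simp
  rw [NormedSpace.exp_eq_tsum ℝ]
  beta_reduce
  rw [tsum_eq_sum (s := Finset.range 2)]
  · ext i j; fin_cases i <;> fin_cases j <;> simp [Finset.sum_range_succ]
  · intro j hj
    rw [Finset.mem_range, not_lt] at hj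
    rw [← Nat.sub_add_cancel hj, pow_add, h, mul_zero, smul_zero]

lemma exp_smul_H (t : ℝ) : NormedSpace.exp (t • (!![1, 0; 0, -1] : Mat))
    = !![Real.exp t, 0; 0, Real.exp (-t)] := by
  have h : t • (!![1, 0; 0, -1] : Mat) = Matrix.diagonal ![t, -t] := by
    ext i j; fin_cases i <;> fin_cases j <;> simp
  rw [h, Matrix.exp_diagonal]
  ext i j; fin_cases i <;> fin_cases j <;> simp [Pi.coe_exp, Real.exp_eq_exp_ℝ]

lemma evalOne_lie {σ : M →* ℂˣ} {lam : ℂ} (X : sl2) (Y : Mat) (hX : X.1 = Y.map Complex.ofReal)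
    (f : principalSpace σ lam) : evalOne σ lam ((principalSeries σ lam).lie X f)
      = deriv (fun t : ℝ => f.1 (expG (t • Y))) 0 := by
  have h1 : reM X.1 = Y := by rw [hX]; ext; simp [reM]
  have h2 : imM X.1 = (0 : ℝ) • Y := by rw [hX]; ext; simp [imM]
  have h3 : lieSmooth X f.1 = deriveSmooth Y f.1 := by
    change deriveSmooth _ f.1 + Complex.I • deriveSmooth _ f.1 = _
    rw [h1, h2, deriveSmooth_smul]
    simp
  change smoothFun.toFun (lieSmooth X f.1) 1 = _
  rw [h3]
  change deriv (fun t : ℝ => f.1 (1 * expG (t • Y))) 0 = _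
  simp only [one_mul]

lemma evalOne_lie_H {σ : M →* ℂˣ} {lam : ℂ} (f : principalSpace σ lam) :
    evalOne σ lam ((principalSeries σ lam).lie H f) = (2 * lam + 1) * evalOne σ lam f := by
  rw [evalOne_lie H !![1, 0; 0, -1] (by ext i j; fin_cases i <;> fin_cases j <;> simp [H])]
  have h : (fun t : ℝ => f.1 (expG (t • (!![1, 0; 0, -1] : Mat))))
      = fun t : ℝ => Complex.exp ((2 * lam + 1) * t) * evalOne σ lam f := funext fun t => by
    have h1 := f.2.1 1 t 0 1
    have ha : expG (t • (!![1, 0; 0, -1] : Mat)) = a t := cls_congr _ (exp_smul_H t)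
    rw [ha, show evalOne σ lam f = f.1 1 from rfl]
    simpa [n_zero] using h1
  rw [h]
  have hd : HasDerivAt (fun t : ℝ => Complex.exp ((2 * lam + 1) * t)) (2 * lam + 1) 0 := by
    have := ((hasDerivAt_id (0 : ℂ)).const_mul (2 * lam + 1)).cexp.comp_ofReal (z := 0)
    simpa using this
  exact (hd.mul_const _).deriv

lemma evalOne_lie_E {σ : M →* ℂˣ} {lam : ℂ} (f : principalSpace σ lam) :
    evalOne σ lam ((principalSeries σ lam).lie E f) = 0 := by
  rw [evalOne_lie E !![0, 1; 0, 0] (by ext i j; fin_cases i <;> fin_cases j <;> simp [E])]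
  have h : (fun t : ℝ => f.1 (expG (t • (!![0, 1; 0, 0] : Mat))))
      = fun t : ℝ => evalOne σ lam f := funext fun t => by
    have h1 := f.2.1 1 0 t 1
    have hn : expG (t • (!![0, 1; 0, 0] : Mat)) = n t := cls_congr _ (exp_smul_E t)
    rw [hn, show evalOne σ lam f = f.1 1 from rfl]
    simpa [a_zero] using h1
  rw [h]
  exact deriv_const _ _

lemma lie_shift_weightVec {σ : M →* ℂˣ} {lam : ℂ} {ε : ℤ} (hε : ε * ε = 1) (k : ℤ) :
    (principalSeries σ lam).lie (shift ε) (weightVec σ lam k)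
      = (2 * lam + 1 + 2 * ε * k) • weightVec σ lam (k + ε) := by
  have hε' : (ε : ℂ) * ε = 1 := by exact_mod_cast hε
  have h := (principalSeries σ lam).lie_Jsl_shift hε' (lie_Jsl_weightVec σ lam k)
  rw [show 2 * Complex.I * (ε : ℂ) + 2 * Complex.I * k = 2 * Complex.I * ((k + ε : ℤ) : ℂ) by
    push_cast; ring] at h
  rw [eq_smul_weightVec h]
  congr 1
  unfold shift
  simp only [map_sub, map_smul, map_add, LinearMap.sub_apply, LinearMap.smul_apply,
    LinearMap.add_apply, evalOne_lie_H, evalOne_lie_E, lie_Jsl_weightVec, evalOne_weightVec,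
    smul_eq_mul]
  linear_combination (-2 * (ε : ℂ) * k) * Complex.I_mul_I

/-- The action of a principal series representation on a basis of weight vectors, with
`c = σ(T)` and `s = 2λ + 1`. -/
structure IsWeightBasis {V : Type*} [AddCommGroup V] [Module ℂ V] (π : GKModule V) (c s : ℂ)
    (v : Module.Basis ℤ ℂ V) : Prop where
  lie_H : ∀ k, π.lie H (v k)
    = (1 / 2 : ℂ) • ((s + 2 * k) • v (k + 1) + (s - 2 * k) • v (k - 1))
  lie_E : ∀ k, π.lie E (v k) = (Complex.I / 4) •
    ((s + 2 * k) • v (k + 1) - (4 * k : ℂ) • v k - (s - 2 * k) • v (k - 1))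
  act_T : ∀ k, π.actM genM (v k) = c • v (-k)

lemma isWeightBasis_weightBasis (σ : M →* ℂˣ) (lam : ℂ) :
    IsWeightBasis (principalSeries σ lam) (σ genM) (2 * lam + 1) (weightBasis σ lam) := by
  have hR := fun k => lie_shift_weightVec (σ := σ) (lam := lam) (ε := 1) (by norm_num) k
  have hL := fun k => lie_shift_weightVec (σ := σ) (lam := lam) (ε := -1) (by norm_num) k
  have hJ := lie_Jsl_weightVec σ lam
  simp only [Int.cast_one, Int.cast_neg, mul_one, mul_neg, neg_mul, ← sub_eq_add_neg] at hR hL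
  have hH : H = (1 / 2 : ℂ) • (shift 1 + shift (-1)) := by
    unfold shift; module
  have hE : E = (Complex.I / 4) • (shift 1 - shift (-1)) - (1 / 2 : ℂ) • Jsl := by
    have e : Complex.I / 4 * (2 * Complex.I) = -1 / 2 := by
      linear_combination (1 / 2 : ℂ) * Complex.I_mul_I
    have : shift 1 - shift (-1) = -(2 * Complex.I) • ((2 : ℂ) • E + Jsl) := by
      unfold shift; module
    rw [this, smul_smul, mul_neg, e]
    module
  refine ⟨fun k => ?_, fun k => ?_, fun k => ?_⟩
  · simp only [weightBasis_apply]
    rw [hH, map_smul, map_add, LinearMap.smul_apply, LinearMap.add_apply, hR, hL]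
  · simp only [weightBasis_apply]
    rw [hE, map_sub, map_smul, map_smul, map_sub, LinearMap.sub_apply, LinearMap.smul_apply,
      LinearMap.sub_apply, LinearMap.smul_apply, hR, hL, hJ]
    module
  · simp only [weightBasis_apply]
    have h1 : Ad T Jsl = -Jsl := by
      refine AdGL_eq ?_
      change (!![-1, 0; 0, 1] : Mat).map Complex.ofReal * _
        = _ * (!![-1, 0; 0, 1] : Mat).map Complex.ofReal
      ext i j; fin_cases i <;> fin_cases j <;> simp [Jsl, Matrix.mul_apply]
    have h2 := (principalSeries σ lam).actM_lie genM Jsl (weightVec σ lam k)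
    change _ = (principalSeries σ lam).lie (Ad T Jsl) _ at h2
    rw [h1, hJ, map_smul, map_neg, LinearMap.neg_apply] at h2
    rw [eq_smul_weightVec (k := -k) (f := (principalSeries σ lam).actM genM (weightVec σ lam k))]
    · congr 1
      change weightFun σ lam k (1 * T) = _
      have := weightFun_equivariant σ lam k genM 0 0 1
      rw [a_zero, n_zero, weightFun_one] at this
      simpa [genM] using this
    · rw [← neg_eq_iff_eq_neg.mpr h2.symm.symm]
      push_cast
      module

/-! ### Cohomology in terms of the operator `E` -/

/-- `E` as an element of `𝔫`. -/
def nilE : nil := ⟨E, mem_nil.mpr ⟨1, one_smul _ _⟩⟩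

lemma adH_nilE : adH nilE = (2 : ℂ) • nilE := Subtype.ext lie_H_E

lemma AdN_nilE : AdN genM⁻¹ nilE = (-1 : ℂ) • nilE := by
  rw [genM_inv]
  exact Subtype.ext Ad_T_E

lemma nil_hom_ext {V : Type*} [AddCommGroup V] [Module ℂ V] {φ ψ : nil →ₗ[ℂ] V}
    (h : φ nilE = ψ nilE) : φ = ψ := by
  ext ⟨X, hX⟩
  obtain ⟨c, rfl⟩ := mem_nil.mp hX
  change φ (c • nilE) = ψ (c • nilE)
  rw [map_smul, map_smul, h]

lemma exists_nil_hom {V : Type*} [AddCommGroup V] [Module ℂ V] (v : V) :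
    ∃ φ : nil →ₗ[ℂ] V, φ nilE = v := by
  refine ⟨{ toFun := fun X => (X.1.1 0 1) • v, map_add' := fun X Y => ?_,
            map_smul' := fun c X => ?_ }, ?_⟩
  · simp [add_smul]
  · simp [mul_smul]
  · simp [nilE, E]

namespace GKModule

variable {V W U : Type*} [AddCommGroup V] [Module ℂ V] [AddCommGroup W] [Module ℂ W]
  [AddCommGroup U] [Module ℂ U]

lemma mem_H0_iff (π : GKModule V) {v : V} : v ∈ π.H0 ↔ π.lie E v = 0 := by
  rw [mem_H0]
  refine ⟨fun h => h E nilE.2, fun h X hX => ?_⟩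
  obtain ⟨c, rfl⟩ := mem_nil.mp hX
  rw [map_smul, LinearMap.smul_apply, h, smul_zero]

lemma H0_eq_bot_iff (π : GKModule V) : π.H0 = ⊥ ↔ ∀ v, π.lie E v = 0 → v = 0 := by
  rw [Submodule.eq_bot_iff]
  simp only [mem_H0_iff]

lemma IsIso.H0_eq_bot_iff {π : GKModule V} {τ : GKModule W} (h : π.IsIso τ) :
    π.H0 = ⊥ ↔ τ.H0 = ⊥ := by
  obtain ⟨e, he, -⟩ := h
  rw [GKModule.H0_eq_bot_iff, GKModule.H0_eq_bot_iff]
  constructor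
  · intro hπ w hw
    have := hπ (e.symm w) (e.injective (by rw [he, e.apply_symm_apply, hw, map_zero]))
    exact e.symm.map_eq_zero_iff.mp this
  · intro hτ v hv
    exact e.map_eq_zero_iff.mp (hτ (e v) (by rw [← he, hv, map_zero]))

/-- `V / E V` is isomorphic to `U`, with `H` acting by `h` and `T` by `r`. -/
def HasCoinvariants (π : GKModule V) (h r : U → U) : Prop :=
  ∃ (L : V →ₗ[ℂ] U) (j : U →ₗ[ℂ] V), (∀ u, L (j u) = u) ∧ (∀ v, L (π.lie E v) = 0) ∧
    LinearMap.range (π.lie E) ⊔ LinearMap.range j = ⊤ ∧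
    (∀ u, L (π.lie H (j u)) = h u) ∧ ∀ u, L (π.actM genM (j u)) = r u

lemma IsIso.hasCoinvariants {π : GKModule V} {τ : GKModule W} (hπ : π.IsIso τ) {h r : U → U}
    (hτ : τ.HasCoinvariants h r) : π.HasCoinvariants h r := by
  obtain ⟨e, he, hk⟩ := hπ
  obtain ⟨L, j, h1, h2, h3, h4, h5⟩ := hτ
  refine ⟨L ∘ₗ e.toLinearMap, e.symm.toLinearMap ∘ₗ j, fun u => ?_, fun v => ?_, ?_,
    fun u => ?_, fun u => ?_⟩
  · simp [h1]
  · simp [he, h2]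
  · rw [eq_top_iff]
    intro v _
    have hv : e v ∈ LinearMap.range (τ.lie E) ⊔ LinearMap.range j := by rw [h3]; trivial
    obtain ⟨_, ⟨w, rfl⟩, _, ⟨u, rfl⟩, hv⟩ := Submodule.mem_sup.mp hv
    refine Submodule.mem_sup.mpr ⟨_, ⟨e.symm w, rfl⟩, _, ⟨u, rfl⟩, e.injective ?_⟩
    rw [map_add, he]
    simpa using hv
  · simp [he, h4]
  · have := h5 u
    simpa [actM, hk] using this

lemma HasCoinvariants.congr {U' : Type*} [AddCommGroup U'] [Module ℂ U'] {π : GKModule V}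
    {h r : U → U} (hπ : π.HasCoinvariants h r) (A : U ≃ₗ[ℂ] U') {h' r' : U' → U'}
    (hh : ∀ u, A (h u) = h' (A u)) (hr : ∀ u, A (r u) = r' (A u)) : π.HasCoinvariants h' r' := by
  obtain ⟨L, j, h1, h2, h3, h4, h5⟩ := hπ
  refine ⟨A.toLinearMap ∘ₗ L, j ∘ₗ A.symm.toLinearMap, fun u => ?_, fun v => ?_, ?_,
    fun u => ?_, fun u => ?_⟩
  · simp [h1]
  · simp [h2]
  · rw [← h3, LinearMap.range_comp_of_range_eq_top _ (LinearEquiv.range A.symm)]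
  · simp [h4, hh]
  · simp [h5, hr]

lemma HasCoinvariants.exists_equiv {π : GKModule V} {h r : U → U}
    (hπ : π.HasCoinvariants h r) : ∃ e : π.H1 ≃ₗ[ℂ] U,
      (∀ x, e (π.cohomology1.a x) = h (e x) - (2 : ℂ) • e x) ∧
      ∀ x, e (π.cohomology1.m genM x) = -r (e x) := by
  obtain ⟨L, j, h1, h2, h3, h4, h5⟩ := hπ
  have hdec : ∀ v, ∃ w u, v = π.lie E w + j u := fun v => by
    have hv : v ∈ LinearMap.range (π.lie E) ⊔ LinearMap.range j := by rw [h3]; trivial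
    obtain ⟨_, ⟨w, rfl⟩, _, ⟨u, rfl⟩, hv⟩ := Submodule.mem_sup.mp hv
    exact ⟨w, u, hv.symm⟩
  let Φ : (nil →ₗ[ℂ] V) →ₗ[ℂ] U := L ∘ₗ LinearMap.applyₗ nilE
  have hΦ : ∀ φ, Φ φ = L (φ nilE) := fun φ => rfl
  have hker : LinearMap.range π.d = LinearMap.ker Φ := by
    ext φ
    rw [LinearMap.mem_ker, hΦ]
    constructor
    · rintro ⟨v, rfl⟩
      exact h2 v
    · intro hφ
      obtain ⟨w, u, hw⟩ := hdec (φ nilE)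
      rw [hw, map_add, h2, h1, zero_add] at hφ
      rw [hφ, map_zero, add_zero] at hw
      exact ⟨w, nil_hom_ext hw.symm⟩
  have hsurj : Function.Surjective Φ := fun u => by
    obtain ⟨φ, hφ⟩ := exists_nil_hom (j u)
    exact ⟨φ, by rw [hΦ, hφ, h1]⟩
  let e : π.H1 ≃ₗ[ℂ] U := (Submodule.quotEquivOfEq _ _ hker).trans
    (Φ.quotKerEquivOfSurjective hsurj)
  have he : ∀ φ : nil →ₗ[ℂ] V, e (Submodule.Quotient.mk φ) = L (φ nilE) := fun φ => rfl
  refine ⟨e, fun x => ?_, fun x => ?_⟩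
  · obtain ⟨φ, rfl⟩ := Submodule.Quotient.mk_surjective _ x
    change e (Submodule.Quotient.mk (π.cochainA φ)) = _
    rw [he, he]
    change L (π.lie H (φ nilE) - φ (adH nilE)) = _
    obtain ⟨w, u, hw⟩ := hdec (φ nilE)
    rw [adH_nilE, map_smul, map_sub, map_smul, hw]
    congr 1
    rw [map_add, map_add, π.lie_mul, lie_H_E, map_smul, LinearMap.smul_apply, map_add, map_smul,
      map_add, h2, h2, h4, h1]
    simp
  · obtain ⟨φ, rfl⟩ := Submodule.Quotient.mk_surjective _ x
    change e (Submodule.Quotient.mk (π.cochainM genM φ)) = _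
    rw [he, he]
    change L (π.actM genM (φ (AdN genM⁻¹ nilE))) = _
    obtain ⟨w, u, hw⟩ := hdec (φ nilE)
    have hT : Ad (genM : G) E = (-1 : ℂ) • E := Ad_T_E
    rw [AdN_nilE, map_smul, map_smul, map_smul, hw, map_add, map_add, actM_lie, hT, map_smul,
      LinearMap.smul_apply, map_smul, h2, h5, map_add, h2, h1]
    simp

lemma HasCoinvariants.isIsoTo_charRep {π : GKModule V} {x y : ℂ}
    (hπ : π.HasCoinvariants (fun u : ℂ => x * u) (fun u : ℂ => y * u)) {σ : M →* ℂˣ} {lam : ℂ}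
    (hx : x - 2 = 2 * lam) (hy : -y = σ genM) : π.cohomology1.IsIsoTo (charRep σ lam) := by
  obtain ⟨e, ha, hm⟩ := hπ.exists_equiv
  refine AModule.isIsoTo_charRep _ e (fun v => ?_) (fun v => ?_)
  · rw [ha, ← hx, smul_eq_mul]; ring
  · rw [hm, ← hy]; ring

lemma HasCoinvariants.isIsoTo_prod {π : GKModule V} {x x' y y' : ℂ}
    (hπ : π.HasCoinvariants (fun u : ℂ × ℂ => (x * u.1, x' * u.2))
      (fun u : ℂ × ℂ => (y * u.1, y' * u.2))) {σ σ' : M →* ℂˣ} {lam lam' : ℂ}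
    (hx : x - 2 = 2 * lam) (hx' : x' - 2 = 2 * lam') (hy : -y = σ genM) (hy' : -y' = σ' genM) :
    π.cohomology1.IsIsoTo ((charRep σ lam).prod (charRep σ' lam')) := by
  obtain ⟨e, ha, hm⟩ := hπ.exists_equiv
  refine AModule.isIsoTo_prod _ e (fun v => ?_) (fun v => ?_)
  · rw [ha, ← hx, ← hx']
    ext <;> simp <;> ring
  · rw [hm, ← hy, ← hy']
    ext <;> simp

lemma HasCoinvariants.isIsoTo_jordanRep {π : GKModule V} {x y : ℂ}
    (hπ : π.HasCoinvariants (fun u : ℂ × ℂ => (x * u.1 + u.2, x * u.2))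
      (fun u : ℂ × ℂ => (y * u.1, y * u.2))) {σ : M →* ℂˣ} {lam : ℂ}
    (hx : x - 2 = 2 * lam) (hy : -y = σ genM) :
    π.cohomology1.IsIsoTo (jordanRep σ lam) := by
  obtain ⟨e, ha, hm⟩ := hπ.exists_equiv
  refine AModule.isIsoTo_jordanRep _ e (fun v => ?_) (fun v => ?_)
  · rw [ha, ← hx]
    ext <;> simp <;> ring
  · rw [hm, ← hy]
    ext <;> simp

lemma lefschetz_of_H0_eq_bot {π : GKModule V} (h : π.H0 = ⊥) (τ : M →* ℂˣ) (mu : ℂ) :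
    π.lefschetz τ mu = Module.finrank ℂ (π.cohomology1.genEigenspace τ mu) := by
  have : Subsingleton π.H0 := by rw [h]; infer_instance
  unfold lefschetz
  rw [Module.finrank_zero_of_subsingleton]
  simp

end GKModule

/-! ### The cohomology of principal series -/

namespace IsWeightBasis

variable {V : Type*} [AddCommGroup V] [Module ℂ V] {π : GKModule V} {c s : ℂ}
  {v : Module.Basis ℤ ℂ V}

/-- The sequence of values of an `E`-invariant functional on weight vectors. -/
def coinvSeq (s p q : ℂ) : ℕ → ℂ
  | 0 => p
  | 1 => q
  | k + 2 => (4 * (k + 1) * coinvSeq s p q (k + 1) + (s - 2 * (k + 1)) * coinvSeq s p q k) /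
      (s + 2 * (k + 1))

/-- The `E`-invariant functional with prescribed values on the weight vectors `v 0` and `v 1`. -/
def coinvFun (v : Module.Basis ℤ ℂ V) (s p q : ℂ) : V →ₗ[ℂ] ℂ :=
  v.constr ℂ fun k => coinvSeq s p q k.natAbs

lemma coinvFun_basis (p q : ℂ) (k : ℤ) : coinvFun v s p q (v k) = coinvSeq s p q k.natAbs :=
  v.constr_basis ℂ _ k

lemma coinvSeq_rec (hs : ∀ k : ℤ, s + 2 * k ≠ 0) (p q : ℂ) (j : ℕ) :
    (s + 2 * (j + 1)) * coinvSeq s p q (j + 2)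
      = 4 * (j + 1) * coinvSeq s p q (j + 1) + (s - 2 * (j + 1)) * coinvSeq s p q j := by
  have := hs (j + 1)
  push_cast at this
  rw [coinvSeq]
  field_simp

lemma coinvFun_lie_E (hv : IsWeightBasis π c s v) (hs : ∀ k : ℤ, s + 2 * k ≠ 0) (p q : ℂ) (w : V) :
    coinvFun v s p q (π.lie E w) = 0 := by
  suffices h : coinvFun v s p q ∘ₗ π.lie E = 0 from LinearMap.congr_fun h w
  refine v.ext fun k => ?_
  rw [LinearMap.comp_apply, hv.lie_E]
  simp only [map_smul, map_sub, coinvFun_basis, smul_eq_mul, LinearMap.zero_apply]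
  refine mul_eq_zero_of_right _ ?_
  obtain ⟨j, rfl | rfl⟩ := k.eq_nat_or_neg
  · rcases j with _ | j
    · simp
    · have h1 : ((j + 1 : ℕ) + 1 : ℤ).natAbs = j + 2 := by omega
      have h2 : ((j + 1 : ℕ) : ℤ).natAbs = j + 1 := by omega
      have h3 : ((j + 1 : ℕ) - 1 : ℤ).natAbs = j := by omega
      rw [h1, h2, h3]
      push_cast
      linear_combination coinvSeq_rec hs p q j
  · rcases j with _ | j
    · simp
    · have h1 : (-(j + 1 : ℕ) + 1 : ℤ).natAbs = j := by omega
      have h2 : (-(j + 1 : ℕ) : ℤ).natAbs = j + 1 := by omega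
      have h3 : (-(j + 1 : ℕ) - 1 : ℤ).natAbs = j + 2 := by omega
      rw [h1, h2, h3]
      push_cast
      linear_combination -coinvSeq_rec hs p q j

lemma smul_succ_mem (hv : IsWeightBasis π c s v) {R : Submodule ℂ V} {k : ℤ}
    (hR : π.lie E (v k) ∈ R) (h0 : v k ∈ R) :
    (s + 2 * k) • v (k + 1) - (s - 2 * k) • v (k - 1) ∈ R := by
  have h : (s + 2 * k) • v (k + 1) - (s - 2 * k) • v (k - 1)
      = (-4 * Complex.I) • π.lie E (v k) + (4 * k : ℂ) • v k := by
    rw [hv.lie_E, smul_smul, show -4 * Complex.I * (Complex.I / 4) = 1 by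
      linear_combination (-1 : ℂ) * Complex.I_mul_I]
    module
  rw [h]
  exact R.add_mem (R.smul_mem _ hR) (R.smul_mem _ h0)

lemma succ_mem (hv : IsWeightBasis π c s v) {R : Submodule ℂ V} {k : ℤ}
    (hR : π.lie E (v k) ∈ R) (h0 : v k ∈ R) (h1 : (s - 2 * k) • v (k - 1) ∈ R)
    (hk : s + 2 * k ≠ 0) : v (k + 1) ∈ R := by
  have := R.add_mem (hv.smul_succ_mem hR h0) h1
  rw [sub_add_cancel] at this
  exact (R.smul_mem_iff hk).mp this

lemma pred_mem (hv : IsWeightBasis π c s v) {R : Submodule ℂ V} {k : ℤ}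
    (hR : π.lie E (v k) ∈ R) (h0 : v k ∈ R) (h1 : (s + 2 * k) • v (k + 1) ∈ R)
    (hk : s - 2 * k ≠ 0) : v (k - 1) ∈ R := by
  have := R.sub_mem h1 (hv.smul_succ_mem hR h0)
  rw [sub_sub_cancel] at this
  exact (R.smul_mem_iff hk).mp this

lemma hasCoinvariants (hv : IsWeightBasis π c s v) (hs : ∀ k : ℤ, s + 2 * k ≠ 0) :
    π.HasCoinvariants (fun u : ℂ × ℂ => ((s - 2) * u.2, s * u.1 + 2 * u.2))
      (fun u : ℂ × ℂ => (c * u.1, c * u.2)) := by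
  set j : ℂ × ℂ →ₗ[ℂ] V := (LinearMap.toSpanSingleton ℂ V (v 0)).coprod
    (LinearMap.toSpanSingleton ℂ V (v 1)) with hj
  have hju : ∀ u, j u = u.1 • v 0 + u.2 • v 1 := fun u => rfl
  have h2 : (s + 2) ≠ 0 := by simpa using hs 1
  refine ⟨(coinvFun v s 1 0).prod (coinvFun v s 0 1), j, fun u => ?_, fun w => ?_, ?_,
    fun u => ?_, fun u => ?_⟩
  · rw [hju]
    ext <;> simp [coinvFun_basis, coinvSeq]
  · ext <;> simp [coinvFun_lie_E hv hs]
  · set R := LinearMap.range (π.lie E) ⊔ LinearMap.range j with hR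
    have hE : LinearMap.range (π.lie E) ≤ R := le_sup_left
    have h0 : v 0 ∈ R := Submodule.mem_sup_right ⟨(1, 0), by simp [hju]⟩
    have h1 : v 1 ∈ R := Submodule.mem_sup_right ⟨(0, 1), by simp [hju]⟩
    have key : ∀ k : ℤ, v k ∈ R ∧ v (k + 1) ∈ R := by
      intro k
      induction k with
      | zero => exact ⟨h0, by simpa using h1⟩
      | succ k ih =>
        refine ⟨ih.2, hv.succ_mem (hE ⟨_, rfl⟩) ih.2 (R.smul_mem _ ?_) (hs _)⟩
        rw [add_sub_cancel_right]
        exact ih.1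
      | pred k ih =>
        refine ⟨hv.pred_mem (hE ⟨_, rfl⟩) ih.1 (R.smul_mem _ ih.2) ?_,
          by rw [sub_add_cancel]; exact ih.1⟩
        have := hs k
        push_cast
        rw [mul_neg, sub_neg_eq_add]
        exact_mod_cast this
    rw [eq_top_iff, ← v.span_eq, Submodule.span_le]
    rintro _ ⟨k, rfl⟩
    exact (key k).1
  · rw [hju, map_add, map_smul, map_smul, hv.lie_H, hv.lie_H]
    ext
    · simp [coinvFun_basis, coinvSeq]
      field_simp
      ring
    · simp [coinvFun_basis, coinvSeq]
      field_simp
      ring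
  · rw [hju, map_add, map_smul, map_smul, hv.act_T, hv.act_T]
    ext
    · simp [coinvFun_basis, coinvSeq]; ring
    · simp [coinvFun_basis, coinvSeq]; ring

lemma repr_lie_E (hv : IsWeightBasis π c s v) (w : V) (j : ℤ) :
    v.repr (π.lie E w) j = (Complex.I / 4) * ((s + 2 * (j - 1)) * v.repr w (j - 1)
      - 4 * j * v.repr w j - (s - 2 * (j + 1)) * v.repr w (j + 1)) := by
  suffices h : v.coord j ∘ₗ π.lie E = (Complex.I / 4) • ((s + 2 * (j - 1)) • v.coord (j - 1)
      - (4 * j : ℂ) • v.coord j - (s - 2 * (j + 1)) • v.coord (j + 1)) from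
    LinearMap.congr_fun h w
  refine v.ext fun k => ?_
  rw [LinearMap.comp_apply, hv.lie_E]
  simp only [map_smul, map_sub, smul_eq_mul, LinearMap.smul_apply, LinearMap.sub_apply,
    Module.Basis.coord_apply, Module.Basis.repr_self, Finsupp.single_apply]
  congr 1
  congr 1
  · congr 1
    · by_cases h : k + 1 = j
      · subst h; simp
      · rw [if_neg h, if_neg (by omega)]; simp
    · by_cases h : k = j
      · subst h; simp
      · rw [if_neg h]; simp
  · by_cases h : k - 1 = j
    · subst h; simp
    · rw [if_neg h, if_neg (by omega)]; simp

lemma exists_of_lie_E_eq_zero (hv : IsWeightBasis π c s v) {w : V} (hw : π.lie E w = 0)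
    (h0 : w ≠ 0) : ∃ k : ℕ, s = -(2 * k) := by
  have hne : (v.repr w).support.Nonempty := by
    rw [Finsupp.support_nonempty_iff]
    exact (v.repr.map_ne_zero_iff).mpr h0
  set k := (v.repr w).support.max' hne
  set l := (v.repr w).support.min' hne
  have hlk : l ≤ k := Finset.min'_le_max' _ hne
  have hk0 : v.repr w k ≠ 0 := Finsupp.mem_support_iff.mp (Finset.max'_mem _ hne)
  have hl0 : v.repr w l ≠ 0 := Finsupp.mem_support_iff.mp (Finset.min'_mem _ hne)
  have hk : ∀ j, k < j → v.repr w j = 0 := fun j hj => by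
    by_contra h
    exact (Finset.le_max' _ j (Finsupp.mem_support_iff.mpr h)).not_gt hj
  have hl : ∀ j, j < l → v.repr w j = 0 := fun j hj => by
    by_contra h
    exact (Finset.min'_le _ j (Finsupp.mem_support_iff.mpr h)).not_gt hj
  have hI : (Complex.I / 4) ≠ 0 := by simp
  have e1 := hv.repr_lie_E w (k + 1)
  have e2 := hv.repr_lie_E w (l - 1)
  rw [hw, map_zero, Finsupp.zero_apply, hk (k + 1) (by omega), hk (k + 1 + 1) (by omega),
    add_sub_cancel_right] at e1
  rw [hw, map_zero, Finsupp.zero_apply, hl (l - 1) (by omega), hl (l - 1 - 1) (by omega),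
    sub_add_cancel] at e2
  have e1' := (mul_eq_zero.mp e1.symm).resolve_left hI
  have e2' := (mul_eq_zero.mp e2.symm).resolve_left hI
  have hsk : s + 2 * k = 0 := by
    have : (s + 2 * k) * v.repr w k = 0 := by
      rw [← e1']; push_cast; ring
    exact (mul_eq_zero.mp this).resolve_right hk0
  have hsl : s - 2 * l = 0 := by
    have : (s - 2 * l) * v.repr w l = 0 := by
      rw [← neg_eq_zero, ← e2']; push_cast; ring
    exact (mul_eq_zero.mp this).resolve_right hl0
  have hkl : (k : ℂ) = ((-l : ℤ) : ℂ) := by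
    push_cast
    linear_combination (1 / 2 : ℂ) * (hsk - hsl)
  have hkl' : k = -l := by exact_mod_cast hkl
  obtain ⟨m, hm⟩ := Int.eq_ofNat_of_zero_le (show 0 ≤ k by omega)
  refine ⟨m, ?_⟩
  rw [hm] at hsk
  push_cast at hsk
  linear_combination hsk

lemma exists_lie_E_eq_zero (hv : IsWeightBasis π c s v) {k : ℕ} (hs : s = -(2 * k)) :
    ∃ w, w ≠ 0 ∧ π.lie E w = 0 := by
  set F := Submodule.span ℂ (v '' Set.Icc (-k : ℤ) k) with hF
  have hfin : FiniteDimensional ℂ F :=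
    FiniteDimensional.span_of_finite ℂ ((Set.finite_Icc _ _).image _)
  have hmem : ∀ j : ℤ, -k ≤ j → j ≤ k → v j ∈ F := fun j h1 h2 =>
    Submodule.subset_span ⟨j, ⟨h1, h2⟩, rfl⟩
  have hE : ∀ w ∈ F, π.lie E w ∈ F := by
    intro w hw
    induction hw using Submodule.span_induction with
    | mem w h =>
      obtain ⟨j, ⟨hj1, hj2⟩, rfl⟩ := h
      rw [hv.lie_E]
      refine F.smul_mem _ (F.sub_mem (F.sub_mem ?_ (F.smul_mem _ (hmem j hj1 hj2))) ?_)
      · rcases hj2.eq_or_lt with rfl | h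
        · rw [hs]; simp
        · exact F.smul_mem _ (hmem _ (by omega) (by omega))
      · rcases hj1.eq_or_lt with rfl | h
        · rw [hs]; simp
        · exact F.smul_mem _ (hmem _ (by omega) (by omega))
    | zero => rw [map_zero]; exact F.zero_mem
    | add y z _ _ h1 h2 => rw [map_add]; exact F.add_mem h1 h2
    | smul c y _ h => rw [map_smul]; exact F.smul_mem c h
  have hℓ : ∀ w, v.constr ℂ (fun _ => (1 : ℂ)) (π.lie E w) = 0 := by
    intro w
    suffices h : v.constr ℂ (fun _ => (1 : ℂ)) ∘ₗ π.lie E = 0 from LinearMap.congr_fun h w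
    refine v.ext fun k => ?_
    rw [LinearMap.comp_apply, hv.lie_E]
    simp only [map_smul, map_sub, Module.Basis.constr_basis, smul_eq_mul, LinearMap.zero_apply]
    ring
  have hns : ¬ Function.Surjective ((π.lie E).restrict hE) := by
    intro h
    obtain ⟨w, hw⟩ := h ⟨v 0, hmem 0 (by omega) (by omega)⟩
    have := hℓ w.1
    rw [show π.lie E w.1 = v 0 from congrArg Subtype.val hw, Module.Basis.constr_basis] at this
    exact one_ne_zero this
  rw [← LinearMap.injective_iff_surjective, injective_iff_map_eq_zero] at hns
  push Not at hns
  obtain ⟨w, hw, hw0⟩ := hns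
  exact ⟨w.1, fun h => hw0 (Subtype.ext h), congrArg Subtype.val hw⟩

lemma H0_eq_bot_iff (hv : IsWeightBasis π c s v) : π.H0 = ⊥ ↔ ¬ ∃ k : ℕ, s = -(2 * k) := by
  rw [GKModule.H0_eq_bot_iff]
  constructor
  · rintro h ⟨k, hk⟩
    obtain ⟨w, hw0, hw⟩ := hv.exists_lie_E_eq_zero hk
    exact hw0 (h w hw)
  · intro h w hw
    by_contra h0
    exact h (hv.exists_of_lie_E_eq_zero hw h0)

end IsWeightBasis

lemma principalSeries_H0 (σ : M →* ℂˣ) (lam : ℂ) : (principalSeries σ lam).H0 = ⊥ ↔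
    ¬ ∃ n : ℕ, Odd n ∧ lam = -((n : ℂ) / 2) := by
  rw [(isWeightBasis_weightBasis σ lam).H0_eq_bot_iff, not_iff_not]
  constructor
  · rintro ⟨k, hk⟩
    refine ⟨2 * k + 1, odd_two_mul_add_one k, ?_⟩
    push_cast
    linear_combination (1 / 2 : ℂ) * hk
  · rintro ⟨_, ⟨k, rfl⟩, hk⟩
    refine ⟨k, ?_⟩
    push_cast at hk
    linear_combination (2 : ℂ) * hk

/-- The linear automorphism of `ℂ²` given by an invertible matrix. -/
def planeEquiv (p q p' q' : ℂ) (h : p * q' - q * p' ≠ 0) : (ℂ × ℂ) ≃ₗ[ℂ] ℂ × ℂ where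
  toFun u := (p * u.1 + q * u.2, p' * u.1 + q' * u.2)
  invFun u := ((p * q' - q * p')⁻¹ * (q' * u.1 - q * u.2),
    (p * q' - q * p')⁻¹ * (p * u.2 - p' * u.1))
  map_add' u w := by ext <;> simp <;> ring
  map_smul' z u := by ext <;> simp <;> ring
  left_inv u := by
    ext
    · simp only; linear_combination u.1 * inv_mul_cancel₀ h
    · simp only; linear_combination u.2 * inv_mul_cancel₀ h
  right_inv u := by
    ext
    · simp only; linear_combination u.1 * inv_mul_cancel₀ h
    · simp only; linear_combination u.2 * inv_mul_cancel₀ h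

lemma planeEquiv_apply {p q p' q' : ℂ} (h : p * q' - q * p' ≠ 0) (u : ℂ × ℂ) :
    planeEquiv p q p' q' h u = (p * u.1 + q * u.2, p' * u.1 + q' * u.2) := rfl

section

variable {V : Type*} [AddCommGroup V] [Module ℂ V] {π : GKModule V} {σ : M →* ℂˣ} {lam : ℂ}

lemma mul_detM_genM (σ : M →* ℂˣ) : ((σ * detM) genM : ℂ) = -(σ genM : ℂ) := by
  rw [MonoidHom.mul_apply, Units.val_mul, detM_genM, mul_neg_one]

lemma GKModule.IsIso.principal_coinvariants (hπ : π.IsIso (principalSeries σ lam))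
    (hlam : ∀ j : ℤ, lam ≠ 1 / 2 + (j : ℂ)) :
    π.HasCoinvariants (fun u : ℂ × ℂ => ((2 * lam + 1 - 2) * u.2, (2 * lam + 1) * u.1 + 2 * u.2))
      (fun u : ℂ × ℂ => ((σ genM : ℂ) * u.1, (σ genM : ℂ) * u.2)) := by
  refine hπ.hasCoinvariants ((isWeightBasis_weightBasis σ lam).hasCoinvariants fun k hk => ?_)
  refine hlam (-k - 1) ?_
  push_cast
  linear_combination (1 / 2 : ℂ) * hk

lemma GKModule.IsIso.principal_cohomology1 (hπ : π.IsIso (principalSeries σ lam))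
    (hlam : ∀ j : ℤ, lam ≠ 1 / 2 + (j : ℂ)) (h0 : lam ≠ 0) :
    π.cohomology1.IsIsoTo ((charRep (σ * detM) (lam - 1 / 2)).prod
      (charRep (σ * detM) (-lam - 1 / 2))) := by
  have hA : 1 * (1 - 2 * lam) - 1 * (1 + 2 * lam) ≠ 0 := by
    rw [show 1 * (1 - 2 * lam) - 1 * (1 + 2 * lam) = -4 * lam by ring]
    exact mul_ne_zero (by norm_num) h0
  have h := (hπ.principal_coinvariants hlam).congr (planeEquiv 1 1 (1 + 2 * lam) (1 - 2 * lam) hA)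
    (h' := fun u : ℂ × ℂ => ((1 + 2 * lam) * u.1, (1 - 2 * lam) * u.2))
    (r' := fun u : ℂ × ℂ => ((σ genM : ℂ) * u.1, (σ genM : ℂ) * u.2))
    (fun u => by simp only [planeEquiv_apply]; ext <;> ring)
    (fun u => by simp only [planeEquiv_apply]; ext <;> ring)
  exact h.isIsoTo_prod (by ring) (by ring) (mul_detM_genM σ).symm (mul_detM_genM σ).symm

lemma GKModule.IsIso.principal_cohomology1_zero (hπ : π.IsIso (principalSeries σ 0)) :
    π.cohomology1.IsIsoTo (jordanRep (σ * detM) (-(1 / 2))) := by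
  have hlam : ∀ j : ℤ, (0 : ℂ) ≠ 1 / 2 + (j : ℂ) := fun j hj => by
    have h1 : ((1 + 2 * j : ℤ) : ℂ) = ((0 : ℤ) : ℂ) := by
      push_cast; linear_combination (-2 : ℂ) * hj
    have h2 : 1 + 2 * j = 0 := by exact_mod_cast h1
    omega
  have hA : (0 : ℂ) * 1 - 1 * 1 ≠ 0 := by norm_num
  have h := (hπ.principal_coinvariants hlam).congr (planeEquiv 0 1 1 1 hA)
    (h' := fun u : ℂ × ℂ => (1 * u.1 + u.2, 1 * u.2))
    (r' := fun u : ℂ × ℂ => ((σ genM : ℂ) * u.1, (σ genM : ℂ) * u.2))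
    (fun u => by simp only [planeEquiv_apply]; ext <;> ring)
    (fun u => by simp only [planeEquiv_apply]; ext <;> ring)
  exact h.isIsoTo_jordanRep (by ring) (mul_detM_genM σ).symm

lemma GKModule.IsIso.principal_lefschetz (hπ : π.IsIso (principalSeries σ lam))
    (hlam : ∀ j : ℤ, lam ≠ 1 / 2 + (j : ℂ)) (τ : M →* ℂˣ) (mu : ℂ) :
    π.lefschetz τ mu = iverson (τ = σ * detM ∧ mu = lam - 1 / 2) +
      iverson (τ = σ * detM ∧ mu = -lam - 1 / 2) := by
  have hH0 : π.H0 = ⊥ := by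
    rw [hπ.H0_eq_bot_iff, principalSeries_H0]
    rintro ⟨_, ⟨k, rfl⟩, hk⟩
    refine hlam (-k - 1) ?_
    rw [hk]
    push_cast
    ring
  rw [GKModule.lefschetz_of_H0_eq_bot hH0]
  by_cases h0 : lam = 0
  · subst h0
    rw [hπ.principal_cohomology1_zero.finrank_jordanRep, zero_sub, neg_zero, zero_sub]
  · exact (hπ.principal_cohomology1 hlam h0).finrank_prod τ mu

end

/-! ### Discrete series -/

lemma sl2_eq (X : sl2) : X = X.1 0 0 • H + (X.1 0 1 + X.1 1 0) • E + X.1 1 0 • Jsl := by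
  have h : X.1 0 0 + X.1 1 1 = 0 := by
    have : Matrix.trace X.1 = 0 := X.2
    rwa [Matrix.trace_fin_two] at this
  ext i j
  fin_cases i <;> fin_cases j <;> simp [H, E, Jsl]
  linear_combination h

lemma GKModule.isStable_of_generators {V : Type*} [AddCommGroup V] [Module ℂ V] (π : GKModule V)
    {S : Submodule ℂ V} (hH : ∀ v ∈ S, π.lie H v ∈ S) (hE : ∀ v ∈ S, π.lie E v ∈ S)
    (hJ : ∀ v ∈ S, π.lie Jsl v ∈ S) (hr : ∀ (t : ℝ), ∀ v ∈ S, π.act (rot t) v ∈ S)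
    (hT : ∀ v ∈ S, π.actM genM v ∈ S) : π.IsStable S := by
  constructor
  · intro X v hv
    rw [sl2_eq X, map_add, map_add, map_smul, map_smul, map_smul]
    exact S.add_mem (S.add_mem (S.smul_mem _ (hH v hv)) (S.smul_mem _ (hE v hv)))
      (S.smul_mem _ (hJ v hv))
  · intro k v hv
    obtain ⟨m, θ, hk⟩ := exists_M_mul_rot k
    have hk' : k = Subgroup.inclusion M_le_K m * rot θ := Subtype.ext hk
    rw [hk', map_mul, Module.End.mul_apply]
    rcases eq_one_or_genM m with rfl | rfl
    · rw [map_one, map_one]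
      exact hr θ v hv
    · exact hT _ (hr θ v hv)

/-- The span of the weight vectors of weight at least `2m` in absolute value. -/
def outerSpan (σ : M →* ℂˣ) (lam : ℂ) (m : ℤ) : Submodule ℂ (principalSpace σ lam) :=
  Submodule.span ℂ (weightBasis σ lam '' {k | m ≤ |k|})

lemma outerSpan_induction {σ : M →* ℂˣ} {lam : ℂ} {m : ℤ} {W : Type*} [AddCommGroup W] [Module ℂ W]
    (f : principalSpace σ lam →ₗ[ℂ] W) (R : Submodule ℂ W)
    (h : ∀ k : ℤ, m ≤ |k| → f (weightBasis σ lam k) ∈ R) {w : principalSpace σ lam}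
    (hw : w ∈ outerSpan σ lam m) : f w ∈ R := by
  have : outerSpan σ lam m ≤ R.comap f := by
    rw [outerSpan, Submodule.span_le]
    rintro _ ⟨k, hk, rfl⟩
    exact h k hk
  exact this hw

lemma mem_outerSpan {σ : M →* ℂˣ} {lam : ℂ} {m k : ℤ} (hk : m ≤ |k|) :
    weightBasis σ lam k ∈ outerSpan σ lam m := Submodule.subset_span ⟨k, hk, rfl⟩

section

variable {σ : M →* ℂˣ} {lam : ℂ} {m : ℤ}

lemma succ_mem_outerSpan (hlam : 2 * lam + 1 = 2 * m) {k : ℤ} (hk : m ≤ |k|) :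
    (2 * lam + 1 + 2 * k) • weightBasis σ lam (k + 1) ∈ outerSpan σ lam m := by
  by_cases h : k = -m
  · rw [h, hlam]; simp
  · refine Submodule.smul_mem _ _ (mem_outerSpan ?_)
    rw [le_abs] at *
    omega

lemma pred_mem_outerSpan (hlam : 2 * lam + 1 = 2 * m) {k : ℤ} (hk : m ≤ |k|) :
    (2 * lam + 1 - 2 * k) • weightBasis σ lam (k - 1) ∈ outerSpan σ lam m := by
  by_cases h : k = m
  · rw [h, hlam]; simp
  · refine Submodule.smul_mem _ _ (mem_outerSpan ?_)
    rw [le_abs] at *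
    omega

lemma outerSpan_stable (hlam : 2 * lam + 1 = 2 * m) :
    (principalSeries σ lam).IsStable (outerSpan σ lam m) := by
  have hv := isWeightBasis_weightBasis σ lam
  refine GKModule.isStable_of_generators _
    (fun v h => outerSpan_induction _ _ (fun k hk => ?_) h)
    (fun v h => outerSpan_induction _ _ (fun k hk => ?_) h)
    (fun v h => outerSpan_induction _ _ (fun k hk => ?_) h)
    (fun t v h => outerSpan_induction _ _ (fun k hk => ?_) h)
    (fun v h => outerSpan_induction _ _ (fun k hk => ?_) h)
  · rw [hv.lie_H]
    exact Submodule.smul_mem _ _ (Submodule.add_mem _ (succ_mem_outerSpan hlam hk)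
      (pred_mem_outerSpan hlam hk))
  · rw [hv.lie_E]
    exact Submodule.smul_mem _ _ (Submodule.sub_mem _ (Submodule.sub_mem _
      (succ_mem_outerSpan hlam hk) (Submodule.smul_mem _ _ (mem_outerSpan hk)))
      (pred_mem_outerSpan hlam hk))
  · rw [weightBasis_apply, lie_Jsl_weightVec, ← weightBasis_apply]
    exact Submodule.smul_mem _ _ (mem_outerSpan hk)
  · rw [weightBasis_apply, GKModule.act_rot_of_eigen _ (lie_Jsl_weightVec σ lam k),
      ← weightBasis_apply]
    exact Submodule.smul_mem _ _ (mem_outerSpan hk)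
  · rw [hv.act_T]
    exact Submodule.smul_mem _ _ (mem_outerSpan (by rwa [abs_neg]))

lemma outerSpan_le_of_stable (hm : 0 < m) (hlam : 2 * lam + 1 = 2 * m)
    {R : Submodule ℂ (principalSpace σ lam)} (hR : R ≠ ⊥)
    (hst : (principalSeries σ lam).IsStable R) : outerSpan σ lam m ≤ R := by
  have hshift : ∀ ε : ℤ, ε * ε = 1 → ∀ k, weightVec σ lam k ∈ R → k ≠ -ε * m →
      weightVec σ lam (k + ε) ∈ R := by
    intro ε hε k hk hkm
    have h := hst.1 (shift ε) _ hk
    rw [lie_shift_weightVec hε, hlam] at h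
    refine (R.smul_mem_iff ?_).mp h
    intro h0
    have h1 : (2 * m + 2 * ε * k : ℤ) = 0 := by exact_mod_cast h0
    apply hkm
    have h2 : m + ε * k = 0 := by linarith
    linear_combination (-k) * hε + ε * h2
  have hT : ∀ k, weightVec σ lam k ∈ R → weightVec σ lam (-k) ∈ R := by
    intro k hk
    have h := hst.2 (Subgroup.inclusion M_le_K genM) _ hk
    have h2 := (isWeightBasis_weightBasis σ lam).act_T k
    rw [weightBasis_apply, weightBasis_apply] at h2
    change (principalSeries σ lam).actM genM _ ∈ R at h
    rw [h2] at h
    exact (R.smul_mem_iff (Units.ne_zero _)).mp h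
  obtain ⟨k, hk⟩ : ∃ k, weightVec σ lam k ∈ R := by
    by_contra! hno
    have htop := ((principalSeries σ lam).restrict R hst).iSup_eigenspace_Jsl
    have hbot : ∀ k : ℤ, Module.End.eigenspace
        (((principalSeries σ lam).restrict R hst).lie Jsl) (2 * Complex.I * k) = ⊥ := by
      intro k
      rw [Submodule.eq_bot_iff]
      intro f hf
      have hf' : (principalSeries σ lam).lie Jsl f.1 = (2 * Complex.I * k) • f.1 :=
        congrArg Subtype.val (Module.End.mem_eigenspace_iff.mp hf)
      have h1 := eq_smul_weightVec hf'
      by_contra h0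
      refine hno k ((R.smul_mem_iff (s := evalOne σ lam f.1) ?_).mp (h1 ▸ f.2))
      intro h2
      rw [h2, zero_smul] at h1
      exact h0 (Subtype.ext h1)
    simp only [hbot, iSup_bot] at htop
    refine hR ((Submodule.eq_bot_iff _).mpr fun x hx => ?_)
    have : (⟨x, hx⟩ : R) ∈ (⊥ : Submodule ℂ R) := by rw [htop]; trivial
    exact congrArg Subtype.val ((Submodule.mem_bot ℂ).mp this)
  obtain ⟨k, hkm, hk⟩ : ∃ k, -m < k ∧ weightVec σ lam k ∈ R := by
    rcases lt_or_ge (-m) k with h | h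
    · exact ⟨k, h, hk⟩
    · exact ⟨-k, by omega, hT k hk⟩
  have hup : ∀ l, k ≤ l → weightVec σ lam l ∈ R := by
    intro l hl
    induction l, hl using Int.leInduction with
    | base => exact hk
    | succ l hl ih => exact hshift 1 (by norm_num) l ih (by omega)
  have hdown : ∀ l : ℤ, m ≤ l → weightVec σ lam l ∈ R := by
    intro l hl
    have : ∀ i : ℕ, weightVec σ lam (max k l - i) ∈ R ∨ max k l - i < l := by
      intro i
      induction i with
      | zero => exact Or.inl (hup _ (by simp))
      | succ i ih =>
        rcases lt_or_ge (max k l - (i + 1 : ℕ)) l with h | h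
        · exact Or.inr h
        · left
          have := hshift (-1) (by norm_num) _ (ih.resolve_right (by push_cast at h; omega))
            (by push_cast at h; omega)
          rw [show max k l - ((i + 1 : ℕ) : ℤ) = max k l - i + -1 by push_cast; ring]
          exact this
    have h1 := this (max k l - l).toNat
    rw [show max k l - ((max k l - l).toNat : ℤ) = l by omega] at h1
    exact h1.resolve_right (lt_irrefl _)
  rw [outerSpan, Submodule.span_le]
  rintro _ ⟨l, hl, rfl⟩
  rw [weightBasis_apply]
  rcases le_abs.mp (show m ≤ |l| from hl) with h | h
  · exact hdown l h
  · have := hT _ (hdown _ h)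
    rwa [neg_neg] at this

lemma socle_eq (hm : 0 < m) (hlam : 2 * lam + 1 = 2 * m) :
    (principalSeries σ lam).socle = outerSpan σ lam m := by
  refine le_antisymm (sInf_le ⟨?_, outerSpan_stable hlam⟩)
    (le_sInf fun R hR => outerSpan_le_of_stable hm hlam hR.1 hR.2)
  intro h
  have h1 : weightBasis σ lam m ∈ outerSpan σ lam m := mem_outerSpan (le_abs_self m)
  rw [h, Submodule.mem_bot] at h1
  exact (weightBasis σ lam).ne_zero m h1

/-- The functionals given by the sums of the coordinates of weight at least `2m`, for `ε = 1`, and at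
most `-2m`, for `ε = -1`. -/
def halfSum (σ : M →* ℂˣ) (lam : ℂ) (m ε : ℤ) : principalSpace σ lam →ₗ[ℂ] ℂ :=
  (weightBasis σ lam).constr ℂ fun k => if m ≤ ε * k then 1 else 0

lemma halfSum_basis (ε k : ℤ) :
    halfSum σ lam m ε (weightBasis σ lam k) = if m ≤ ε * k then 1 else 0 :=
  (weightBasis σ lam).constr_basis ℂ _ k

lemma halfSum_lie_E (hm : 0 < m) (hlam : 2 * lam + 1 = 2 * m) {ε : ℤ} (hε : ε = 1 ∨ ε = -1)
    {w : principalSpace σ lam} (hw : w ∈ outerSpan σ lam m) :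
    halfSum σ lam m ε ((principalSeries σ lam).lie E w) = 0 := by
  refine (Submodule.mem_bot ℂ).mp (outerSpan_induction (halfSum σ lam m ε ∘ₗ
    (principalSeries σ lam).lie E) ⊥ (fun k hk => (Submodule.mem_bot ℂ).mpr ?_) hw)
  rw [LinearMap.comp_apply, (isWeightBasis_weightBasis σ lam).lie_E, hlam]
  simp only [map_smul, map_sub, smul_eq_mul, halfSum_basis]
  refine mul_eq_zero_of_right _ ?_
  rcases hε with rfl | rfl <;> rcases le_abs.mp hk with h | h
  · by_cases h1 : k = m
    · subst h1
      rw [if_pos (by omega), if_pos (by omega), if_neg (by omega)]; ring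
    · rw [if_pos (by omega), if_pos (by omega), if_pos (by omega)]; ring
  · rw [if_neg (by omega), if_neg (by omega), if_neg (by omega)]; ring
  · rw [if_neg (by omega), if_neg (by omega), if_neg (by omega)]; ring
  · by_cases h1 : k = -m
    · subst h1
      rw [if_neg (by omega), if_pos (by omega), if_pos (by omega)]; push_cast; ring
    · rw [if_pos (by omega), if_pos (by omega), if_pos (by omega)]; ring

lemma outerSpan_coinvariants (hm : 0 < m) (hlam : 2 * lam + 1 = 2 * m)
    {S : Submodule ℂ (principalSpace σ lam)}
    (hS : S = outerSpan σ lam m) (hst : (principalSeries σ lam).IsStable S) :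
    ((principalSeries σ lam).restrict S hst).HasCoinvariants
      (fun u : ℂ × ℂ => (2 * m * u.1, 2 * m * u.2))
      (fun u : ℂ × ℂ => ((σ genM : ℂ) * u.1, -(σ genM : ℂ) * u.2)) := by
  have hv := isWeightBasis_weightBasis σ lam
  set v := weightBasis σ lam with hvdef
  have hmem : ∀ k : ℤ, m ≤ |k| → v k ∈ S := fun k hk => hS ▸ mem_outerSpan hk
  have hm1 : m ≤ |m| := le_abs_self m
  have hm2 : m ≤ |(-m)| := by rw [abs_neg]; exact hm1
  let j : ℂ × ℂ →ₗ[ℂ] S := (LinearMap.toSpanSingleton ℂ S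
      (⟨v m, hmem m hm1⟩ + ⟨v (-m), hmem _ hm2⟩)).coprod
    (LinearMap.toSpanSingleton ℂ S (⟨v m, hmem m hm1⟩ - ⟨v (-m), hmem _ hm2⟩))
  have hj : ∀ u, (j u).1 = u.1 • (v m + v (-m)) + u.2 • (v m - v (-m)) := fun u => rfl
  let L : S →ₗ[ℂ] ℂ × ℂ := ((1 / 2 : ℂ) • LinearMap.prod (halfSum σ lam m 1 + halfSum σ lam m (-1))
    (halfSum σ lam m 1 - halfSum σ lam m (-1))) ∘ₗ S.subtype
  have hL : ∀ w, L w = ((1 / 2) * (halfSum σ lam m 1 w.1 + halfSum σ lam m (-1) w.1),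
      (1 / 2) * (halfSum σ lam m 1 w.1 - halfSum σ lam m (-1) w.1)) := fun w => rfl
  have c1 : halfSum σ lam m 1 (v m) = 1 := by rw [halfSum_basis, if_pos (by omega)]
  have c2 : halfSum σ lam m 1 (v (-m)) = 0 := by rw [halfSum_basis, if_neg (by omega)]
  have c3 : halfSum σ lam m (-1) (v m) = 0 := by rw [halfSum_basis, if_neg (by omega)]
  have c4 : halfSum σ lam m (-1) (v (-m)) = 1 := by rw [halfSum_basis, if_pos (by omega)]
  refine ⟨L, j, fun u => ?_, fun w => ?_, ?_, fun u => ?_, fun u => ?_⟩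
  · rw [hL, hj]
    simp only [map_add, map_sub, map_smul, c1, c2, c3, c4, smul_eq_mul]
    ext <;> simp only <;> ring
  · have hw : w.1 ∈ outerSpan σ lam m := hS ▸ w.2
    rw [hL]
    change ((1 / 2) * (halfSum σ lam m 1 ((principalSeries σ lam).lie E w.1) +
      halfSum σ lam m (-1) ((principalSeries σ lam).lie E w.1)),
      (1 / 2) * (halfSum σ lam m 1 ((principalSeries σ lam).lie E w.1) -
      halfSum σ lam m (-1) ((principalSeries σ lam).lie E w.1))) = 0
    rw [halfSum_lie_E hm hlam (Or.inl rfl) hw, halfSum_lie_E hm hlam (Or.inr rfl) hw]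
    simp
  · set R := LinearMap.range (((principalSeries σ lam).restrict S hst).lie E) ⊔ LinearMap.range j
      with hR
    set R' := R.map S.subtype with hR'
    have hE : ∀ k : ℤ, m ≤ |k| → (principalSeries σ lam).lie E (v k) ∈ R' := fun k hk =>
      ⟨_, Submodule.mem_sup_left ⟨⟨v k, hmem k hk⟩, rfl⟩, rfl⟩
    have hjR : ∀ u, (j u).1 ∈ R' := fun u => ⟨j u, Submodule.mem_sup_right ⟨u, rfl⟩, rfl⟩
    have hpos : v m ∈ R' := by
      have := hjR (1 / 2, 1 / 2)
      rw [hj] at this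
      convert this using 1
      module
    have hneg : v (-m) ∈ R' := by
      have := hjR (1 / 2, -1 / 2)
      rw [hj] at this
      convert this using 1
      module
    have hup : ∀ k, m ≤ k → v k ∈ R' ∧ (2 * lam + 1 - 2 * k) • v (k - 1) ∈ R' := by
      intro k hk
      induction k, hk using Int.leInduction with
      | base => exact ⟨hpos, by rw [hlam, sub_self, zero_smul]; exact R'.zero_mem⟩
      | succ k hk ih =>
        refine ⟨hv.succ_mem (hE k (hk.trans (le_abs_self k))) ih.1 ih.2 ?_, ?_⟩
        · rw [hlam]
          have : (2 * m + 2 * k : ℤ) ≠ 0 := by omega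
          exact_mod_cast this
        · rw [add_sub_cancel_right]
          exact R'.smul_mem _ ih.1
    have hdown : ∀ k, m ≤ k → v (-k) ∈ R' ∧ (2 * lam + 1 - 2 * k) • v (-k + 1) ∈ R' := by
      intro k hk
      induction k, hk using Int.leInduction with
      | base => exact ⟨hneg, by rw [hlam, sub_self, zero_smul]; exact R'.zero_mem⟩
      | succ k hk ih =>
        have e : -(k + 1) = -k - 1 := by ring
        rw [e]
        refine ⟨hv.pred_mem (hE (-k) ?_) ih.1 ?_ ?_, ?_⟩
        · rw [abs_neg]; exact hk.trans (le_abs_self k)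
        · have := ih.2
          push_cast
          rwa [mul_neg, ← sub_eq_add_neg]
        · rw [hlam]
          have : (2 * m - 2 * -k : ℤ) ≠ 0 := by omega
          exact_mod_cast this
        · rw [sub_add_cancel]
          exact R'.smul_mem _ ih.1
    rw [eq_top_iff]
    intro w _
    have hw : w.1 ∈ outerSpan σ lam m := hS ▸ w.2
    have hw' : w.1 ∈ R' := by
      refine outerSpan_induction LinearMap.id R' (fun k hk => ?_) hw
      rcases le_abs.mp hk with h | h
      · exact (hup k h).1
      · have := (hdown _ h).1
        rwa [neg_neg] at this
    obtain ⟨w', hw'', hww⟩ := hw'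
    rwa [← Subtype.ext hww]
  · rw [hL]
    change ((1 / 2) * (halfSum σ lam m 1 ((principalSeries σ lam).lie H (j u).1) +
      halfSum σ lam m (-1) ((principalSeries σ lam).lie H (j u).1)),
      (1 / 2) * (halfSum σ lam m 1 ((principalSeries σ lam).lie H (j u).1) -
      halfSum σ lam m (-1) ((principalSeries σ lam).lie H (j u).1))) = _
    have d1 : halfSum σ lam m 1 ((principalSeries σ lam).lie H (v m)) = 2 * m := by
      rw [hv.lie_H, hlam]
      simp only [map_smul, map_add, hvdef, halfSum_basis, smul_eq_mul]
      rw [if_pos (by omega), if_neg (by omega)]; ring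
    have d2 : halfSum σ lam m 1 ((principalSeries σ lam).lie H (v (-m))) = 0 := by
      rw [hv.lie_H, hlam]
      simp only [map_smul, map_add, hvdef, halfSum_basis, smul_eq_mul]
      rw [if_neg (by omega), if_neg (by omega)]; ring
    have d3 : halfSum σ lam m (-1) ((principalSeries σ lam).lie H (v m)) = 0 := by
      rw [hv.lie_H, hlam]
      simp only [map_smul, map_add, hvdef, halfSum_basis, smul_eq_mul]
      rw [if_neg (by omega), if_neg (by omega)]; ring
    have d4 : halfSum σ lam m (-1) ((principalSeries σ lam).lie H (v (-m))) = 2 * m := by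
      rw [hv.lie_H, hlam]
      simp only [map_smul, map_add, hvdef, halfSum_basis, smul_eq_mul]
      rw [if_neg (by omega), if_pos (by omega)]; push_cast; ring
    rw [hj]
    simp only [map_add, map_sub, map_smul, d1, d2, d3, d4, smul_eq_mul]
    ext <;> simp only <;> ring
  · rw [hL]
    change ((1 / 2) * (halfSum σ lam m 1 ((principalSeries σ lam).actM genM (j u).1) +
      halfSum σ lam m (-1) ((principalSeries σ lam).actM genM (j u).1)),
      (1 / 2) * (halfSum σ lam m 1 ((principalSeries σ lam).actM genM (j u).1) -
      halfSum σ lam m (-1) ((principalSeries σ lam).actM genM (j u).1))) = _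
    rw [hj]
    simp only [map_add, map_sub, map_smul, hv.act_T, neg_neg, c1, c2, c3, c4, smul_eq_mul]
    ext <;> simp only <;> ring

end

lemma two_mul_natCast_div (r : ℕ) :
    2 * (((2 * r + 1 : ℕ) : ℂ) / 2) + 1 = 2 * ((r + 1 : ℤ) : ℂ) := by
  push_cast; ring

lemma discreteSeries_H0 {n : ℕ} : (discreteSeries n).H0 = ⊥ := by
  have h : (principalSeries 1 ((n : ℂ) / 2)).H0 = ⊥ := by
    rw [principalSeries_H0]
    rintro ⟨l, hl, h⟩
    have h1 : ((n + l : ℕ) : ℂ) = ((0 : ℕ) : ℂ) := by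
      push_cast; linear_combination (2 : ℂ) * h
    have h2 : n + l = 0 := by exact_mod_cast h1
    have := hl.pos
    omega
  rw [GKModule.H0_eq_bot_iff] at *
  intro w hw
  exact Subtype.ext (h w.1 (congrArg Subtype.val hw))

section

variable {V : Type*} [AddCommGroup V] [Module ℂ V] {π : GKModule V}

lemma GKModule.IsIso.discrete_cohomology1 {n : ℕ} (hn : Odd n)
    (hπ : π.IsIso (discreteSeries n)) : π.cohomology1.IsIsoTo
      ((charRep detM (((n : ℂ) - 1) / 2)).prod (charRep 1 (((n : ℂ) - 1) / 2))) := by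
  obtain ⟨r, rfl⟩ := hn
  have hm : (0 : ℤ) < r + 1 := by omega
  have h := hπ.hasCoinvariants (outerSpan_coinvariants (σ := 1) hm (two_mul_natCast_div r)
    (socle_eq hm (two_mul_natCast_div r)) (GKModule.socle_stable _))
  refine h.isIsoTo_prod (by push_cast; ring) (by push_cast; ring) ?_ ?_
  · rw [detM_genM]; simp
  · simp

lemma detM_ne_one : detM ≠ 1 := by
  intro h
  have := detM_genM
  rw [h] at this
  norm_num at this

lemma eq_one_or_detM (τ : M →* ℂˣ) : τ = 1 ∨ τ = detM := by
  rcases char_genM τ with h | h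
  · exact Or.inl (char_ext (by rw [h]; simp))
  · exact Or.inr (char_ext (by rw [h, detM_genM]))

lemma GKModule.IsIso.discrete_lefschetz {n : ℕ} (hn : Odd n)
    (hπ : π.IsIso (discreteSeries n)) (τ : M →* ℂˣ) (mu : ℂ) :
    π.lefschetz τ mu = iverson (mu = ((n : ℂ) - 1) / 2) := by
  rw [GKModule.lefschetz_of_H0_eq_bot (hπ.H0_eq_bot_iff.mpr discreteSeries_H0),
    (hπ.discrete_cohomology1 hn).finrank_prod]
  rcases eq_one_or_detM τ with rfl | rfl
  · simp [iverson, detM_ne_one.symm]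
  · simp [iverson, detM_ne_one]

end

/-! ### Finite-dimensional representations -/

section

variable {V W : Type*} [AddCommGroup V] [Module ℂ V] [AddCommGroup W] [Module ℂ W]

lemma GKModule.cohomology0_isIsoTo (π : GKModule V) {v : V} (h0 : v ≠ 0)
    (hker : ∀ w, π.lie E w = 0 ↔ ∃ z : ℂ, z • v = w) {σ : M →* ℂˣ} {lam : ℂ}
    (hH : π.lie H v = (2 * lam) • v) (hT : π.actM genM v = (σ genM : ℂ) • v) :
    π.cohomology0.IsIsoTo (charRep σ lam) := by
  have hspan : π.H0 = Submodule.span ℂ {v} := by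
    ext w
    rw [π.mem_H0_iff, hker, Submodule.mem_span_singleton]
  let e : ℂ ≃ₗ[ℂ] π.H0 := (LinearEquiv.toSpanNonzeroSingleton ℂ V v h0).trans
    (LinearEquiv.ofEq _ _ hspan.symm)
  have he : ∀ z, (e z).1 = z • v := fun z => rfl
  refine AModule.isIsoTo_charRep _ e.symm (fun w => ?_) (fun w => ?_)
  · obtain ⟨z, rfl⟩ := e.surjective w
    rw [LinearEquiv.symm_apply_eq, e.symm_apply_apply]
    refine Subtype.ext ?_
    change π.lie H (e z).1 = _
    rw [he, he, map_smul, hH, smul_smul, mul_comm]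
  · obtain ⟨z, rfl⟩ := e.surjective w
    rw [LinearEquiv.symm_apply_eq, e.symm_apply_apply]
    refine Subtype.ext ?_
    change π.actM genM (e z).1 = _
    rw [he, he, map_smul, hT, smul_smul, mul_comm]

lemma GKModule.IsIso.cohomology0_isIsoTo {π : GKModule V} {τ : GKModule W} (hπ : π.IsIso τ)
    {v : W} (h0 : v ≠ 0) (hker : ∀ w, τ.lie E w = 0 ↔ ∃ z : ℂ, z • v = w) {σ : M →* ℂˣ} {lam : ℂ}
    (hH : τ.lie H v = (2 * lam) • v) (hT : τ.actM genM v = (σ genM : ℂ) • v) :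
    π.cohomology0.IsIsoTo (charRep σ lam) := by
  obtain ⟨e, he, hk⟩ := hπ
  refine π.cohomology0_isIsoTo (v := e.symm v) (e.symm.map_ne_zero_iff.mpr h0) (fun w => ?_)
    (e.injective ?_) (e.injective ?_)
  · rw [← e.map_eq_zero_iff, he, hker]
    refine exists_congr fun z => ?_
    rw [← map_smul, LinearEquiv.symm_apply_eq]
  · rw [he, map_smul, e.apply_symm_apply, hH]
  · change e (π.act _ _) = _
    rw [hk, map_smul, e.apply_symm_apply]
    exact hT

end

lemma extendChar_genM (σ : M →* ℂˣ) : (extendChar σ (genM : G) : ℂ) = σ genM := by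
  unfold extendChar
  split_ifs with h
  · rw [h]; rfl
  · rcases char_genM σ with h1 | h1
    · exact absurd (char_ext (by rw [h1]; simp)) h
    · rw [h1]; exact signDet_T

open MvPolynomial in
lemma X_pow_mem (k : ℕ) (i : Fin 2) : (X i ^ (2 * k) : MvPolynomial (Fin 2) ℂ) ∈ polySpace k :=
  isHomogeneous_X_pow i (2 * k)

/-- The polynomials `X^{2k}`, for `i = 0`, and `Y^{2k}`, for `i = 1`. -/
def extremeVec (k : ℕ) (i : Fin 2) : polySpace k := ⟨_, X_pow_mem k i⟩

lemma extremeVec_ne_zero (k : ℕ) (i : Fin 2) : extremeVec k i ≠ 0 := fun h =>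
  pow_ne_zero (2 * k) (MvPolynomial.X_ne_zero i) (congrArg Subtype.val h)

open MvPolynomial in
lemma derivPoly_E (p : MvPolynomial (Fin 2) ℂ) : derivPoly E.1 p = X 0 * pderiv 1 p := by
  have : derivPoly E.1 = (X 0 : MvPolynomial (Fin 2) ℂ) • pderiv 1 :=
    MvPolynomial.derivation_ext fun i => by
      fin_cases i <;> simp [derivPoly_X, E]
  rw [this]
  rfl

lemma finDim_lie_val (σ : M →* ℂˣ) (k : ℕ) (A : sl2) (p : polySpace k) :
    ((finDim σ k).lie A p).1 = derivPoly A.1 p.1 := rfl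

lemma finDim_lie_H_extremeVec (σ : M →* ℂˣ) (k : ℕ) (i : Fin 2) :
    (finDim σ k).lie H (extremeVec k i) = (H.1 i i * (2 * k) : ℂ) • extremeVec k i := by
  refine Subtype.ext ?_
  rw [finDim_lie_val]
  change derivPoly H.1 (MvPolynomial.X i ^ (2 * k)) = _ • (MvPolynomial.X i ^ (2 * k))
  have hX : derivPoly H.1 (MvPolynomial.X i) = H.1 i i • MvPolynomial.X i := by
    rw [derivPoly_X, Fin.sum_univ_two, MvPolynomial.smul_eq_C_mul]
    fin_cases i <;> simp [H]
  rw [Derivation.leibniz_pow, hX]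
  rcases k with _ | k
  · simp
  · rw [show 2 * (k + 1) = 2 * k + 1 + 1 by ring, Nat.add_sub_cancel]
    simp only [smul_eq_mul, nsmul_eq_mul, MvPolynomial.smul_eq_C_mul, map_mul, map_natCast,
      Nat.cast_add, Nat.cast_mul, Nat.cast_ofNat, Nat.cast_one, map_add, map_one, map_ofNat]
    ring

lemma finDim_actM_extremeVec (σ : M →* ℂˣ) (k : ℕ) (i : Fin 2) :
    (finDim σ k).actM genM (extremeVec k i) = (σ genM : ℂ) • extremeVec k i := by
  change (extendChar σ (genM : G) : ℂ) • delta k T (extremeVec k i) = _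
  rw [extendChar_genM]
  congr 1
  refine Subtype.ext ?_
  change (((|(!![-1, 0; 0, 1] : Mat).det| ^ k)⁻¹ : ℝ) : ℂ) •
    substPoly ((!![-1, 0; 0, 1] : Mat).map Complex.ofReal) (MvPolynomial.X i ^ (2 * k))
    = MvPolynomial.X i ^ (2 * k)
  rw [map_pow, substPoly_X, Fin.sum_univ_two]
  fin_cases i
  · simp [pow_mul]
  · simp

/-- The coefficient of `Y^{2k}`. -/
def topCoeff (k : ℕ) : polySpace k →ₗ[ℂ] ℂ :=
  MvPolynomial.lcoeff ℂ (Finsupp.single 1 (2 * k)) ∘ₗ (polySpace k).subtype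

lemma topCoeff_lie_E (σ : M →* ℂˣ) (k : ℕ) (p : polySpace k) :
    topCoeff k ((finDim σ k).lie E p) = 0 := by
  change MvPolynomial.coeff _ (derivPoly E.1 p.1) = 0
  rw [derivPoly_E, MvPolynomial.coeff_X_mul', if_neg]
  simp

lemma topCoeff_extremeVec (k : ℕ) : topCoeff k (extremeVec k 1) = 1 := by
  change MvPolynomial.coeff _ (MvPolynomial.X 1 ^ (2 * k)) = 1
  simp [MvPolynomial.coeff_X_pow]

lemma finDim_range_sup (σ : M →* ℂˣ) (k : ℕ) : LinearMap.range ((finDim σ k).lie E) ⊔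
    LinearMap.range (LinearMap.toSpanSingleton ℂ _ (extremeVec k 1)) = ⊤ := by
  set R := LinearMap.range ((finDim σ k).lie E) ⊔
    LinearMap.range (LinearMap.toSpanSingleton ℂ _ (extremeVec k 1)) with hR
  rw [eq_top_iff]
  intro p _
  suffices h : p.1 ∈ R.map (polySpace k).subtype by
    obtain ⟨q, hq, hqp⟩ := h
    rwa [← Subtype.ext hqp]
  have hp' : p.1.IsHomogeneous (2 * k) := p.2
  rw [p.1.as_sum]
  refine Submodule.sum_mem _ fun d hd => ?_
  have hdeg : d 0 + d 1 = 2 * k := by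
    have h : d.degree = 2 * k := by
      rw [Finsupp.degree_eq_weight_one]
      exact hp' (MvPolynomial.mem_support_iff.mp hd)
    rwa [Finsupp.degree_eq_sum, Fin.sum_univ_two] at h
  set z := MvPolynomial.coeff d p.1
  rcases hd0 : d 0 with _ | i
  · refine ⟨z • extremeVec k 1, Submodule.mem_sup_right ⟨z, rfl⟩, ?_⟩
    have hd' : d = Finsupp.single 1 (2 * k) := by
      ext j
      fin_cases j
      · simp [hd0]
      · simp; omega
    change z • MvPolynomial.X 1 ^ (2 * k) = _
    rw [hd', MvPolynomial.X_pow_eq_monomial, MvPolynomial.smul_monomial, smul_eq_mul, mul_one]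
  · set d' := d - Finsupp.single 0 1 with hd'
    have hdd : d = d' + Finsupp.single 0 1 := by
      ext j
      fin_cases j <;> simp [hd', hd0]
    have hd1 : d' 1 = d 1 := by simp [hd']
    have hd0' : d' 0 = i := by simp [hd', hd0]
    have hq : MvPolynomial.monomial (d' + Finsupp.single 1 1) (z / (d 1 + 1)) ∈ polySpace k := by
      refine MvPolynomial.isHomogeneous_monomial _ ?_
      rw [Finsupp.degree_eq_sum, Fin.sum_univ_two]
      simp [hd1, hd0']
      omega
    refine ⟨_, Submodule.mem_sup_left ⟨⟨_, hq⟩, rfl⟩, ?_⟩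
    change derivPoly E.1 (MvPolynomial.monomial _ _) = _
    have hne : (d 1 + 1 : ℂ) ≠ 0 := Nat.cast_add_one_ne_zero _
    rw [derivPoly_E, MvPolynomial.pderiv_monomial, add_tsub_cancel_right, MvPolynomial.X,
      MvPolynomial.monomial_mul, one_mul, add_comm (Finsupp.single 0 1), ← hdd]
    congr 1
    simp [hd1]
    field_simp

lemma finDim_ker_E (σ : M →* ℂˣ) (k : ℕ) (p : polySpace k) :
    (finDim σ k).lie E p = 0 ↔ ∃ z : ℂ, z • extremeVec k 0 = p := by
  have hfin : FiniteDimensional ℂ (polySpace k) := Module.Finite.iff_fg.mpr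
    (MvPolynomial.homogeneousSubmodule_fg (Fin 2) ℂ (2 * k))
  have hrange : LinearMap.range ((finDim σ k).lie E) = LinearMap.ker (topCoeff k) := by
    ext q
    constructor
    · rintro ⟨w, rfl⟩
      exact topCoeff_lie_E σ k w
    · intro hq
      have hq' : q ∈ LinearMap.range ((finDim σ k).lie E) ⊔
        LinearMap.range (LinearMap.toSpanSingleton ℂ _ (extremeVec k 1)) := by
        rw [finDim_range_sup]; trivial
      obtain ⟨_, ⟨w, rfl⟩, _, ⟨z, rfl⟩, rfl⟩ := Submodule.mem_sup.mp hq'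
      rw [LinearMap.mem_ker, map_add, topCoeff_lie_E, LinearMap.toSpanSingleton_apply, map_smul,
        topCoeff_extremeVec, zero_add, smul_eq_mul, mul_one] at hq
      rw [hq, map_zero, add_zero]
      exact ⟨w, rfl⟩
  have h1 := LinearMap.finrank_range_add_finrank_ker ((finDim σ k).lie E)
  have h2 := LinearMap.finrank_range_add_finrank_ker (topCoeff k)
  have h3 : LinearMap.range (topCoeff k) = ⊤ := LinearMap.range_eq_top.mpr fun z =>
    ⟨z • extremeVec k 1, by rw [map_smul, topCoeff_extremeVec, smul_eq_mul, mul_one]⟩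
  rw [h3, finrank_top, Module.finrank_self, ← hrange] at h2
  have h4 : Module.finrank ℂ (LinearMap.ker ((finDim σ k).lie E)) = 1 := by omega
  have hmem : (finDim σ k).lie E (extremeVec k 0) = 0 := by
    refine Subtype.ext ?_
    change derivPoly E.1 (MvPolynomial.X 0 ^ (2 * k)) = 0
    rw [derivPoly_E, Derivation.leibniz_pow]
    simp
  constructor
  · intro hp
    obtain ⟨z, hz⟩ := (finrank_eq_one_iff_of_nonzero' (⟨extremeVec k 0, hmem⟩ :
      LinearMap.ker ((finDim σ k).lie E)) fun h =>
        extremeVec_ne_zero k 0 (congrArg Subtype.val h)).mp h4 ⟨p, hp⟩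
    exact ⟨z, congrArg Subtype.val hz⟩
  · rintro ⟨z, rfl⟩
    rw [map_smul, hmem, smul_zero]

lemma finDim_coinvariants (σ : M →* ℂˣ) (k : ℕ) : (finDim σ k).HasCoinvariants
    (fun u : ℂ => -(2 * k) * u) (fun u : ℂ => (σ genM : ℂ) * u) := by
  refine ⟨topCoeff k, LinearMap.toSpanSingleton ℂ _ (extremeVec k 1), fun u => ?_,
    topCoeff_lie_E σ k, finDim_range_sup σ k, fun u => ?_, fun u => ?_⟩
  · rw [LinearMap.toSpanSingleton_apply, map_smul, topCoeff_extremeVec, smul_eq_mul, mul_one]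
  · rw [LinearMap.toSpanSingleton_apply, map_smul, finDim_lie_H_extremeVec, map_smul, map_smul,
      topCoeff_extremeVec]
    simp [H]
    ring
  · rw [LinearMap.toSpanSingleton_apply, map_smul, finDim_actM_extremeVec, map_smul, map_smul,
      topCoeff_extremeVec]
    simp
    ring

section

variable {V : Type*} [AddCommGroup V] [Module ℂ V] {π : GKModule V} {σ : M →* ℂˣ} {k : ℕ}

lemma GKModule.IsIso.finDim_cohomology0 (hπ : π.IsIso (finDim σ k)) :
    π.cohomology0.IsIsoTo (charRep σ (k : ℂ)) := by
  refine hπ.cohomology0_isIsoTo (extremeVec_ne_zero k 0) (finDim_ker_E σ k) ?_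
    (finDim_actM_extremeVec σ k 0)
  rw [finDim_lie_H_extremeVec]
  simp [H]

lemma GKModule.IsIso.finDim_cohomology1 (hπ : π.IsIso (finDim σ k)) :
    π.cohomology1.IsIsoTo (charRep (σ * detM) (-(k : ℂ) - 1)) :=
  (hπ.hasCoinvariants (finDim_coinvariants σ k)).isIsoTo_charRep (by ring) (mul_detM_genM σ).symm

end

end PGLTwo

end

theorem mainTheorem8 {V : Type*} [AddCommGroup V] [Module ℂ V] (π : PGLTwo.GKModule V) :
    (∀ (σ : PGLTwo.M →* ℂˣ) (lam : ℂ), π.IsIso (PGLTwo.principalSeries σ lam) →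
      (π.H0 = ⊥ ↔ ¬ ∃ n : ℕ, Odd n ∧ lam = -((n : ℂ) / 2)) ∧
      ((∀ j : ℤ, lam ≠ 1 / 2 + (j : ℂ)) →
        (lam ≠ 0 → π.cohomology1.IsIsoTo
          ((PGLTwo.charRep (σ * PGLTwo.detM) (lam - 1 / 2)).prod
            (PGLTwo.charRep (σ * PGLTwo.detM) (-lam - 1 / 2)))) ∧
        (lam = 0 → π.cohomology1.IsIsoTo
          (PGLTwo.jordanRep (σ * PGLTwo.detM) (-(1 / 2)))) ∧
        ∀ (τ : PGLTwo.M →* ℂˣ) (mu : ℂ), π.lefschetz τ mu =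
          PGLTwo.iverson (τ = σ * PGLTwo.detM ∧ mu = lam - 1 / 2) +
          PGLTwo.iverson (τ = σ * PGLTwo.detM ∧ mu = -lam - 1 / 2))) ∧
    (∀ (σ : PGLTwo.M →* ℂˣ) (k : ℕ), π.IsIso (PGLTwo.finDim σ k) →
      π.cohomology0.IsIsoTo (PGLTwo.charRep σ (k : ℂ)) ∧
      π.cohomology1.IsIsoTo (PGLTwo.charRep (σ * PGLTwo.detM) (-(k : ℂ) - 1)) ∧
      ∀ (τ : PGLTwo.M →* ℂˣ) (mu : ℂ), π.lefschetz τ mu =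
        PGLTwo.iverson (τ = σ * PGLTwo.detM ∧ mu = -(k : ℂ) - 1) -
        PGLTwo.iverson (τ = σ ∧ mu = (k : ℂ))) ∧
    (∀ n : ℕ, Odd n → π.IsIso (PGLTwo.discreteSeries n) →
      π.H0 = ⊥ ∧
      π.cohomology1.IsIsoTo
        ((PGLTwo.charRep PGLTwo.detM (((n : ℂ) - 1) / 2)).prod
          (PGLTwo.charRep 1 (((n : ℂ) - 1) / 2))) ∧
      ∀ (τ : PGLTwo.M →* ℂˣ) (mu : ℂ), π.lefschetz τ mu =
        PGLTwo.iverson (mu = ((n : ℂ) - 1) / 2)) := by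
  refine ⟨fun σ lam hπ => ⟨?_, fun hlam => ⟨hπ.principal_cohomology1 hlam, ?_,
    hπ.principal_lefschetz hlam⟩⟩, fun σ k hπ => ⟨hπ.finDim_cohomology0, hπ.finDim_cohomology1, ?_⟩,
    fun n hn hπ => ⟨?_, hπ.discrete_cohomology1 hn, hπ.discrete_lefschetz hn⟩⟩
  · rw [hπ.H0_eq_bot_iff, PGLTwo.principalSeries_H0]
  · rintro rfl
    exact hπ.principal_cohomology1_zero
  · intro τ mu
    unfold PGLTwo.GKModule.lefschetz
    rw [hπ.finDim_cohomology0.finrank_charRep, hπ.finDim_cohomology1.finrank_charRep]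
    ring
  · exact hπ.H0_eq_bot_iff.mpr PGLTwo.discreteSeries_H0
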